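/- Let $S_f=\{p_1,\dots,p_s\}$ be a finite (possibly empty) set of primes, $S=S_f\cup\{\infty\}$, $\mathbb Q_\infty=\mathbb R$, $\mathbb Q_S=\prod_{p\in S}\mathbb Q_p$, and let $\mathbb Z_S=\mathbb Z[1/p_1,\dots,1/p_s]$ be the ring of $S$-integers, embedded diagonally in $\mathbb Q_S$. Let $d\ge 2$. Let $\mathrm{vol}$ (also written $d\mathbf v$) be the product measure on $\mathbb Q_S^d$ of Lebesgue measure on $\mathbb R^d$ and, for each $p\in S_f$, the Haar measure on $\mathbb Q_p^d$ with $\mathrm{vol}_p(\mathbb Z_p^d)=1$. Elements of $\mathbb Q_S^d$ are row vectors. Let $\mathrm{UL}_d(\mathbb R)=\mathrm{SL}_d(\mathbb R)$, $\mathrm{UL}_d(\mathbb Q_p)=\{g\in\mathrm{GL}_d(\mathbb Q_p):|\det g|_p=1\}$ for $p\in S_f$, $\mathrm{UL}_d(\mathbb Q_S)=\prod_{p\in S}\mathrm{UL}_d(\mathbb Q_p)$, and let $\mathrm{UL}_d(\mathbb Z_S)=\mathrm{SL}_d(\mathbb Z_S)$, embedded diagonally. Let $\mathrm{AUL}_d(\mathbb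 Q_S)=\mathbb Q_S^d\times\mathrm{UL}_d(\mathbb Q_S)$ with the group law $(\xi_1,\mathsf g_1)(\xi_2,\mathsf g_2)=(\xi_2+\xi_1\mathsf g_2,\mathsf g_1\mathsf g_2)$, and let $\mathrm{AUL}_d(\mathbb Z_S)=\mathbb Z_S^d\times\mathrm{UL}_d(\mathbb Z_S)$. The coset of $(\xi,\mathsf g)$ in $X=\mathrm{AUL}_d(\mathbb Z_S)\backslash\mathrm{AUL}_d(\mathbb Q_S)$ is identified with the unimodular affine $S$-lattice $\mathbb Z_S^d\mathsf g+\xi$. Let $\widetilde\mu_S$ be the Haar measure on $\mathrm{UL}_d(\mathbb Q_S)$ normalized so that $\mathrm{UL}_d(\mathbb Z_S)\backslash\mathrm{UL}_d(\mathbb Q_S)$ has measure $1$, and equip $X$ with the measure induced by $d\widetilde\mu_S\,d\mathbf v$ (that is, the product measure restricted to a fundamental domain), which is a probability measure. For a function $f$ on $\mathbb Q_S^d$ put $\widehat f(\Lambda)=\sum_{\mathbf k\in\Lambda}f(\mathbf k)$, $\Lambda\in X$. (a) For every bounded, compactly supported Borel function $f:\mathbb Q_S^d\to\mathbb R_{\ge0}$,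 the sum $\widehat f(\Lambda)$ converges for every $\Lambda\in X$, $\widehat f$ is integrable on $X$, and $$\int_X\widehat f\,d\widetilde\mu_S\,d\mathbf v=\int_{\mathbb Q_S^d}f(\mathbf v)\,d\mathbf v.$$ (b) For every bounded, compactly supported Borel function $F:(\mathbb Q_S^d)^2\to\mathbb R_{\ge0}$, the sum $\sum_{\mathbf k_1,\mathbf k_2\in\mathbb Z_S^d}F(\mathbf k_1\mathsf g+\mathbf v,\mathbf k_2\mathsf g+\mathbf v)$ converges for every $(\mathbf v,\mathsf g)$, defines an integrable function on $X$, and $$\int_X\ \sum_{\mathbf k_1,\mathbf k_2\in\mathbb Z_S^d}F(\mathbf k_1\mathsf g+\mathbf v,\mathbf k_2\mathsf g+\mathbf v)\,d\widetilde\mu_S\,d\mathbf v=\int_{(\mathbb Q_S^d)^2}F(\mathbf v_1,\mathbf v_2)\,d\mathbf v_1\,d\mathbf v_2+\int_{\mathbb Q_S^d}F(\mathbf v,\mathbf v)\,d\mathbf v.$$ In particular, for every Borel set $A\subseteq\mathbb Q_S^d$ with characteristic function $\chi_A$, $$\int_X\widehat{\chi_A}^{\,2}\,d\widetilde\mu_S\,d\mathbf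 v=\mathrm{vol}(A)^2+\mathrm{vol}(A),$$ as an identity in $[0,\infty]$. -/

import Mathlib

open MeasureTheory
open scoped ENNReal Matrix

noncomputable section

namespace SArith

instance factPrime (p : Nat.Primes) : Fact p.1.Prime := ⟨p.2⟩

instance padicMeasurableSpace (p : ℕ) [Fact p.Prime] : MeasurableSpace ℚ_[p] := borel _

instance padicBorelSpace (p : ℕ) [Fact p.Prime] : BorelSpace ℚ_[p] := ⟨rfl⟩

/-! Throughout, `S : Finset Nat.Primes` is the set of finite places; the infinite place is always
included and is kept as a separate factor. Vectors are row vectors. -/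

/-- The ring of `S`-integers: the rationals that are `p`-integral for every prime `p` outside `S`.
Its diagonal copy in `ℚ_S` is given by `ZS.toReal` and `ZS.toPadic`. -/
def ZS (S : Finset Nat.Primes) : Subring ℚ where
  carrier := {z | ∀ p : Nat.Primes, p ∉ S → padicNorm p.1 z ≤ 1}
  mul_mem' {a b} ha hb p hp := by
    rw [padicNorm.mul]
    exact mul_le_one₀ (ha p hp) (padicNorm.nonneg _) (hb p hp)
  one_mem' p _ := by simp
  add_mem' {a b} ha hb p hp := padicNorm.nonarchimedean.trans (max_le (ha p hp) (hb p hp))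
  zero_mem' p _ := by simp
  neg_mem' {a} ha p hp := by rw [padicNorm.neg]; exact ha p hp

/-- The embedding of the `S`-integers at the infinite place. -/
def ZS.toReal (S : Finset Nat.Primes) : ZS S →+* ℝ := (Rat.castHom ℝ).comp (ZS S).subtype

/-- The embedding of the `S`-integers at the finite place `p`. -/
def ZS.toPadic (S : Finset Nat.Primes) (p : S) : ZS S →+* ℚ_[p.1.1] :=
  (Rat.castHom ℚ_[p.1.1]).comp (ZS S).subtype

/-- The space `ℚ_S ^ d`. -/
abbrev QSVec (S : Finset Nat.Primes) (d : ℕ) : Type :=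
  (Fin d → ℝ) × ((p : S) → Fin d → ℚ_[p.1.1])

/-- The diagonal embedding of `ℤ_S ^ d` in `ℚ_S ^ d`. -/
def diagVec {S : Finset Nat.Primes} {d : ℕ} (k : Fin d → ZS S) : QSVec S d :=
  (fun i => ZS.toReal S (k i), fun p i => ZS.toPadic S p (k i))

/-- The compact open subset `ℤ_p ^ d` of `ℚ_p ^ d` (the closed unit ball of the sup norm). -/
def unitBall (p : ℕ) [Fact p.Prime] (d : ℕ) : TopologicalSpace.PositiveCompacts (Fin d → ℚ_[p]) where
  carrier := Metric.closedBall 0 1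
  isCompact' := isCompact_closedBall _ _
  interior_nonempty' :=
    ⟨0, Metric.ball_subset_interior_closedBall (Metric.mem_ball_self one_pos)⟩

/-- The Haar measure on `ℚ_p ^ d` that gives `ℤ_p ^ d` mass one. -/
def volPadic (p : ℕ) [Fact p.Prime] (d : ℕ) : Measure (Fin d → ℚ_[p]) :=
  Measure.addHaarMeasure (unitBall p d)

/-- The measure on `ℚ_S ^ d`: the product of Lebesgue measure and the normalized Haar measures at
the finite places. -/
def volS (S : Finset Nat.Primes) (d : ℕ) : Measure (QSVec S d) :=
  (volume : Measure (Fin d → ℝ)).prod (Measure.pi fun p : S => volPadic p.1.1 d)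

/-- `UL_d(ℚ_p)`: invertible matrices whose determinant has `p`-adic norm one. -/
def ULp (p : ℕ) [Fact p.Prime] (d : ℕ) : Subgroup (GL (Fin d) ℚ_[p]) where
  carrier := {g | ‖(g : Matrix (Fin d) (Fin d) ℚ_[p]).det‖ = 1}
  mul_mem' {a b} ha hb := by
    simp only [Set.mem_ofPred_eq] at ha hb ⊢
    rw [Units.val_mul, Matrix.det_mul, norm_mul, ha, hb, one_mul]
  one_mem' := by simp
  inv_mem' {a} ha := by
    simp only [Set.mem_ofPred_eq] at ha ⊢
    have h : ((a : Matrix (Fin d) (Fin d) ℚ_[p]) * ((a⁻¹ : GL (Fin d) ℚ_[p]) :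
        Matrix (Fin d) (Fin d) ℚ_[p])).det = 1 := by
      rw [← Units.val_mul, mul_inv_cancel]; simp
    rw [Matrix.det_mul] at h
    have h2 := congrArg norm h
    rwa [norm_mul, ha, one_mul, norm_one] at h2

/-- `UL_d(ℚ_S)`, the product of `SL_d(ℝ)` and the groups `UL_d(ℚ_p)` for `p ∈ S`. -/
def UL (S : Finset Nat.Primes) (d : ℕ) : Type :=
  Matrix.SpecialLinearGroup (Fin d) ℝ × ((p : S) → ULp p.1.1 d)

instance (S : Finset Nat.Primes) (d : ℕ) : Group (UL S d) :=
  inferInstanceAs (Group (Matrix.SpecialLinearGroup (Fin d) ℝ × ((p : S) → ULp p.1.1 d)))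

instance (S : Finset Nat.Primes) (d : ℕ) : TopologicalSpace (UL S d) :=
  inferInstanceAs
    (TopologicalSpace (Matrix.SpecialLinearGroup (Fin d) ℝ × ((p : S) → ULp p.1.1 d)))

instance (S : Finset Nat.Primes) (d : ℕ) : IsTopologicalGroup (UL S d) :=
  inferInstanceAs
    (IsTopologicalGroup (Matrix.SpecialLinearGroup (Fin d) ℝ × ((p : S) → ULp p.1.1 d)))

instance (S : Finset Nat.Primes) (d : ℕ) : MeasurableSpace (UL S d) := borel _

instance (S : Finset Nat.Primes) (d : ℕ) : BorelSpace (UL S d) := ⟨rfl⟩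

/-- The component of `g` at the infinite place, as a matrix. -/
def UL.realMat {S : Finset Nat.Primes} {d : ℕ} (g : UL S d) : Matrix (Fin d) (Fin d) ℝ :=
  (g.1 : Matrix (Fin d) (Fin d) ℝ)

/-- The component of `g` at the finite place `p`, as a matrix. -/
def UL.padicMat {S : Finset Nat.Primes} {d : ℕ} (g : UL S d) (p : S) :
    Matrix (Fin d) (Fin d) ℚ_[p.1.1] :=
  ((g.2 p : GL (Fin d) ℚ_[p.1.1]) : Matrix (Fin d) (Fin d) ℚ_[p.1.1])

/-- The right action `v ↦ v g` of `UL_d(ℚ_S)` on row vectors. -/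
def rowMul {S : Finset Nat.Primes} {d : ℕ} (v : QSVec S d) (g : UL S d) : QSVec S d :=
  (v.1 ᵥ* g.realMat, fun p => v.2 p ᵥ* g.padicMat p)

section lemmas

variable {S : Finset Nat.Primes} {d : ℕ}

lemma rowMul_mul (v : QSVec S d) (g h : UL S d) : rowMul v (g * h) = rowMul (rowMul v g) h :=
  Prod.ext (Matrix.vecMul_vecMul v.1 g.realMat h.realMat).symm
    (funext fun p => (Matrix.vecMul_vecMul (v.2 p) (g.padicMat p) (h.padicMat p)).symm)

lemma rowMul_one (v : QSVec S d) : rowMul v (1 : UL S d) = v :=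
  Prod.ext (Matrix.vecMul_one v.1) (funext fun p => Matrix.vecMul_one (v.2 p))

lemma rowMul_add (v w : QSVec S d) (g : UL S d) : rowMul (v + w) g = rowMul v g + rowMul w g :=
  Prod.ext (Matrix.add_vecMul g.realMat v.1 w.1)
    (funext fun p => Matrix.add_vecMul (g.padicMat p) (v.2 p) (w.2 p))

lemma rowMul_zero (g : UL S d) : rowMul (0 : QSVec S d) g = 0 :=
  Prod.ext (Matrix.zero_vecMul g.realMat) (funext fun p => Matrix.zero_vecMul (g.padicMat p))

lemma rowMul_neg (v : QSVec S d) (g : UL S d) : rowMul (-v) g = -rowMul v g :=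
  Prod.ext (Matrix.neg_vecMul v.1 g.realMat)
    (funext fun p => Matrix.neg_vecMul (v.2 p) (g.padicMat p))

lemma diagVec_add (k l : Fin d → ZS S) : diagVec (k + l) = diagVec k + diagVec l := by
  refine Prod.ext (funext fun i => ?_) (funext fun p => funext fun i => ?_) <;>
  simp [diagVec]

lemma diagVec_neg (k : Fin d → ZS S) : diagVec (-k) = -diagVec k := by
  refine Prod.ext (funext fun i => ?_) (funext fun p => funext fun i => ?_) <;>
  simp [diagVec]

lemma diagVec_zero : diagVec (0 : Fin d → ZS S) = 0 := by
  refine Prod.ext (funext fun i => ?_) (funext fun p => funext fun i => ?_) <;>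
  simp [diagVec]

end lemmas

/-- The diagonal embedding of `SL_d(ℤ_S)` in `UL_d(ℚ_S)`. -/
def diagSL (S : Finset Nat.Primes) (d : ℕ) :
    Matrix.SpecialLinearGroup (Fin d) (ZS S) →* UL S d where
  toFun γ := (Matrix.SpecialLinearGroup.map (ZS.toReal S) γ, fun p =>
    ⟨Matrix.SpecialLinearGroup.toGL (Matrix.SpecialLinearGroup.map (ZS.toPadic S p) γ), by
      change ‖(Matrix.SpecialLinearGroup.map (ZS.toPadic S p) γ :
        Matrix (Fin d) (Fin d) ℚ_[p.1.1]).det‖ = 1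
      rw [Matrix.SpecialLinearGroup.det_coe, norm_one]⟩)
  map_one' := by
    refine Prod.ext (map_one _) (funext fun p => Subtype.ext ?_)
    change Matrix.SpecialLinearGroup.toGL (Matrix.SpecialLinearGroup.map _ 1) = 1
    rw [map_one, map_one]
  map_mul' a b := by
    refine Prod.ext (map_mul _ _ _) (funext fun p => Subtype.ext ?_)
    change Matrix.SpecialLinearGroup.toGL (Matrix.SpecialLinearGroup.map _ (a * b)) =
      Matrix.SpecialLinearGroup.toGL (Matrix.SpecialLinearGroup.map _ a) *
        Matrix.SpecialLinearGroup.toGL (Matrix.SpecialLinearGroup.map _ b)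
    rw [map_mul, map_mul]

/-- `UL_d(ℤ_S)`. As the component at the infinite place has determinant one and the embedding is
diagonal, it is the image of `SL_d(ℤ_S)`. -/
def ULZ (S : Finset Nat.Primes) (d : ℕ) : Subgroup (UL S d) := (diagSL S d).range

lemma rowMul_diag {S : Finset Nat.Primes} {d : ℕ} (k : Fin d → ZS S)
    (γ : Matrix.SpecialLinearGroup (Fin d) (ZS S)) :
    rowMul (diagVec k) (diagSL S d γ) = diagVec (k ᵥ* (γ : Matrix (Fin d) (Fin d) (ZS S))) := by
  refine Prod.ext (funext fun i => ?_) (funext fun p => funext fun i => ?_)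
  · exact (RingHom.map_vecMul (ZS.toReal S) (γ : Matrix (Fin d) (Fin d) (ZS S)) k i).symm
  · exact (RingHom.map_vecMul (ZS.toPadic S p) (γ : Matrix (Fin d) (Fin d) (ZS S)) k i).symm

/-- `AUL_d(ℚ_S)`: the pair `(ξ, g)` stands for the affine map `x ↦ x g + ξ` of row vectors. -/
@[ext]
structure AUL (S : Finset Nat.Primes) (d : ℕ) where
  /-- the translation part -/
  vec : QSVec S d
  /-- the linear part -/
  lin : UL S d

/-- The group law `(ξ₁, g₁) (ξ₂, g₂) = (ξ₂ + ξ₁ g₂, g₁ g₂)`. -/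
instance (S : Finset Nat.Primes) (d : ℕ) : Group (AUL S d) where
  mul a b := ⟨b.vec + rowMul a.vec b.lin, a.lin * b.lin⟩
  one := ⟨0, 1⟩
  inv a := ⟨-rowMul a.vec a.lin⁻¹, a.lin⁻¹⟩
  mul_assoc a b c := by
    refine AUL.ext ?_ (mul_assoc _ _ _)
    change c.vec + rowMul (b.vec + rowMul a.vec b.lin) c.lin =
      (c.vec + rowMul b.vec c.lin) + rowMul a.vec (b.lin * c.lin)
    rw [rowMul_add, rowMul_mul, add_assoc]
  one_mul a := by
    refine AUL.ext ?_ (one_mul _)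
    change a.vec + rowMul 0 a.lin = a.vec
    rw [rowMul_zero, add_zero]
  mul_one a := by
    refine AUL.ext ?_ (mul_one _)
    change 0 + rowMul a.vec 1 = a.vec
    rw [rowMul_one, zero_add]
  inv_mul_cancel a := by
    refine AUL.ext ?_ (inv_mul_cancel _)
    change a.vec + rowMul (-rowMul a.vec a.lin⁻¹) a.lin = 0
    rw [rowMul_neg, ← rowMul_mul, inv_mul_cancel, rowMul_one, add_neg_cancel]

/-- The σ-algebra of the product `ℚ_S ^ d × UL_d(ℚ_S)`. -/
instance (S : Finset Nat.Primes) (d : ℕ) : MeasurableSpace (AUL S d) :=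
  MeasurableSpace.comap (fun a => (a.vec, a.lin)) inferInstance

/-- `AUL_d(ℤ_S)`: both the translation part and the linear part are `S`-integral. -/
def AULZ (S : Finset Nat.Primes) (d : ℕ) : Subgroup (AUL S d) where
  carrier := {a | (∃ k : Fin d → ZS S, a.vec = diagVec k) ∧ a.lin ∈ ULZ S d}
  mul_mem' := by
    rintro a b ⟨⟨k, hk⟩, ha⟩ ⟨⟨l, hl⟩, hb⟩
    refine ⟨?_, mul_mem ha hb⟩
    obtain ⟨β, hβ⟩ := hb
    refine ⟨l + k ᵥ* (β : Matrix (Fin d) (Fin d) (ZS S)), ?_⟩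
    change b.vec + rowMul a.vec b.lin = _
    rw [hk, hl, ← hβ, rowMul_diag, diagVec_add]
  one_mem' := ⟨⟨0, diagVec_zero.symm⟩, one_mem _⟩
  inv_mem' := by
    rintro a ⟨⟨k, hk⟩, ha⟩
    refine ⟨?_, inv_mem ha⟩
    obtain ⟨α, hα⟩ := ha
    refine ⟨-(k ᵥ* ((α⁻¹ : Matrix.SpecialLinearGroup (Fin d) (ZS S)) :
      Matrix (Fin d) (Fin d) (ZS S))), ?_⟩
    change -rowMul a.vec a.lin⁻¹ = _
    rw [hk, ← hα, ← map_inv, rowMul_diag, diagVec_neg]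

/-- The space `AUL_d(ℤ_S) \ AUL_d(ℚ_S)` of unimodular affine `S`-lattices. -/
abbrev AffSpace (S : Finset Nat.Primes) (d : ℕ) : Type :=
  Quotient (QuotientGroup.rightRel (AULZ S d))

/-- The point `k g + ξ` of the affine lattice attached to `(ξ, g)`. -/
def latticePoint {S : Finset Nat.Primes} {d : ℕ} (a : AUL S d) (k : Fin d → ZS S) : QSVec S d :=
  rowMul (diagVec k) a.lin + a.vec

lemma exists_reindex {S : Finset Nat.Primes} {d : ℕ} {c : AUL S d} (hc : c ∈ AULZ S d) :
    ∃ e : (Fin d → ZS S) ≃ (Fin d → ZS S), ∀ (a : AUL S d) (k : Fin d → ZS S),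
      latticePoint (c * a) k = latticePoint a (e k) := by
  obtain ⟨⟨z, hz⟩, γ, hγ⟩ := hc
  refine ⟨⟨fun k => k ᵥ* (γ : Matrix (Fin d) (Fin d) (ZS S)) + z,
    fun k => (k - z) ᵥ* ((γ⁻¹ : Matrix.SpecialLinearGroup (Fin d) (ZS S)) :
      Matrix (Fin d) (Fin d) (ZS S)), fun k => ?_, fun k => ?_⟩, fun a k => ?_⟩
  · simp only [add_sub_cancel_right, Matrix.vecMul_vecMul]
    rw [← Matrix.SpecialLinearGroup.coe_mul, mul_inv_cancel, Matrix.SpecialLinearGroup.coe_one,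
      Matrix.vecMul_one]
  · simp only [Matrix.vecMul_vecMul]
    rw [← Matrix.SpecialLinearGroup.coe_mul, inv_mul_cancel, Matrix.SpecialLinearGroup.coe_one,
      Matrix.vecMul_one, sub_add_cancel]
  · change rowMul (diagVec k) (c.lin * a.lin) + (a.vec + rowMul c.vec a.lin) =
      rowMul (diagVec (k ᵥ* (γ : Matrix (Fin d) (Fin d) (ZS S)) + z)) a.lin + a.vec
    rw [hz, ← hγ, rowMul_mul, rowMul_diag, diagVec_add, rowMul_add]
    abel

/-- The unimodular affine `S`-lattice `ℤ_S ^ d g + ξ` represented by the coset of `(ξ, g)`. -/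
def affineLattice {S : Finset Nat.Primes} {d : ℕ} (x : AffSpace S d) : Set (QSVec S d) :=
  Quotient.lift (fun a : AUL S d => Set.range (latticePoint a)) (by
    rintro a b h
    obtain ⟨⟨c, hc⟩, rfl⟩ := h
    obtain ⟨e, he⟩ := exists_reindex hc
    change Set.range (latticePoint (c * b)) = Set.range (latticePoint b)
    rw [show latticePoint (c * b) = latticePoint b ∘ e from funext fun k => he b k]
    exact e.surjective.range_comp _) x

/-- The Siegel transform: the sum of `f` over the points of the affine lattice. -/
def siegelTransform {S : Finset Nat.Primes} {d : ℕ} {M : Type} [AddCommMonoid M]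
    [TopologicalSpace M] (f : QSVec S d → M) (x : AffSpace S d) : M :=
  ∑' v : affineLattice x, f v

/-- The sum `∑ F (k₁ g + ξ, k₂ g + ξ)` over `k₁, k₂ ∈ ℤ_S ^ d`, which depends only on the coset
of `(ξ, g)`. -/
def pairTransform {S : Finset Nat.Primes} {d : ℕ} (F : QSVec S d × QSVec S d → ℝ)
    (x : AffSpace S d) : ℝ :=
  Quotient.lift (fun a : AUL S d =>
    ∑' k : (Fin d → ZS S) × (Fin d → ZS S), F (latticePoint a k.1, latticePoint a k.2)) (by
    rintro a b h
    obtain ⟨⟨c, hc⟩, rfl⟩ := h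
    obtain ⟨e, he⟩ := exists_reindex hc
    refine Eq.trans (tsum_congr fun k => ?_) ((e.prodCongr e).tsum_eq
      fun k => F (latticePoint b k.1, latticePoint b k.2))
    change F (latticePoint (c * b) k.1, latticePoint (c * b) k.2) = _
    rw [he, he]
    rfl) x

open scoped Classical in
/-- The measure induced by `μ` on the space `Γ \ G` of right cosets: the image of the restriction
of `μ` to a fundamental domain for left multiplication by `Γ`. For countable `Γ` and left
`Γ`-invariant `μ` it does not depend on the fundamental domain. -/
def quotientMeasure {G : Type} [Group G] [MeasurableSpace G] (Γ : Subgroup G) (μ : Measure G) :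
    Measure (Quotient (QuotientGroup.rightRel Γ)) :=
  if h : HasFundamentalDomain Γ G μ then
    (μ.restrict h.ExistsIsFundamentalDomain.choose).map (Quotient.mk (QuotientGroup.rightRel Γ))
  else 0

/-- The multiple of a Haar measure `μ` on `UL_d(ℚ_S)` for which `UL_d(ℤ_S) \ UL_d(ℚ_S)` has
measure one. -/
def normalizedHaar {S : Finset Nat.Primes} {d : ℕ} (μ : Measure (UL S d)) : Measure (UL S d) :=
  (covolume (ULZ S d) (UL S d) μ)⁻¹ • μ

/-- The measure on `AUL_d(ℤ_S) \ AUL_d(ℚ_S)` induced by the product of the measure on `ℚ_S ^ d`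
and the normalized Haar measure on `UL_d(ℚ_S)`. -/
def affMeasure {S : Finset Nat.Primes} {d : ℕ} (μ : Measure (UL S d)) : Measure (AffSpace S d) :=
  quotientMeasure (AULZ S d)
    (((volS S d).prod (normalizedHaar μ)).map fun x => (⟨x.1, x.2⟩ : AUL S d))

end SArith

end

/-! The space of affine lattices fibres over the quotient of `UL S d` by `ULZ S d`, and the fibre
over `g` is parametrised by `u g` with `u` in the box `unitBox`, a strict fundamental domain of
volume one for the diagonal `S`-integral vectors. Translates of the box tile space and `g` preserves
volume, so the first moment is already correct on each fibre. For pairs, put `k₂ = k₁ + l` and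
integrate over the fibre: what is left is the sum over `l` of `Φ (l g)` with `Φ w = ∫ H (x, x + w)
dx`. The term `l = 0` is the diagonal integral; the terms `l ≠ 0` are handled by Siegel's mean value
formula on the linear quotient (`siegel_formula`), and a shear turns `∫ Φ` into the double integral.

Siegel's formula is proved together with the finiteness of the covolume. The averages of the
counting measures of `{k g}` over a domain `F` form a measure on `ℚ_S ^ d` (`orbitMeasure`) that is
invariant under `UL` and absolutely continuous, hence a multiple of the volume
(`exists_eq_smul_volS`). For the orbit of the first basis vector, unfolding bounds the constant by
the measure of any set meeting every relevant orbit of the stabilizer (`orbitMeasure_primitive_le`).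
Such a set of finite measure is built from one for `d - 1` by Schur complements (`liftSet`), which
makes an induction on `d` possible. Every nonzero vector is a multiple, by an integer prime to `S`,
of one in that orbit, so a convergent series gives finiteness for all nonzero vectors. Finally the
constant is identified with `μ F` by counting lattice points in large balls: Fatou's lemma shows
that `μ F` is finite, and dominated convergence gives equality (`covolume_eq_of_orbitMeasure`).

Haar measure is made concrete as the radial projection of additive volume on a cone of matrices
(`coneMeasure`). This gives invariance on both sides, the null sets of the first row, and the Fubini
estimate in the induction. -/

open scoped NNReal Pointwise

noncomputable section

namespace SArith

/-! ### Homomorphisms from the general linear group to commutative monoids -/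

section GLHom

variable {K : Type*} [Field K] {n : Type*} [Fintype n] [DecidableEq n]

/-- The diagonal matrix with entry `a` at the place `i` and `1` elsewhere. -/
def diagSingle (i : n) (a : Kˣ) : GL n K :=
  Matrix.GeneralLinearGroup.mkOfDetNeZero (Matrix.diagonal (fun j => ((Pi.mulSingle i a : n → Kˣ) j : K)))
    (by rw [Matrix.det_diagonal]; exact Finset.prod_ne_zero_iff.2 fun j _ => Units.ne_zero _)

lemma coe_diagSingle (i : n) (a : Kˣ) : (diagSingle i a : Matrix n n K) =
    Matrix.diagonal (fun j => ((Pi.mulSingle i a : n → Kˣ) j : K)) := rfl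

def transvectionGL (i j : n) (hij : i ≠ j) (c : K) : GL n K :=
  Matrix.GeneralLinearGroup.mkOfDetNeZero (Matrix.transvection i j c)
    (by rw [Matrix.det_transvection_of_ne _ _ hij]; exact one_ne_zero)

variable {A : Type*} [CommMonoid A] (φ : GL n K →* A)

lemma GL.map_conj (a b c : GL n K) (h : a * b = c * a) : φ b = φ c := by
  have := congrArg φ h
  rw [map_mul, map_mul, mul_comm] at this
  have hu : IsUnit (φ a) := (Group.isUnit a).map φ
  exact hu.mul_right_cancel this

/-- Doubling the parameter squares a transvection, but it is also conjugation by the diagonal matrix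
with entry 2 at `i`, invisible in a commutative target. The image is therefore idempotent, and it is
invertible. -/
lemma GL.map_transvection (h2 : (2 : K) ≠ 0) (i j : n) (hij : i ≠ j) (c : K) :
    φ (transvectionGL i j hij c) = 1 := by
  have h1 : transvectionGL i j hij c * transvectionGL i j hij c =
      transvectionGL i j hij (2 * c) := by
    apply Units.ext
    change Matrix.transvection i j c * Matrix.transvection i j c = Matrix.transvection i j (2 * c)
    rw [Matrix.transvection_mul_transvection_same _ _ hij, two_mul]
  have hc : φ (transvectionGL i j hij c) = φ (transvectionGL i j hij (2 * c)) := by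
    apply GL.map_conj φ (diagSingle i (Units.mk0 2 h2))
    apply Units.ext
    change Matrix.diagonal _ * Matrix.transvection i j c =
      Matrix.transvection i j (2 * c) * Matrix.diagonal _
    ext x y
    simp only [Matrix.diagonal_mul, Matrix.mul_diagonal, Matrix.transvection, Matrix.add_apply,
      Matrix.single_apply, Matrix.one_apply, Pi.mulSingle_apply]
    by_cases hx : x = i
    · subst hx
      by_cases hy : y = j
      · subst hy
        simp [hij, hij.symm]
      · by_cases hxy : x = y
        · subst hxy
          simp [Ne.symm hy]
        · simp [hxy, Ne.symm hy]
    · by_cases hxy : x = y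
      · subst hxy
        simp [hx, Ne.symm hx]
      · simp [hxy, Ne.symm hx]
  have h3 := congrArg φ h1
  rw [map_mul, ← hc] at h3
  have hu : IsUnit (φ (transvectionGL i j hij c)) := (Group.isUnit _).map φ
  exact hu.mul_right_cancel (by rw [h3, one_mul])

lemma GL.map_diagSingle (i j : n) (a : Kˣ) : φ (diagSingle i a) = φ (diagSingle j a) := by
  let w : GL n K := Matrix.GeneralLinearGroup.mkOfDetNeZero ((Equiv.swap i j).permMatrix K) (by
    rw [Matrix.det_permutation]
    rcases Int.units_eq_one_or (Equiv.Perm.sign (Equiv.swap i j)) with h | h <;> simp [h])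
  apply GL.map_conj φ w
  apply Units.ext
  change (Equiv.swap i j).permMatrix K * Matrix.diagonal _ = Matrix.diagonal _ * (Equiv.swap i j).permMatrix K
  ext x y
  simp only [Matrix.mul_diagonal, Matrix.diagonal_mul, Equiv.Perm.permMatrix, PEquiv.toMatrix_apply,
    Equiv.toPEquiv_apply, Option.mem_def, Option.some.injEq, Pi.mulSingle_apply]
  by_cases hxy : Equiv.swap i j x = y
  · subst hxy
    have : Equiv.swap i j x = i ↔ x = j := by
      rw [← Equiv.eq_symm_apply]; simp
    simp only [this]; simp
  · simp [hxy]

/-- A homomorphism from `GL_n(K)` to a commutative monoid factors through the determinant. -/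
theorem GL.map_eq_map_det (h2 : (2 : K) ≠ 0) (i : n) (g : GL n K) :
    φ g = φ (diagSingle i (Matrix.GeneralLinearGroup.det g)) := by
  have key : ∀ M : Matrix n n K, M.det ≠ 0 → ∀ h : M.det ≠ 0,
      φ (Matrix.GeneralLinearGroup.mkOfDetNeZero M h) = φ (diagSingle i (Units.mk0 _ h)) := by
    have hmul : ∀ a b : Kˣ, (diagSingle i (a * b) : GL n K) = diagSingle i a * diagSingle i b := by
      intro a b
      apply Units.ext
      change Matrix.diagonal _ = Matrix.diagonal _ * Matrix.diagonal _
      rw [Matrix.diagonal_mul_diagonal, Pi.mulSingle_mul]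
      rfl
    have hone : (diagSingle i (1 : Kˣ) : GL n K) = 1 := by
      apply Units.ext
      rw [coe_diagSingle]
      simp
    intro M hM
    refine Matrix.diagonal_transvection_induction_of_det_ne_zero
      (fun M => ∀ h : M.det ≠ 0, φ (Matrix.GeneralLinearGroup.mkOfDetNeZero M h) =
        φ (diagSingle i (Units.mk0 _ h))) M hM ?_ ?_ ?_
    · intro D hD h
      have hD' : ∀ j, D j ≠ 0 := by
        rw [Matrix.det_diagonal] at hD
        exact fun j => Finset.prod_ne_zero_iff.1 hD j (Finset.mem_univ j)
      let u : n → Kˣ := fun j => Units.mk0 (D j) (hD' j)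
      let δ : (n → Kˣ) →* GL n K :=
        { toFun := fun v => Matrix.GeneralLinearGroup.mkOfDetNeZero
            (Matrix.diagonal fun j => (v j : K)) (by
              rw [Matrix.det_diagonal]; exact Finset.prod_ne_zero_iff.2 fun j _ => Units.ne_zero _)
          map_one' := by
            apply Units.ext
            change Matrix.diagonal _ = 1
            simp
          map_mul' := fun v w => by
            apply Units.ext
            change Matrix.diagonal _ = Matrix.diagonal _ * Matrix.diagonal _
            rw [Matrix.diagonal_mul_diagonal]
            rfl }
      let ε : Kˣ →* GL n K := ⟨⟨fun a => diagSingle i a, hone⟩, hmul⟩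
      have e1 : Matrix.GeneralLinearGroup.mkOfDetNeZero (Matrix.diagonal D) h = δ u := rfl
      have e2 : Units.mk0 (Matrix.diagonal D).det h = ∏ j, u j := by
        apply Units.ext
        simp [u]
      -- A diagonal matrix is a product of single-entry ones. Each of them may be moved to the place
      -- `i` by conjugation with a transposition, so only the product of the entries survives.
      have e4 : ∀ j, φ.comp δ (Pi.mulSingle j (u j)) = φ.comp ε (u j) :=
        fun j => GL.map_diagSingle φ j i (u j)
      rw [e1, e2]
      change φ.comp δ u = φ.comp ε (∏ j, u j)
      conv_lhs => rw [← Finset.univ_prod_mulSingle u, map_prod]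
      rw [map_prod]
      exact Finset.prod_congr rfl fun j _ => e4 j
    · intro t h
      have : Units.mk0 t.toMatrix.det h = 1 := Units.ext t.det
      rw [this, hone, map_one]
      exact GL.map_transvection φ h2 t.i t.j t.hij t.c
    · intro A B hA hB pA pB h
      have e1 : Matrix.GeneralLinearGroup.mkOfDetNeZero (A * B) h =
          Matrix.GeneralLinearGroup.mkOfDetNeZero A hA *
          Matrix.GeneralLinearGroup.mkOfDetNeZero B hB := Units.ext rfl
      have e2 : Units.mk0 (A * B).det h = Units.mk0 _ hA * Units.mk0 _ hB :=
        Units.ext (Matrix.det_mul A B)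
      rw [e1, e2, hmul, map_mul, map_mul, pA hA, pB hB]
  have hg := g.det_ne_zero
  have e := key g hg hg
  have e1 : Matrix.GeneralLinearGroup.mkOfDetNeZero (g : Matrix n n K) hg = g := Units.ext rfl
  have e2 : Units.mk0 (g : Matrix n n K).det hg = Matrix.GeneralLinearGroup.det g := Units.ext rfl
  rwa [e1, e2] at e

end GLHom

/-! ### Volume preservation by the linear actions -/

section Volumes

instance volPadic_isAddHaarMeasure (p : ℕ) [Fact p.Prime] (d : ℕ) :
    (volPadic p d).IsAddHaarMeasure := by
  unfold volPadic; infer_instance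

instance piPadic_isAddHaarMeasure (S : Finset Nat.Primes) (d : ℕ) :
    (Measure.pi fun p : S => volPadic p.1.1 d).IsAddHaarMeasure :=
  Measure.pi.isAddHaarMeasure _

instance volS_isAddHaarMeasure (S : Finset Nat.Primes) (d : ℕ) : (volS S d).IsAddHaarMeasure :=
  Measure.prod.instIsAddHaarMeasure _ _

instance measurableAdd_QSVec (S : Finset Nat.Primes) (d : ℕ) : MeasurableAdd (QSVec S d) :=
  ContinuousAdd.measurableAdd

instance measurableAdd₂_QSVec (S : Finset Nat.Primes) (d : ℕ) : MeasurableAdd₂ (QSVec S d) :=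
  ContinuousAdd.measurableMul₂

/-- Matrices over `ℚ_S` with `n` rows of length `d`, as tuples of rows. -/
abbrev RowSpace (S : Finset Nat.Primes) (n d : ℕ) : Type := Fin n → QSVec S d

instance borelSpace_RowSpace (S : Finset Nat.Primes) (n d : ℕ) : BorelSpace (RowSpace S n d) :=
  @Pi.borelSpace (Fin n) (fun _ => QSVec S d) _ _ _ _ fun _ => Prod.borelSpace

/-- The additive Haar measure on the space of matrices. -/
def volRows (S : Finset Nat.Primes) (n d : ℕ) : Measure (RowSpace S n d) :=
  Measure.pi fun _ => volS S d

instance volRows_isAddHaarMeasure (S : Finset Nat.Primes) (n d : ℕ) :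
    (volRows S n d).IsAddHaarMeasure :=
  Measure.pi.isAddHaarMeasure _

instance sigmaFinite_volS (S : Finset Nat.Primes) (d : ℕ) : SigmaFinite (volS S d) :=
  inferInstance

instance sigmaFinite_volRows (S : Finset Nat.Primes) (n d : ℕ) : SigmaFinite (volRows S n d) :=
  Measure.pi.sigmaFinite _

/-- An invertible matrix as a continuous automorphism of the space of column vectors. -/
def mulVecEquiv {K : Type*} [Field K] [TopologicalSpace K] [IsTopologicalRing K] {n : Type*}
    [Fintype n] [DecidableEq n] (g : GL n K) : (n → K) ≃ₜ+ (n → K) where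
  toFun v := (g : Matrix n n K) *ᵥ v
  invFun v := ((g⁻¹ : GL n K) : Matrix n n K) *ᵥ v
  left_inv v := by simp only [Matrix.mulVec_mulVec]; rw [← Units.val_mul]; simp
  right_inv v := by simp only [Matrix.mulVec_mulVec]; rw [← Units.val_mul]; simp
  map_add' v w := Matrix.mulVec_add _ v w
  continuous_toFun := Continuous.matrix_mulVec continuous_const continuous_id
  continuous_invFun := Continuous.matrix_mulVec continuous_const continuous_id

lemma norm_diagSingle_mulVec {p : ℕ} [Fact p.Prime] {d : ℕ} (i : Fin d) (a : ℚ_[p]ˣ)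
    (ha : ‖(a : ℚ_[p])‖ = 1) (v : Fin d → ℚ_[p]) :
    ‖(diagSingle i a : Matrix (Fin d) (Fin d) ℚ_[p]) *ᵥ v‖ = ‖v‖ := by
  rw [coe_diagSingle]
  have : ∀ j, ‖(Matrix.diagonal (fun j => ((Pi.mulSingle i a : Fin d → ℚ_[p]ˣ) j : ℚ_[p])) *ᵥ v) j‖₊
      = ‖v j‖₊ := by
    intro j
    rw [Matrix.mulVec_diagonal, nnnorm_mul]
    by_cases h : j = i
    · subst h
      rw [Pi.mulSingle_eq_same, show ‖(a : ℚ_[p])‖₊ = 1 from NNReal.eq ha, one_mul]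
    · rw [Pi.mulSingle_eq_of_ne h, Units.val_one, nnnorm_one, one_mul]
  simp only [Pi.norm_def, this]

/-- The factor by which `g` scales Haar measure is multiplicative in `g`, hence depends only on the
determinant. It may be computed on a diagonal matrix with a single nontrivial entry, a unit, whose
action preserves the unit ball. -/
theorem measurePreserving_mulVec_padic (p : ℕ) [Fact p.Prime] (d : ℕ) (g : GL (Fin d) ℚ_[p])
    (hg : ‖(g : Matrix (Fin d) (Fin d) ℚ_[p]).det‖ = 1) :
    MeasurePreserving (fun v => (g : Matrix (Fin d) (Fin d) ℚ_[p]) *ᵥ v)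
      (volPadic p d) (volPadic p d) := by
  rcases Nat.eq_zero_or_pos d with rfl | hd
  · have : (fun v => (g : Matrix (Fin 0) (Fin 0) ℚ_[p]) *ᵥ v) = id := by
      funext v; exact Subsingleton.elim _ _
    rw [this]; exact MeasurePreserving.id _
  let φ : GL (Fin d) ℚ_[p] →* ℝ≥0 :=
    { toFun := fun g => addEquivAddHaarChar (mulVecEquiv g)
      map_one' := by
        have : mulVecEquiv (1 : GL (Fin d) ℚ_[p]) = ContinuousAddEquiv.refl _ := by
          ext v : 1
          exact Matrix.one_mulVec v
        rw [this, addEquivAddHaarChar_refl]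
      map_mul' := fun a b => by
        have : mulVecEquiv (a * b) = (mulVecEquiv b).trans (mulVecEquiv a) := by
          ext v : 1
          exact (Matrix.mulVec_mulVec v (a : Matrix (Fin d) (Fin d) ℚ_[p]) b).symm
        rw [this, addEquivAddHaarChar_trans, mul_comm] }
  have h2 : (2 : ℚ_[p]) ≠ 0 := two_ne_zero
  let i : Fin d := ⟨0, hd⟩
  let a := Matrix.GeneralLinearGroup.det g
  have ha : ‖(a : ℚ_[p])‖ = 1 := hg
  have h1 : φ (diagSingle i a) = 1 := by
    have := addEquivAddHaarChar_smul_preimage (volPadic p d) (X := Metric.closedBall 0 1)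
      (mulVecEquiv (diagSingle i a))
    have hpre : (mulVecEquiv (diagSingle i a)) ⁻¹' (Metric.closedBall 0 1) =
        Metric.closedBall 0 1 := by
      ext v
      simp only [Set.mem_preimage, mem_closedBall_zero_iff]
      change ‖(diagSingle i a : Matrix (Fin d) (Fin d) ℚ_[p]) *ᵥ v‖ ≤ 1 ↔ _
      rw [norm_diagSingle_mulVec i a ha]
    rw [hpre] at this
    have hv : volPadic p d (Metric.closedBall 0 1) = 1 :=
      Measure.addHaarMeasure_self (K₀ := unitBall p d)
    rw [hv, ENNReal.smul_def, smul_eq_mul, mul_one] at this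
    exact_mod_cast this
  have h3 : addEquivAddHaarChar (mulVecEquiv g) = 1 := by
    change φ g = 1
    rw [GL.map_eq_map_det φ h2 i g]; exact h1
  refine ⟨(mulVecEquiv g).continuous.measurable, ?_⟩
  have := addEquivAddHaarChar_smul_map (volPadic p d) (mulVecEquiv g)
  rw [h3, one_smul] at this
  exact this

theorem measurePreserving_mulVec_real (d : ℕ) (g : Matrix (Fin d) (Fin d) ℝ) (hg : g.det = 1) :
    MeasurePreserving (fun v => g *ᵥ v) (volume : Measure (Fin d → ℝ)) volume := by
  refine ⟨(Continuous.matrix_mulVec continuous_const continuous_id).measurable, ?_⟩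
  have := Real.map_matrix_volume_pi_eq_smul_volume_pi (M := g) (by rw [hg]; exact one_ne_zero)
  rw [hg] at this
  simp only [inv_one, abs_one, ENNReal.ofReal_one, one_smul] at this
  exact this

variable {S : Finset Nat.Primes} {d : ℕ}

/-- The action of `g` on column vectors. -/
def colMul (g : UL S d) (v : QSVec S d) : QSVec S d :=
  (g.realMat *ᵥ v.1, fun p => g.padicMat p *ᵥ v.2 p)

lemma UL.det_realMat (g : UL S d) : g.realMat.det = 1 := g.1.2

lemma UL.norm_det_padicMat (g : UL S d) (p : S) : ‖(g.padicMat p).det‖ = 1 := (g.2 p).2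

theorem measurePreserving_colMul (g : UL S d) :
    MeasurePreserving (colMul g) (volS S d) (volS S d) := by
  have h2 : ∀ p : S, MeasurePreserving (fun v => g.padicMat p *ᵥ v) (volPadic p.1.1 d)
      (volPadic p.1.1 d) := fun p => measurePreserving_mulVec_padic p.1.1 d (g.2 p).1 (g.2 p).2
  exact (measurePreserving_mulVec_real d _ g.det_realMat).prod (measurePreserving_pi _ _ h2)

theorem measurePreserving_rowMul (g : UL S d) :
    MeasurePreserving (fun v => rowMul v g) (volS S d) (volS S d) := by
  have h1 : MeasurePreserving (fun v => v ᵥ* g.realMat) (volume : Measure (Fin d → ℝ)) volume := by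
    simp only [← Matrix.mulVec_transpose]
    exact measurePreserving_mulVec_real d _ (by rw [Matrix.det_transpose]; exact g.det_realMat)
  have h2 : ∀ p : S, MeasurePreserving (fun v => v ᵥ* g.padicMat p) (volPadic p.1.1 d)
      (volPadic p.1.1 d) := by
    intro p
    simp only [← Matrix.mulVec_transpose]
    have hdet : ((g.padicMat p)ᵀ).det ≠ 0 := by
      rw [Matrix.det_transpose, ← norm_ne_zero_iff, g.norm_det_padicMat p]; exact one_ne_zero
    exact measurePreserving_mulVec_padic p.1.1 d
      (Matrix.GeneralLinearGroup.mkOfDetNeZero _ hdet) (by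
        change ‖((g.padicMat p)ᵀ).det‖ = 1
        rw [Matrix.det_transpose]; exact g.norm_det_padicMat p)
  exact h1.prod (measurePreserving_pi _ _ h2)

/-- Multiplication of matrices by `g` on the right. -/
def rowsMul {n : ℕ} (X : RowSpace S n d) (g : UL S d) : RowSpace S n d := fun i => rowMul (X i) g

theorem measurePreserving_rowsMul (n : ℕ) (g : UL S d) :
    MeasurePreserving (fun X => rowsMul X g) (volRows S n d) (volRows S n d) :=
  measurePreserving_pi _ _ fun _ => measurePreserving_rowMul g

/-- The transpose of a square matrix. -/
def transposeRows : RowSpace S d d ≃ₜ+ RowSpace S d d where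
  toFun X i := (fun j => (X j).1 i, fun p j => (X j).2 p i)
  invFun X i := (fun j => (X j).1 i, fun p j => (X j).2 p i)
  left_inv X := rfl
  right_inv X := rfl
  map_add' X Y := rfl
  continuous_toFun := by fun_prop
  continuous_invFun := by fun_prop

/-- Multiplication of matrices by `g` on the left. -/
def mulRows (g : UL S d) (X : RowSpace S d d) : RowSpace S d d :=
  transposeRows (fun i => colMul g (transposeRows X i))

/-- Left multiplication acts on columns, so it is the column action conjugated by the transpose. The
transpose sends the volume to some multiple of itself by uniqueness of Haar measure; the value of
the multiple is irrelevant, because it is undone by transposing back. -/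
theorem measurePreserving_mulRows (g : UL S d) :
    MeasurePreserving (mulRows g) (volRows S d d) (volRows S d d) := by
  have hT : MeasurePreserving (transposeRows (S := S) (d := d)) (volRows S d d)
      ((volRows S d d).map transposeRows) := ⟨transposeRows.continuous.measurable, rfl⟩
  have hH : ((volRows S d d).map (transposeRows (S := S) (d := d))).IsAddHaarMeasure :=
    transposeRows.isAddHaarMeasure_map _
  have hc := Measure.isAddLeftInvariant_eq_smul ((volRows S d d).map (transposeRows (S := S) (d := d)))
    (volRows S d d)
  set c := ((volRows S d d).map (transposeRows (S := S) (d := d))).addHaarScalarFactor (volRows S d d)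
  have hcol : MeasurePreserving (fun X : RowSpace S d d => fun i => colMul g (X i))
      (volRows S d d) (volRows S d d) := measurePreserving_pi _ _ fun _ => measurePreserving_colMul g
  have hcol' : MeasurePreserving (fun X : RowSpace S d d => fun i => colMul g (X i))
      ((volRows S d d).map transposeRows) ((volRows S d d).map transposeRows) := by
    rw [hc]
    refine ⟨hcol.measurable, ?_⟩
    rw [Measure.map_smul, hcol.map_eq]
  have hback : MeasurePreserving (transposeRows (S := S) (d := d))
      ((volRows S d d).map transposeRows) (volRows S d d) := by
    refine ⟨hT.measurable, ?_⟩
    rw [Measure.map_map hT.measurable hT.measurable]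
    exact Measure.map_id
  exact hback.comp (hcol'.comp hT)

end Volumes

/-! ### The group as a closed set of matrices -/

section Topology

variable {S : Finset Nat.Primes} {d : ℕ}

/-- The component at the infinite place of a matrix over `ℚ_S`. -/
def RowSpace.realMat {n : ℕ} (X : RowSpace S n d) : Matrix (Fin n) (Fin d) ℝ := fun i j => (X i).1 j

/-- The component at the place `p` of a matrix over `ℚ_S`. -/
def RowSpace.padicMat {n : ℕ} (X : RowSpace S n d) (p : S) : Matrix (Fin n) (Fin d) ℚ_[p.1.1] :=
  fun i j => (X i).2 p j

/-- The matrix over `ℚ_S` underlying an element of `UL_d(ℚ_S)`. -/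
def UL.rows (g : UL S d) : RowSpace S d d := fun i => (g.realMat i, fun p => g.padicMat p i)

lemma isClosedEmbedding_SL : Topology.IsClosedEmbedding
    (fun g : Matrix.SpecialLinearGroup (Fin d) ℝ => (g : Matrix (Fin d) (Fin d) ℝ)) := by
  refine ⟨Topology.IsEmbedding.subtypeVal, ?_⟩
  have : Set.range (fun g : Matrix.SpecialLinearGroup (Fin d) ℝ => (g : Matrix (Fin d) (Fin d) ℝ)) =
      {X | X.det = 1} := by
    ext X
    exact ⟨fun ⟨g, hg⟩ => hg ▸ g.2, fun hX => ⟨⟨X, hX⟩, rfl⟩⟩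
  rw [this]
  exact isClosed_eq (Continuous.matrix_det continuous_id) continuous_const

/-- Inversion of matrices is continuous where the determinant does not vanish, by the adjugate
formula. So the topology of the unit group, which also records the inverse, is the subspace
topology. -/
lemma isEmbedding_GL (p : ℕ) [Fact p.Prime] : Topology.IsEmbedding
    (fun g : GL (Fin d) ℚ_[p] => (g : Matrix (Fin d) (Fin d) ℚ_[p])) := by
  refine Units.isEmbedding_val_mk' (f := fun X => X⁻¹) ?_ fun g => (Matrix.coe_units_inv g).symm
  intro X hX
  have h : X.det ≠ 0 := ((Matrix.isUnit_iff_isUnit_det X).1 hX).ne_zero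
  refine ContinuousAt.continuousWithinAt ?_
  simp only [Matrix.inv_def, Ring.inverse_eq_inv']
  exact ((Continuous.matrix_det continuous_id).continuousAt.inv₀ h).smul
    (Continuous.matrix_adjugate continuous_id).continuousAt

lemma isClosedEmbedding_ULp (p : ℕ) [Fact p.Prime] : Topology.IsClosedEmbedding
    (fun g : ULp p d => ((g : GL (Fin d) ℚ_[p]) : Matrix (Fin d) (Fin d) ℚ_[p])) := by
  refine ⟨(isEmbedding_GL p).comp Topology.IsEmbedding.subtypeVal, ?_⟩
  have : Set.range (fun g : ULp p d => ((g : GL (Fin d) ℚ_[p]) : Matrix (Fin d) (Fin d) ℚ_[p])) =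
      {X | ‖X.det‖ = 1} := by
    ext X
    constructor
    · rintro ⟨g, rfl⟩
      exact g.2
    · intro hX
      have h0 : X.det ≠ 0 := by
        rw [← norm_ne_zero_iff, show ‖X.det‖ = 1 from hX]; exact one_ne_zero
      exact ⟨⟨Matrix.GeneralLinearGroup.mkOfDetNeZero X h0, hX⟩, rfl⟩
  rw [this]
  exact isClosed_eq (Continuous.matrix_det continuous_id).norm continuous_const

/-- The source of the Hausdorff, second countable and locally compact properties of `UL S d`, and
the means to test measurability of maps into it on matrix entries. -/
theorem isClosedEmbedding_rows : Topology.IsClosedEmbedding (UL.rows (S := S) (d := d)) := by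
  have h1 : Topology.IsClosedEmbedding (Prod.map
      (fun g : Matrix.SpecialLinearGroup (Fin d) ℝ => (g : Matrix (Fin d) (Fin d) ℝ))
      (Pi.map fun p : S => fun g : ULp p.1.1 d =>
        ((g : GL (Fin d) ℚ_[p.1.1]) : Matrix (Fin d) (Fin d) ℚ_[p.1.1]))) :=
    isClosedEmbedding_SL.prodMap (.piMap fun p => isClosedEmbedding_ULp p.1.1)
  let e : (Matrix (Fin d) (Fin d) ℝ × ((p : S) → Matrix (Fin d) (Fin d) ℚ_[p.1.1])) ≃ₜ
      RowSpace S d d :=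
    { toFun := fun X i => (X.1 i, fun p => X.2 p i)
      invFun := fun X => (X.realMat, fun p => X.padicMat p)
      left_inv := fun X => rfl
      right_inv := fun X => rfl
      continuous_toFun := by fun_prop
      continuous_invFun := by
        unfold RowSpace.realMat RowSpace.padicMat
        refine Continuous.prodMk ?_ (continuous_pi fun p => ?_)
        · exact continuous_pi fun i => continuous_pi fun j => by fun_prop
        · exact continuous_pi fun i => continuous_pi fun j => by fun_prop }
  exact e.isClosedEmbedding.comp h1

instance : T2Space (UL S d) := isClosedEmbedding_rows.isEmbedding.t2Space

instance : SecondCountableTopology (UL S d) :=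
  isClosedEmbedding_rows.isEmbedding.secondCountableTopology

instance : LocallyCompactSpace (UL S d) := isClosedEmbedding_rows.locallyCompactSpace

lemma continuous_realMat : Continuous (UL.realMat (S := S) (d := d)) :=
  isClosedEmbedding_SL.continuous.comp continuous_fst

lemma continuous_padicMat (p : S) : Continuous fun g : UL S d => g.padicMat p :=
  (isClosedEmbedding_ULp p.1.1).continuous.comp ((continuous_apply p).comp continuous_snd)

lemma continuous_rowMul : Continuous fun x : QSVec S d × UL S d => rowMul x.1 x.2 := by
  unfold rowMul
  refine Continuous.prodMk ?_ (continuous_pi fun p => ?_)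
  · exact Continuous.matrix_vecMul (by fun_prop) (continuous_realMat.comp continuous_snd)
  · exact Continuous.matrix_vecMul (by fun_prop) ((continuous_padicMat p).comp continuous_snd)

lemma measurable_rowMul : Measurable fun x : QSVec S d × UL S d => rowMul x.1 x.2 :=
  continuous_rowMul.measurable

lemma realMat_mul (g h : UL S d) : (g * h).realMat = g.realMat * h.realMat := rfl

lemma padicMat_mul (g h : UL S d) (p : S) : (g * h).padicMat p = g.padicMat p * h.padicMat p := rfl

lemma rows_injective : Function.Injective (UL.rows (S := S) (d := d)) :=
  isClosedEmbedding_rows.injective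

lemma UL.ext_mat {g h : UL S d} (h1 : g.realMat = h.realMat)
    (h2 : ∀ p, g.padicMat p = h.padicMat p) : g = h :=
  rows_injective (funext fun i => Prod.ext (congrFun h1 i) (funext fun p => congrFun (h2 p) i))

lemma measurableEmbedding_rows : MeasurableEmbedding (UL.rows (S := S) (d := d)) :=
  isClosedEmbedding_rows.measurableEmbedding

end Topology

/-! ### Haar measure as a cone measure -/

section Cone

variable {S : Finset Nat.Primes} {d : ℕ}

/-- The square matrices over `ℚ_S` whose determinant is in `(0, 1]` at the infinite place and a unit
at the finite places. -/
def cone (S : Finset Nat.Primes) (d : ℕ) : Set (RowSpace S d d) :=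
  {X | (0 < X.realMat.det ∧ X.realMat.det ≤ 1) ∧ ∀ p : S, ‖(X.padicMat p).det‖ = 1}

lemma det_normalize {A : Matrix (Fin d) (Fin d) ℝ} (hA : 0 < A.det) :
    ((A.det ^ (-(1 / d : ℝ))) • A).det = 1 := by
  rcases Nat.eq_zero_or_pos d with rfl | hd
  · exact Matrix.det_isEmpty
  · rw [Matrix.det_smul, Fintype.card_fin, ← Real.rpow_natCast, ← Real.rpow_mul hA.le]
    have : (d : ℝ) ≠ 0 := by positivity
    rw [show -(1 / (d : ℝ)) * d = -1 by field_simp, Real.rpow_neg_one]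
    have hne : A.det ≠ 0 := hA.ne'
    exact inv_mul_cancel₀ hne

/-- The element of `UL_d(ℚ_S)` with given components. -/
def UL.ofMat (A : Matrix (Fin d) (Fin d) ℝ) (hA : A.det = 1)
    (B : (p : S) → Matrix (Fin d) (Fin d) ℚ_[p.1.1]) (hB : ∀ p, ‖(B p).det‖ = 1) : UL S d :=
  Prod.mk (α := Matrix.SpecialLinearGroup (Fin d) ℝ) (β := (p : S) → ULp p.1.1 d)
    ⟨A, hA⟩ (fun p => ⟨Matrix.GeneralLinearGroup.mkOfDetNeZero (B p)
      (by rw [← norm_ne_zero_iff, hB p]; exact one_ne_zero), hB p⟩)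

open scoped Classical in
/-- The radial projection of the cone to `UL_d(ℚ_S)`. -/
def coneMap (X : RowSpace S d d) : UL S d :=
  if h : X ∈ cone S d then
    UL.ofMat ((X.realMat.det ^ (-(1 / d : ℝ))) • X.realMat) (det_normalize h.1.1)
      (fun p => X.padicMat p) h.2
  else 1

lemma coneMap_realMat {X : RowSpace S d d} (h : X ∈ cone S d) :
    (coneMap X).realMat = (X.realMat.det ^ (-(1 / d : ℝ))) • X.realMat := by
  unfold coneMap; rw [dif_pos h]; rfl

lemma coneMap_padicMat {X : RowSpace S d d} (h : X ∈ cone S d) (p : S) :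
    (coneMap X).padicMat p = X.padicMat p := by
  unfold coneMap; rw [dif_pos h]; rfl

lemma continuous_RowSpace_realMat {n : ℕ} :
    Continuous (RowSpace.realMat : RowSpace S n d → Matrix (Fin n) (Fin d) ℝ) :=
  continuous_pi fun i => continuous_pi fun j => by unfold RowSpace.realMat; fun_prop

lemma continuous_RowSpace_padicMat {n : ℕ} (p : S) :
    Continuous (fun X : RowSpace S n d => X.padicMat p) :=
  continuous_pi fun i => continuous_pi fun j => by unfold RowSpace.padicMat; fun_prop

lemma continuous_det_realMat : Continuous fun X : RowSpace S d d => X.realMat.det :=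
  Continuous.matrix_det continuous_RowSpace_realMat

lemma continuous_det_padicMat (p : S) : Continuous fun X : RowSpace S d d => (X.padicMat p).det :=
  Continuous.matrix_det (continuous_RowSpace_padicMat p)

lemma measurableSet_cone : MeasurableSet (cone S d) := by
  refine MeasurableSet.inter (MeasurableSet.inter ?_ ?_) ?_
  · exact (isOpen_lt continuous_const continuous_det_realMat).measurableSet
  · exact (isClosed_le continuous_det_realMat continuous_const).measurableSet
  · have : {X : RowSpace S d d | ∀ p : S, ‖(X.padicMat p).det‖ = 1} =
        ⋂ p : S, {X | ‖(X.padicMat p).det‖ = 1} := by ext; simp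
    change MeasurableSet {X : RowSpace S d d | ∀ p : S, ‖(X.padicMat p).det‖ = 1}
    rw [this]
    exact MeasurableSet.iInter fun p =>
      (isClosed_eq (continuous_det_padicMat p).norm continuous_const).measurableSet

open scoped Classical in
lemma measurable_coneMap : Measurable (coneMap (S := S) (d := d)) := by
  rw [← measurableEmbedding_rows.measurable_comp_iff]
  have : UL.rows ∘ coneMap (S := S) (d := d) = fun X => if X ∈ cone S d then
      fun i => ((X.realMat.det ^ (-(1 / d : ℝ))) • (X i).1, (X i).2) else (1 : UL S d).rows := by
    funext X
    simp only [Function.comp]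
    split_ifs with h
    · funext i
      refine Prod.ext ?_ (funext fun p => ?_)
      · change (coneMap X).realMat i = _
        rw [coneMap_realMat h]; rfl
      · change (coneMap X).padicMat p i = _
        rw [coneMap_padicMat h]; rfl
    · unfold coneMap; rw [dif_neg h]
  rw [this]
  refine Measurable.ite measurableSet_cone ?_ measurable_const
  refine measurable_pi_lambda _ fun i => Measurable.prodMk ?_ (by fun_prop)
  exact (continuous_det_realMat.measurable.pow_const _).smul (by fun_prop)

lemma realMat_rowsMul (X : RowSpace S d d) (g : UL S d) :
    (rowsMul X g).realMat = X.realMat * g.realMat := rfl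

lemma padicMat_rowsMul (X : RowSpace S d d) (g : UL S d) (p : S) :
    (rowsMul X g).padicMat p = X.padicMat p * g.padicMat p := rfl

lemma realMat_mulRows (X : RowSpace S d d) (g : UL S d) :
    (mulRows g X).realMat = g.realMat * X.realMat := rfl

lemma padicMat_mulRows (X : RowSpace S d d) (g : UL S d) (p : S) :
    (mulRows g X).padicMat p = g.padicMat p * X.padicMat p := rfl

lemma rowsMul_mem_cone (X : RowSpace S d d) (g : UL S d) :
    rowsMul X g ∈ cone S d ↔ X ∈ cone S d := by
  simp only [cone, Set.mem_ofPred_eq, realMat_rowsMul, padicMat_rowsMul, Matrix.det_mul, norm_mul,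
    g.det_realMat, g.norm_det_padicMat, mul_one]

lemma mulRows_mem_cone (X : RowSpace S d d) (g : UL S d) :
    mulRows g X ∈ cone S d ↔ X ∈ cone S d := by
  simp only [cone, Set.mem_ofPred_eq, realMat_mulRows, padicMat_mulRows, Matrix.det_mul, norm_mul,
    g.det_realMat, g.norm_det_padicMat, one_mul]

lemma coneMap_rowsMul {X : RowSpace S d d} (h : X ∈ cone S d) (g : UL S d) :
    coneMap (rowsMul X g) = coneMap X * g := by
  have h' := (rowsMul_mem_cone X g).2 h
  refine UL.ext_mat ?_ fun p => ?_
  · rw [coneMap_realMat h', realMat_mul, coneMap_realMat h, realMat_rowsMul, Matrix.det_mul,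
      g.det_realMat, mul_one, Matrix.smul_mul]
  · rw [coneMap_padicMat h', padicMat_mul, coneMap_padicMat h, padicMat_rowsMul]

lemma coneMap_mulRows {X : RowSpace S d d} (h : X ∈ cone S d) (g : UL S d) :
    coneMap (mulRows g X) = g * coneMap X := by
  have h' := (mulRows_mem_cone X g).2 h
  refine UL.ext_mat ?_ fun p => ?_
  · rw [coneMap_realMat h', realMat_mul, coneMap_realMat h, realMat_mulRows, Matrix.det_mul,
      g.det_realMat, one_mul, Matrix.mul_smul]
  · rw [coneMap_padicMat h', padicMat_mul, coneMap_padicMat h, padicMat_mulRows]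

/-- The cone measure on `UL_d(ℚ_S)`. -/
def coneMeasure (S : Finset Nat.Primes) (d : ℕ) : Measure (UL S d) :=
  ((volRows S d d).restrict (cone S d)).map coneMap

/-- Multiplication by `g` preserves the volume of matrices and the determinant conditions of the
cone, and it commutes with the radial projection. The same holds on the right. -/
instance : (coneMeasure S d).IsMulLeftInvariant where
  map_mul_left_eq_self g := by
    unfold coneMeasure
    have hm : MeasurePreserving (mulRows g) ((volRows S d d).restrict (cone S d))
        ((volRows S d d).restrict (cone S d)) := by
      have := (measurePreserving_mulRows g).restrict_preimage measurableSet_cone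
      rwa [show mulRows g ⁻¹' cone S d = cone S d from
        Set.ext fun X => mulRows_mem_cone X g] at this
    rw [Measure.map_map (measurable_const_mul g) measurable_coneMap]
    conv_rhs => rw [← hm.map_eq, Measure.map_map measurable_coneMap hm.measurable]
    refine Measure.map_congr ?_
    filter_upwards [ae_restrict_mem measurableSet_cone] with X hX
    exact (coneMap_mulRows hX g).symm

instance : (coneMeasure S d).IsMulRightInvariant where
  map_mul_right_eq_self g := by
    unfold coneMeasure
    have hm : MeasurePreserving (fun X => rowsMul X g) ((volRows S d d).restrict (cone S d))
        ((volRows S d d).restrict (cone S d)) := by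
      have := (measurePreserving_rowsMul d g).restrict_preimage measurableSet_cone
      rwa [show (fun X => rowsMul X g) ⁻¹' cone S d = cone S d from
        Set.ext fun X => rowsMul_mem_cone X g] at this
    rw [Measure.map_map (measurable_mul_const g) measurable_coneMap]
    conv_rhs => rw [← hm.map_eq, Measure.map_map measurable_coneMap hm.measurable]
    refine Measure.map_congr ?_
    filter_upwards [ae_restrict_mem measurableSet_cone] with X hX
    exact (coneMap_rowsMul hX g).symm

/-- The determinant is at most one, so the projection multiplies the real part by a factor at least
one. Hence the preimage of a compact set is bounded, which makes the cone measure finite on compact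
sets. -/
lemma norm_le_norm_rows_coneMap {X : RowSpace S d d} (h : X ∈ cone S d) :
    ‖X‖ ≤ ‖(coneMap X).rows‖ := by
  refine (pi_norm_le_iff_of_nonneg (norm_nonneg _)).2 fun i => ?_
  refine le_trans ?_ (norm_le_pi_norm _ i)
  refine max_le ?_ ?_
  · refine le_trans ?_ (le_max_left _ _)
    change ‖(X i).1‖ ≤ ‖(coneMap X).realMat i‖
    rw [coneMap_realMat h]
    change _ ≤ ‖(X.realMat.det ^ (-(1 / d : ℝ))) • (X i).1‖
    rw [norm_smul]
    refine le_mul_of_one_le_left (norm_nonneg _) ?_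
    rw [Real.norm_eq_abs]
    refine le_trans ?_ (le_abs_self _)
    exact Real.one_le_rpow_of_pos_of_le_one_of_nonpos h.1.1 h.1.2 (by
      rw [neg_nonpos]; positivity)
  · refine le_trans (le_of_eq ?_) (le_max_right _ _)
    congr 1
    funext p
    change _ = (coneMap X).padicMat p i
    rw [coneMap_padicMat h]; rfl

instance : IsFiniteMeasureOnCompacts (coneMeasure S d) where
  lt_top_of_isCompact := by
    intro K hK
    obtain ⟨R, hR⟩ := (hK.image isClosedEmbedding_rows.continuous).isBounded.exists_norm_le
    unfold coneMeasure
    rw [Measure.map_apply measurable_coneMap hK.measurableSet,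
      Measure.restrict_apply (measurable_coneMap hK.measurableSet)]
    refine lt_of_le_of_lt (measure_mono ?_)
      ((isCompact_closedBall (0 : RowSpace S d d) R).measure_lt_top (μ := volRows S d d))
    rintro X ⟨hX, hc⟩
    rw [mem_closedBall_zero_iff]
    exact (norm_le_norm_rows_coneMap hc).trans (hR _ ⟨_, hX, rfl⟩)

/-- The interior part of the cone. -/
def openCone (S : Finset Nat.Primes) (d : ℕ) : Set (RowSpace S d d) :=
  {X | (0 < X.realMat.det ∧ X.realMat.det < 1) ∧ ∀ p : S, ‖(X.padicMat p).det‖ = 1}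

lemma isOpen_openCone : IsOpen (openCone S d) := by
  refine IsOpen.inter (IsOpen.inter ?_ ?_) ?_
  · exact isOpen_lt continuous_const continuous_det_realMat
  · exact isOpen_lt continuous_det_realMat continuous_const
  · have : {X : RowSpace S d d | ∀ p : S, ‖(X.padicMat p).det‖ = 1} =
        ⋂ p : S, (fun X => (X.padicMat p).det) ⁻¹' Metric.sphere 0 1 := by ext; simp
    change IsOpen {X : RowSpace S d d | ∀ p : S, ‖(X.padicMat p).det‖ = 1}
    rw [this]
    exact isOpen_iInter_of_finite fun p =>
      (IsUltrametricDist.isOpen_sphere 0 one_ne_zero).preimage (continuous_det_padicMat p)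

lemma openCone_subset : openCone S d ⊆ cone S d := fun _ h => ⟨⟨h.1.1, h.1.2.le⟩, h.2⟩

lemma openCone_nonempty (hd : d ≠ 0) : (openCone S d).Nonempty := by
  let i : Fin d := ⟨0, Nat.pos_of_ne_zero hd⟩
  refine ⟨fun j => (Matrix.diagonal (Pi.mulSingle i (1 / 2 : ℝ)) j, fun p => (1 : Matrix _ _ _) j),
    ?_, fun p => ?_⟩
  · change 0 < (Matrix.diagonal (Pi.mulSingle i (1 / 2 : ℝ))).det ∧
      (Matrix.diagonal (Pi.mulSingle i (1 / 2 : ℝ))).det < 1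
    rw [Matrix.det_diagonal, Fintype.prod_eq_single i fun j hj => Pi.mulSingle_eq_of_ne hj _,
      Pi.mulSingle_eq_same]
    norm_num
  · change ‖(1 : Matrix (Fin d) (Fin d) ℚ_[p.1.1]).det‖ = 1
    simp

/-- Every Haar measure on `UL_d(ℚ_S)` is a multiple of the cone measure. -/
theorem exists_coneMeasure_eq_smul (hd : d ≠ 0) (μ : Measure (UL S d)) [μ.IsHaarMeasure] :
    ∃ c : ℝ≥0, c ≠ 0 ∧ coneMeasure S d = c • μ := by
  refine ⟨_, ?_, Measure.isMulLeftInvariant_eq_smul (coneMeasure S d) μ⟩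
  -- With the constant zero the cone measure would vanish, but its total mass is at least the volume
  -- of a nonempty open set.
  intro h0
  have h := Measure.isMulLeftInvariant_eq_smul (coneMeasure S d) μ
  rw [h0, zero_smul] at h
  have h1 : coneMeasure S d Set.univ = volRows S d d (cone S d) := by
    unfold coneMeasure
    rw [Measure.map_apply measurable_coneMap MeasurableSet.univ]; simp
  have h2 : 0 < volRows S d d (cone S d) :=
    (isOpen_openCone.measure_pos _ (openCone_nonempty hd)).trans_le (measure_mono openCone_subset)
  rw [← h1, h] at h2
  exact lt_irrefl _ h2

/-- Unimodularity of the group: the cone measure is invariant on both sides, and every Haar measure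
is a multiple of it. -/
theorem isMulRightInvariant_of_isHaarMeasure (hd : d ≠ 0) (μ : Measure (UL S d))
    [μ.IsHaarMeasure] : μ.IsMulRightInvariant := by
  obtain ⟨c, hc, h⟩ := exists_coneMeasure_eq_smul hd μ
  have : μ = c⁻¹ • coneMeasure S d := by
    rw [h, smul_smul, inv_mul_cancel₀ hc, one_smul]
  rw [this]
  infer_instance

end Cone

/-! ### Invariant measures on the space of vectors -/

section Uniqueness

variable {S : Finset Nat.Primes} {d : ℕ}

/-- Scaling of the component at the infinite place. -/
def realScale (t : ℝ) (v : QSVec S d) : QSVec S d := (t • v.1, v.2)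

lemma measurable_realScale : Measurable fun x : ℝ × QSVec S d => realScale x.1 x.2 := by
  unfold realScale
  exact Measurable.prodMk (measurable_fst.smul measurable_snd.fst) measurable_snd.snd

lemma measurable_realScale_const (t : ℝ) : Measurable (realScale t : QSVec S d → QSVec S d) :=
  measurable_realScale.comp (measurable_const.prodMk measurable_id)

lemma map_realScale {t : ℝ} (ht : t ≠ 0) :
    (volS S d).map (realScale t) = ENNReal.ofReal |(t ^ d)⁻¹| • volS S d := by
  have h : (volume : Measure (Fin d → ℝ)).map (fun x => t • x) =
      ENNReal.ofReal |(t ^ d)⁻¹| • volume := by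
    have := Measure.map_addHaar_smul (volume : Measure (Fin d → ℝ)) ht
    simpa using this
  unfold volS
  rw [← Measure.prod_smul_left, ← h]
  conv_rhs => rw [← Measure.map_id (μ := Measure.pi fun p : S => volPadic p.1.1 d)]
  rw [Measure.map_prod_map _ _ (measurable_const_smul t) measurable_id]
  rfl

lemma volS_preimage_realScale {t : ℝ} (ht : t ≠ 0) {A : Set (QSVec S d)} (hA : MeasurableSet A) :
    volS S d (realScale t ⁻¹' A) = ENNReal.ofReal |(t ^ d)⁻¹| * volS S d A := by
  rw [← Measure.map_apply (measurable_realScale_const t) hA, map_realScale ht]; rfl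

lemma volPadic_hyperplane (p : ℕ) [Fact p.Prime] (i : Fin d) :
    ∀ᵐ v ∂(volPadic p d), v i ≠ 0 := by
  let ν : Measure ℚ_[p] := Measure.addHaar
  have hν : (Measure.pi fun _ : Fin d => ν).IsAddHaarMeasure := Measure.pi.isAddHaarMeasure _
  have h := Measure.isAddLeftInvariant_eq_smul (volPadic p d) (Measure.pi fun _ : Fin d => ν)
  rw [ae_iff, h, Measure.smul_apply]
  have h0 : (Measure.pi fun _ : Fin d => ν) {v | v i = 0} = 0 :=
    Measure.pi_hyperplane (fun _ : Fin d => ν) i 0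
  simp only [ne_eq, not_not]
  rw [h0, smul_zero]

lemma ae_volS_ne_zero (i : Fin d) :
    ∀ᵐ v ∂(volS S d), v.1 i ≠ 0 ∧ ∀ p : S, v.2 p i ≠ 0 := by
  refine Filter.Eventually.and ?_ (ae_all_iff.2 fun p => ?_)
  · have h : ∀ᵐ x : Fin d → ℝ, x i ≠ 0 := by
      rw [ae_iff]
      simp only [ne_eq, not_not]
      exact Measure.pi_hyperplane (fun _ : Fin d => (volume : Measure ℝ)) i 0
    exact Measure.quasiMeasurePreserving_fst.ae h
  · exact (Measure.quasiMeasurePreserving_eval (μ := fun p : S => volPadic p.1.1 d) p).ae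
      (volPadic_hyperplane p.1.1 i) |> Measure.quasiMeasurePreserving_snd.ae

/-- Rows completing a vector `v` to a square matrix of determinant `v 0 * a`. -/
def completion {K : Type*} [Zero K] [One K] (n : ℕ) (a : K) : Fin (n + 1) → Fin (n + 2) → K :=
  fun i j => if j = i.succ then (if i = 0 then a else 1) else 0

lemma det_cons_completion {K : Type*} [CommRing K] (n : ℕ) (a : K) (v : Fin (n + 2) → K) :
    (Matrix.of (Fin.cons v (completion n a) : Fin (n + 2) → Fin (n + 2) → K)).det = v 0 * a := by
  rw [Matrix.det_of_isUpperTriangular]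
  · rw [Fin.prod_univ_succ, Fin.prod_univ_succ]
    simp [completion]
  · intro i j hij
    induction i using Fin.cases with
    | zero => exact absurd hij (Fin.not_lt_zero j)
    | succ i =>
      have : j ≠ i.succ := ne_of_lt hij
      simp [completion, this]

variable {m : ℕ}

/-- Fubini along the first row. When the first coordinates of `v` are nonzero at all places, the
lower rows that complete `v` to a point of the open cone form a nonempty open set, of positive
measure; so a null event for `X` forces almost every `v` to avoid `A`. -/
lemma ae_cone_iff (A : Set (QSVec S (m + 2))) :
    (∀ᵐ X ∂((volRows S (m + 2) (m + 2)).restrict (cone S (m + 2))), X 0 ∉ A) ↔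
      volS S (m + 2) A = 0 := by
  constructor
  · intro h
    rw [ae_restrict_iff' measurableSet_cone] at h
    have hmp := measurePreserving_piFinSuccAbove (fun _ : Fin (m + 2) => volS S (m + 2)) 0
    have h1 := hmp.symm.quasiMeasurePreserving.ae h
    have : SigmaFinite (Measure.pi fun _ : Fin (m + 1) => volS S (m + 2)) := Measure.pi.sigmaFinite _
    have h2 := Measure.ae_ae_of_ae_prod h1
    rw [measure_eq_zero_iff_ae_notMem]
    filter_upwards [h2, ae_volS_ne_zero (S := S) (0 : Fin (m + 2))] with v hv hv0 hvA
    let U : Set (Fin (m + 1) → QSVec S (m + 2)) :=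
      {Y | (Fin.cons v Y : RowSpace S (m + 2) (m + 2)) ∈ openCone S (m + 2)}
    have hcont : Continuous fun Y : Fin (m + 1) → QSVec S (m + 2) =>
        (Fin.cons v Y : RowSpace S (m + 2) (m + 2)) := by
      refine continuous_pi fun i => ?_
      induction i using Fin.cases with
      | zero => exact continuous_const
      | succ i => exact continuous_apply i
    have hU : IsOpen U := isOpen_openCone.preimage hcont
    have hne : U.Nonempty := by
      -- These entries make the determinant 1/2 at the infinite place, strictly between 0 and 1, and
      -- 1 at the finite places.
      refine ⟨fun i => (completion m ((2 * v.1 0)⁻¹) i, fun p => completion m (v.2 p 0)⁻¹ i), ?_, ?_⟩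
      · have : RowSpace.realMat (Fin.cons v (fun i => (completion m ((2 * v.1 0)⁻¹) i,
            fun p => completion m (v.2 p 0)⁻¹ i)) : RowSpace S (m + 2) (m + 2)) =
            Matrix.of (Fin.cons v.1 (completion m ((2 * v.1 0)⁻¹)) :
              Fin (m + 2) → Fin (m + 2) → ℝ) := by
          ext i j
          induction i using Fin.cases with
          | zero => rfl
          | succ i => rfl
        rw [this, det_cons_completion]
        have : v.1 0 * (2 * v.1 0)⁻¹ = 1 / 2 := by have := hv0.1; field_simp
        rw [this]; norm_num
      · intro p
        have : RowSpace.padicMat (Fin.cons v (fun i => (completion m ((2 * v.1 0)⁻¹) i,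
            fun p => completion m (v.2 p 0)⁻¹ i)) : RowSpace S (m + 2) (m + 2)) p =
            Matrix.of (Fin.cons (v.2 p) (completion m (v.2 p 0)⁻¹) :
              Fin (m + 2) → Fin (m + 2) → ℚ_[p.1.1]) := by
          ext i j
          induction i using Fin.cases with
          | zero => rfl
          | succ i => rfl
        rw [this, det_cons_completion, mul_inv_cancel₀ (hv0.2 p), norm_one]
    have hpos : 0 < volRows S (m + 1) (m + 2) U := hU.measure_pos _ hne
    have hzero : volRows S (m + 1) (m + 2) U = 0 := by
      rw [measure_eq_zero_iff_ae_notMem]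
      filter_upwards [hv] with Y hY hYU
      have e : (MeasurableEquiv.piFinSuccAbove (fun _ : Fin (m + 2) => QSVec S (m + 2)) 0).symm (v, Y)
          = Fin.cons v Y := Fin.insertNth_zero' v Y
      rw [e] at hY
      exact hY (openCone_subset hYU) hvA
    exact hpos.ne' hzero
  · intro h
    refine ae_restrict_of_ae ?_
    exact (Measure.quasiMeasurePreserving_eval (μ := fun _ : Fin (m + 2) => volS S (m + 2)) 0).ae
      (measure_eq_zero_iff_ae_notMem.1 h)

/-- The diagonal matrix with entries `t`, `t⁻¹`, `1`, ... at the infinite place. -/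
def realDiag (S : Finset Nat.Primes) (m : ℕ) (t : ℝ) (ht : t ≠ 0) : UL S (m + 2) :=
  UL.ofMat (Matrix.diagonal (Fin.cons t (Fin.cons t⁻¹ fun _ => 1)))
    (by
      rw [Matrix.det_diagonal, Fin.prod_univ_succ, Fin.prod_univ_succ]
      simp [ht]) (fun _ => 1) (fun _ => by simp)

lemma rows_realDiag_mul (t : ℝ) (ht : t ≠ 0) (g : UL S (m + 2)) :
    (realDiag S m t ht * g).rows 0 = realScale t (g.rows 0) := by
  refine Prod.ext ?_ (funext fun p => ?_)
  · have h : (realDiag S m t ht * g).realMat =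
        Matrix.diagonal (Fin.cons t (Fin.cons t⁻¹ fun _ => 1)) * g.realMat := rfl
    change (realDiag S m t ht * g).realMat 0 = t • g.realMat 0
    funext j
    rw [h, Matrix.diagonal_mul]; rfl
  · have h : (realDiag S m t ht * g).padicMat p = 1 * g.padicMat p := rfl
    change (realDiag S m t ht * g).padicMat p 0 = g.padicMat p 0
    rw [h, one_mul]

lemma measurable_firstRow : Measurable fun g : UL S (m + 2) => g.rows 0 :=
  (measurable_pi_apply 0).comp measurableEmbedding_rows.measurable

instance : SFinite (coneMeasure S d) := by unfold coneMeasure; infer_instance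

lemma ae_coneMeasure_realScale {A : Set (QSVec S (m + 2))} (t : ℝ)
    (ht : t ≠ 0) : (∀ᵐ g ∂(coneMeasure S (m + 2)), realScale t (g.rows 0) ∉ A) ↔
      ∀ᵐ g ∂(coneMeasure S (m + 2)), g.rows 0 ∉ A := by
  have h : (coneMeasure S (m + 2)) ((fun g => realDiag S m t ht * g) ⁻¹' {g | g.rows 0 ∈ A}) =
      coneMeasure S (m + 2) {g | g.rows 0 ∈ A} := measure_preimage_mul _ _ _
  have e : (fun g => realDiag S m t ht * g) ⁻¹' {g | g.rows 0 ∈ A} =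
      {g | realScale t (g.rows 0) ∈ A} := by
    ext g
    simp only [Set.mem_preimage, Set.mem_ofPred_eq, rows_realDiag_mul]
  rw [e] at h
  simp only [ae_iff, not_not]
  rw [h]

lemma rows_coneMap_zero {X : RowSpace S (m + 2) (m + 2)} (hX : X ∈ cone S (m + 2)) :
    (coneMap X).rows 0 = realScale (X.realMat.det ^ (-(1 / (m + 2 : ℕ) : ℝ))) (X 0) := by
  refine Prod.ext ?_ (funext fun p => ?_)
  · change (coneMap X).realMat 0 = _
    rw [coneMap_realMat hX]; rfl
  · change (coneMap X).padicMat p 0 = _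
    rw [coneMap_padicMat hX]; rfl

/-- The first row of a random element of `UL_d(ℚ_S)` has the null sets of the volume. -/
theorem ae_firstRow_iff {A : Set (QSVec S (m + 2))} (hA : MeasurableSet A) :
    (∀ᵐ g ∂(coneMeasure S (m + 2)), g.rows 0 ∉ A) ↔ volS S (m + 2) A = 0 := by
  set lam := (volRows S (m + 2) (m + 2)).restrict (cone S (m + 2)) with hlam
  -- The logarithm of the radial factor: on the cone, the first row of `coneMap X` is that of `X`
  -- with its real part multiplied by `exp (σ X)`.
  set σ : RowSpace S (m + 2) (m + 2) → ℝ := fun X =>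
    Real.log X.realMat.det * (-(1 / (m + 2 : ℕ) : ℝ)) with hσ
  have hσm : Measurable σ := (continuous_det_realMat.measurable.log).mul_const _
  have hmeas : MeasurableSet {x : ℝ × RowSpace S (m + 2) (m + 2) |
      realScale (Real.exp x.1) (x.2 0) ∉ A} := by
    refine MeasurableSet.compl (measurable_realScale.comp (Measurable.prodMk ?_ ?_) hA)
    · exact Real.measurable_exp.comp measurable_fst
    · exact (measurable_pi_apply 0).comp measurable_snd
  have hmeas' : MeasurableSet {x : ℝ × RowSpace S (m + 2) (m + 2) |
      realScale (Real.exp (x.1 + σ x.2)) (x.2 0) ∉ A} := by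
    have hf : Measurable fun x : ℝ × RowSpace S (m + 2) (m + 2) => (x.1 + σ x.2, x.2) :=
      (measurable_fst.add (hσm.comp measurable_snd)).prodMk measurable_snd
    exact hf hmeas
  -- Left translation by `realDiag` rescales the real part of the first row, so an arbitrary factor
  -- `exp s` can be inserted without changing the left side.
  have step1 : ∀ s : ℝ, (∀ᵐ g ∂(coneMeasure S (m + 2)), g.rows 0 ∉ A) ↔
      ∀ᵐ X ∂lam, realScale (Real.exp (s + σ X)) (X 0) ∉ A := by
    intro s
    rw [← ae_coneMeasure_realScale (Real.exp s) (Real.exp_pos s).ne']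
    unfold coneMeasure
    have hset : MeasurableSet {g : UL S (m + 2) | realScale (Real.exp s) (g.rows 0) ∉ A} :=
      (((measurable_realScale_const _).comp measurable_firstRow) hA).compl
    rw [ae_map_iff measurable_coneMap.aemeasurable hset]
    refine Filter.eventually_congr ?_
    filter_upwards [ae_restrict_mem measurableSet_cone] with X hX
    rw [rows_coneMap_zero hX, Real.rpow_def_of_pos hX.1.1, Real.exp_add]
    simp only [realScale, smul_smul, hσ]
  have step2 : (∀ᵐ g ∂(coneMeasure S (m + 2)), g.rows 0 ∉ A) ↔
      ∀ᵐ s : ℝ, ∀ᵐ X ∂lam, realScale (Real.exp (s + σ X)) (X 0) ∉ A := by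
    simp only [← step1, Filter.eventually_const]
  -- Once `s` is averaged over the line, translation invariance absorbs the shift `σ X`. This
  -- removes the radial projection and leaves the first row of `X` itself.
  have step3 : (∀ᵐ s : ℝ, ∀ᵐ X ∂lam, realScale (Real.exp (s + σ X)) (X 0) ∉ A) ↔
      ∀ᵐ s : ℝ, ∀ᵐ X ∂lam, realScale (Real.exp s) (X 0) ∉ A := by
    refine (Measure.ae_ae_comm hmeas').trans (Iff.trans ?_ (Measure.ae_ae_comm hmeas).symm)
    refine Filter.eventually_congr (Filter.Eventually.of_forall fun X => ?_)
    have hB : MeasurableSet {s : ℝ | realScale (Real.exp s) (X 0) ∉ A} :=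
      (measurable_id.prodMk measurable_const : Measurable fun s : ℝ => (s, X)) hmeas
    have := (measurePreserving_add_right (volume : Measure ℝ) (σ X)).map_eq
    conv_rhs => rw [← this]
    rw [ae_map_iff (measurable_add_const _).aemeasurable hB]
  have step4 : (∀ᵐ s : ℝ, ∀ᵐ X ∂lam, realScale (Real.exp s) (X 0) ∉ A) ↔
      ∀ᵐ s : ℝ, volS S (m + 2) A = 0 := by
    refine Filter.eventually_congr (Filter.Eventually.of_forall fun s => ?_)
    have := ae_cone_iff (realScale (Real.exp s) ⁻¹' A)
    refine this.trans ?_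
    rw [volS_preimage_realScale (Real.exp_pos s).ne' hA, mul_eq_zero]
    simp only [ENNReal.ofReal_eq_zero, or_iff_right_iff_imp]
    intro h
    exact absurd h (not_le.2 (abs_pos.2 (inv_ne_zero (pow_ne_zero _ (Real.exp_pos s).ne'))))
  rw [step2, step3, step4, Filter.eventually_const]

lemma coneMeasure_ne_zero (hd : d ≠ 0) : coneMeasure S d ≠ 0 := by
  intro h
  have h1 : coneMeasure S d Set.univ = volRows S d d (cone S d) := by
    unfold coneMeasure
    rw [Measure.map_apply measurable_coneMap MeasurableSet.univ]; simp
  have h2 : 0 < volRows S d d (cone S d) :=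
    (isOpen_openCone.measure_pos _ (openCone_nonempty hd)).trans_le (measure_mono openCone_subset)
  rw [← h1, h] at h2
  exact lt_irrefl _ h2

/-- A measure on `ℚ_S ^ d` which is invariant under `UL_d(ℚ_S)` and absolutely continuous is a
multiple of the volume. -/
theorem exists_eq_smul_volS (ν : Measure (QSVec S (m + 2))) [SFinite ν]
    (hinv : ∀ g : UL S (m + 2), ν.map (fun v => rowMul v g) = ν) (hac : ν ≪ volS S (m + 2)) :
    ∃ c : ℝ≥0∞, ν = c • volS S (m + 2) := by
  set ρ := ν.rnDeriv (volS S (m + 2)) with hρ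
  have hρm : Measurable ρ := Measure.measurable_rnDeriv _ _
  have hν : (volS S (m + 2)).withDensity ρ = ν := Measure.withDensity_rnDeriv_eq _ _ hac
  have hR : ∀ g : UL S (m + 2), Measurable fun v : QSVec S (m + 2) => rowMul v g := fun g =>
    (measurePreserving_rowMul g).measurable
  have hρinv : ∀ g : UL S (m + 2), ∀ᵐ v ∂(volS S (m + 2)), ρ (rowMul v g) = ρ v := by
    intro g
    refine (withDensity_eq_iff_of_sigmaFinite (hρm.comp (hR g)).aemeasurable hρm.aemeasurable).1 ?_
    rw [hν]
    ext A hA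
    have h1 : ν A = ν ((fun v => rowMul v g⁻¹) ⁻¹' A) := by
      rw [← Measure.map_apply (hR _) hA, hinv]
    rw [h1, ← hν, withDensity_apply _ hA, withDensity_apply _ (hR _ hA),
      ← (measurePreserving_rowMul g).setLIntegral_comp_preimage (hR _ hA) hρm]
    have : (fun v => rowMul v g) ⁻¹' ((fun v => rowMul v g⁻¹) ⁻¹' A) = A := by
      ext v
      simp only [Set.mem_preimage, ← rowMul_mul, mul_inv_cancel, rowMul_one]
    rw [this]; rfl
  have hP : MeasurableSet {x : UL S (m + 2) × QSVec S (m + 2) | ρ (rowMul x.2 x.1) = ρ x.2} :=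
    measurableSet_eq_fun (hρm.comp (measurable_rowMul.comp measurable_swap))
      (hρm.comp measurable_snd)
  -- The exceptional null set of `hρinv` depends on `g`. Exchanging the quantifiers by Fubini gives
  -- vectors `v` that are good for almost every `g`, and one of them is the first row of some `h`.
  have h1 : ∀ᵐ v ∂(volS S (m + 2)), ∀ᵐ g ∂(coneMeasure S (m + 2)), ρ (rowMul v g) = ρ v :=
    (Measure.ae_ae_comm hP).1 (Filter.Eventually.of_forall hρinv)
  obtain ⟨N, hN, hNm, hN0⟩ := exists_measurable_superset_of_null (ae_iff.1 h1)
  have h2 : ∀ᵐ h ∂(coneMeasure S (m + 2)), h.rows 0 ∉ N := (ae_firstRow_iff hNm).2 hN0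
  have : (ae (coneMeasure S (m + 2))).NeBot := ae_neBot.2 (coneMeasure_ne_zero (by omega))
  obtain ⟨h, hh⟩ := h2.exists
  have h3 : ∀ᵐ g ∂(coneMeasure S (m + 2)), ρ (rowMul (h.rows 0) g) = ρ (h.rows 0) := by
    by_contra hcon
    exact hh (hN hcon)
  set c := ρ (h.rows 0)
  refine ⟨c, ?_⟩
  have hA : MeasurableSet {v | ρ v ≠ c} := (hρm (measurableSet_singleton c)).compl
  -- The first row of `h` times `g` is the first row of `h * g`, so left invariance makes the
  -- density equal to `c` at the first row of almost every `g`.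
  have h4 : ∀ᵐ g ∂(coneMeasure S (m + 2)), g.rows 0 ∉ {v | ρ v ≠ c} := by
    have e : coneMeasure S (m + 2) ((fun g => h * g) ⁻¹' {g | g.rows 0 ∈ {v | ρ v ≠ c}}) =
      coneMeasure S (m + 2) {g | g.rows 0 ∈ {v | ρ v ≠ c}} := measure_preimage_mul _ _ _
    rw [ae_iff]
    simp only [not_not]
    rw [← e]
    exact ae_iff.1 h3
  have h5 : ρ =ᵐ[volS S (m + 2)] fun _ => c := by
    have := (ae_firstRow_iff hA).1 h4
    exact ae_iff.2 this
  rw [← hν, withDensity_congr_ae h5, withDensity_const]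

end Uniqueness

/-! ### The diagonal lattice and its fundamental box -/

section Lattice

variable {S : Finset Nat.Primes} {d : ℕ}

lemma norm_sub_le_max {E : Type*} [SeminormedAddCommGroup E] [IsUltrametricDist E] (x y : E) :
    ‖x - y‖ ≤ max ‖x‖ ‖y‖ := by
  rw [sub_eq_add_neg, ← norm_neg y]
  exact IsUltrametricDist.norm_add_le_max _ _

lemma not_dvd_den_of_padicNorm_le_one {p : ℕ} [Fact p.Prime] {z : ℚ} (h : padicNorm p z ≤ 1) :
    ¬ p ∣ z.den := by
  intro hp
  have hnum : padicNorm p (z.num : ℚ) = 1 := by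
    rw [padicNorm.int_eq_one_iff]
    intro hn
    have h1 : p ∣ z.num.natAbs := Int.natCast_dvd.1 hn
    have h2 : p ∣ 1 := by rw [← z.reduced]; exact Nat.dvd_gcd h1 hp
    exact (Fact.out : p.Prime).one_lt.ne' (Nat.dvd_one.1 h2)
  have hden : padicNorm p (z.den : ℚ) < 1 := (padicNorm.nat_lt_one_iff _).2 hp
  have hz : z * z.den = z.num := Rat.mul_den_eq_num z
  have := congrArg (padicNorm p) hz
  rw [padicNorm.mul, hnum] at this
  have h0 : 0 ≤ padicNorm p (z.den : ℚ) := padicNorm.nonneg _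
  nlinarith [padicNorm.nonneg (p := p) z]

lemma exists_int_of_padicNorm_le_one {z : ℚ} (h : ∀ p : Nat.Primes, padicNorm p.1 z ≤ 1) :
    ∃ n : ℤ, (n : ℚ) = z := by
  refine ⟨z.num, ?_⟩
  have : z.den = 1 := by
    by_contra hne
    obtain ⟨p, hp, hpd⟩ := Nat.exists_prime_and_dvd hne
    have : Fact p.Prime := ⟨hp⟩
    exact not_dvd_den_of_padicNorm_le_one (h ⟨p, hp⟩) hpd
  exact Rat.coe_int_num_of_den_eq_one this

lemma inv_den_mem_ZS {z : ℚ} (hz : z ∈ ZS S) : ((z.den : ℚ)⁻¹) ∈ ZS S := by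
  intro p hp
  have h := not_dvd_den_of_padicNorm_le_one (hz p hp)
  have h1 : padicNorm p.1 (z.den : ℚ) = 1 := (padicNorm.nat_eq_one_iff _).2 h
  rw [← one_div, padicNorm.div, h1]
  simp

lemma norm_toPadic (p : S) (z : ZS S) : ‖ZS.toPadic S p z‖ = padicNorm p.1.1 (z : ℚ) :=
  Padic.eq_padicNorm _

/-- Approximation of a `p`-adic number by a rational number which is integral outside `p`. -/
lemma exists_rat_approx (p : Nat.Primes) (y : ℚ_[p.1]) :
    ∃ q : ℚ, ‖y - q‖ ≤ 1 ∧ ∀ p' : Nat.Primes, p' ≠ p → padicNorm p'.1 q ≤ 1 := by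
  obtain ⟨n, hn⟩ := pow_unbounded_of_one_lt ‖y‖ (Nat.one_lt_cast.2 p.2.one_lt : (1 : ℝ) < p.1)
  have hp0 : (0 : ℝ) < (p.1 : ℝ) ^ n := pow_pos (Nat.cast_pos.2 p.2.pos) n
  have hpn : ‖((p.1 : ℚ_[p.1]) ^ n)‖ = ((p.1 : ℝ) ^ n)⁻¹ := by
    rw [norm_pow, Padic.norm_p, inv_pow]
  have hne : ((p.1 : ℚ_[p.1]) ^ n) ≠ 0 := by
    rw [← norm_ne_zero_iff, hpn]; exact inv_ne_zero hp0.ne'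
  have hu : ‖(p.1 : ℚ_[p.1]) ^ n * y‖ ≤ 1 := by
    rw [norm_mul, hpn, inv_mul_le_iff₀ hp0, mul_one]; exact hn.le
  let u : ℤ_[p.1] := ⟨(p.1 : ℚ_[p.1]) ^ n * y, hu⟩
  have hspec := (PadicInt.norm_le_pow_iff_mem_span_pow _ n).2 (PadicInt.appr_spec n u)
  -- Multiplication by `p ^ n` makes `y` a `p`-adic integer, which agrees with a natural number
  -- modulo `p ^ n`. Dividing back leaves an integral error and only powers of `p` in the
  -- denominator.
  refine ⟨(u.appr n : ℚ) / (p.1 : ℚ) ^ n, ?_, ?_⟩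
  · have e : y - (((u.appr n : ℚ) / (p.1 : ℚ) ^ n : ℚ) : ℚ_[p.1]) =
        ((p.1 : ℚ_[p.1]) ^ n)⁻¹ * ((u - (u.appr n : ℤ_[p.1]) : ℤ_[p.1]) : ℚ_[p.1]) := by
      push_cast
      rw [mul_sub, show (u : ℚ_[p.1]) = (p.1 : ℚ_[p.1]) ^ n * y from rfl, ← mul_assoc,
        inv_mul_cancel₀ hne, one_mul, div_eq_inv_mul]
    rw [e, norm_mul, norm_inv, hpn, inv_inv]
    calc (p.1 : ℝ) ^ n * ‖((u - (u.appr n : ℤ_[p.1]) : ℤ_[p.1]) : ℚ_[p.1])‖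
        ≤ (p.1 : ℝ) ^ n * (p.1 : ℝ) ^ (-n : ℤ) :=
          mul_le_mul_of_nonneg_left hspec hp0.le
      _ = 1 := by rw [zpow_neg, zpow_natCast, mul_inv_cancel₀ hp0.ne']
  · intro p' hp'
    have h1 : padicNorm p'.1 ((p.1 : ℚ) ^ n) = 1 := by
      have : padicNorm p'.1 ((p.1 ^ n : ℕ) : ℚ) = 1 := by
        rw [padicNorm.nat_eq_one_iff]
        intro h
        exact hp' (Subtype.ext ((Nat.prime_dvd_prime_iff_eq p'.2 p.2).1 (p'.2.dvd_of_dvd_pow h)))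
      exact_mod_cast this
    rw [padicNorm.div, h1, div_one]
    exact padicNorm.of_nat _

/-- Strong approximation by partial fractions: add the approximations at the separate places. The
one made for another place is integral at `p`, so the ultrametric inequality keeps the error at `p`
integral. -/
lemma exists_ZS_approx (y : (p : S) → ℚ_[p.1.1]) :
    ∃ z : ZS S, ∀ p : S, ‖y p - ZS.toPadic S p z‖ ≤ 1 := by
  choose q hq1 hq2 using fun p : S => exists_rat_approx p.1 (y p)
  have hmem : ∀ p : S, q p ∈ ZS S := fun p p' hp' => hq2 p p' fun h => hp' (h ▸ p.2)
  refine ⟨∑ p : S, ⟨q p, hmem p⟩, fun p => ?_⟩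
  rw [map_sum, ← Finset.add_sum_erase _ _ (Finset.mem_univ p), ← sub_sub]
  refine (norm_sub_le_max _ _).trans (max_le (hq1 p) ?_)
  refine IsUltrametricDist.norm_sum_le_of_forall_le_of_nonneg zero_le_one fun p' hp' => ?_
  rw [norm_toPadic]
  have := hq2 p' p.1 fun h => (Finset.ne_of_mem_erase hp') (Subtype.ext h.symm)
  exact_mod_cast this

/-- An `S`-integer that is also integral at the primes of `S` is an ordinary integer. This is the
discreteness behind both the lattice and the arithmetic group. -/
lemma ZS.eq_zero_of_small {z : ZS S} (h1 : |ZS.toReal S z| < 1)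
    (h2 : ∀ p : S, ‖ZS.toPadic S p z‖ ≤ 1) : z = 0 := by
  have hInt : ∀ p : Nat.Primes, padicNorm p.1 (z : ℚ) ≤ 1 := by
    intro p
    by_cases hp : p ∈ S
    · have h := h2 ⟨p, hp⟩
      rw [norm_toPadic] at h
      exact_mod_cast h
    · exact z.2 p hp
  obtain ⟨k, hk⟩ := exists_int_of_padicNorm_le_one hInt
  have hreal : ZS.toReal S z = (k : ℝ) := by
    change ((z : ℚ) : ℝ) = k
    rw [← hk]; simp
  rw [hreal] at h1
  have h1' : |k| < 1 := by exact_mod_cast h1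
  rw [Int.abs_lt_one_iff] at h1'
  rw [h1'] at hk
  exact Subtype.ext (by rw [← hk]; simp)

/-- For existence, correct the finite places first; then subtract a floor, an ordinary integer that
leaves them integral. For uniqueness, the difference of two solutions is small at every place. -/
lemma exists_unique_ZS (x : ℝ) (y : (p : S) → ℚ_[p.1.1]) :
    ∃! z : ZS S, x + ZS.toReal S z ∈ Set.Ico (0 : ℝ) 1 ∧ ∀ p : S, ‖y p + ZS.toPadic S p z‖ ≤ 1 := by
  obtain ⟨z₀, hz₀⟩ := exists_ZS_approx y
  let n : ℤ := ⌊x - ZS.toReal S z₀⌋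
  set w : ZS S := -z₀ - (n : ZS S) with hw
  have hw1 : x + ZS.toReal S w ∈ Set.Ico (0 : ℝ) 1 := by
    have h1 := Int.floor_le (x - ZS.toReal S z₀)
    have h2 := Int.lt_floor_add_one (x - ZS.toReal S z₀)
    simp only [hw, map_sub, map_neg, map_intCast, Set.mem_Ico]
    constructor <;> linarith
  have hw2 : ∀ p : S, ‖y p + ZS.toPadic S p w‖ ≤ 1 := by
    intro p
    have h : y p + ZS.toPadic S p w = (y p - ZS.toPadic S p z₀) - (n : ℚ_[p.1.1]) := by
      simp only [hw, map_sub, map_neg, map_intCast]; ring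
    rw [h]
    exact (norm_sub_le_max _ _).trans (max_le (hz₀ p) (Padic.norm_int_le_one n))
  refine ⟨w, ⟨hw1, hw2⟩, ?_⟩
  · rintro z ⟨hz1, hz2⟩
    refine sub_eq_zero.1 (ZS.eq_zero_of_small ?_ fun p => ?_)
    · rw [map_sub, abs_lt]
      constructor <;> linarith [hz1.1, hz1.2, hw1.1, hw1.2]
    · have e : ZS.toPadic S p (z - w) = (y p + ZS.toPadic S p z) - (y p + ZS.toPadic S p w) := by
        rw [map_sub]; ring
      rw [e]
      exact (norm_sub_le_max _ _).trans (max_le (hz2 _) (hw2 _))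

/-- The standard fundamental domain of `ℤ_S ^ d` in `ℚ_S ^ d`. -/
def unitBox (S : Finset Nat.Primes) (d : ℕ) : Set (QSVec S d) :=
  (Set.univ.pi fun _ => Set.Ico (0 : ℝ) 1) ×ˢ
    (Set.univ.pi fun p : S => Metric.closedBall (0 : Fin d → ℚ_[p.1.1]) 1)

lemma exists_unique_mem_unitBox (v : QSVec S d) :
    ∃! k : Fin d → ZS S, v + diagVec k ∈ unitBox S d := by
  have h := fun i => exists_unique_ZS (S := S) (v.1 i) (fun p => v.2 p i)
  have key : ∀ k : Fin d → ZS S, v + diagVec k ∈ unitBox S d ↔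
      ∀ i, v.1 i + ZS.toReal S (k i) ∈ Set.Ico (0 : ℝ) 1 ∧
        ∀ p : S, ‖v.2 p i + ZS.toPadic S p (k i)‖ ≤ 1 := by
    intro k
    simp only [unitBox, Set.mem_prod, Set.mem_univ_pi, mem_closedBall_zero_iff]
    simp only [pi_norm_le_iff_of_nonneg zero_le_one]
    constructor
    · rintro ⟨h1, h2⟩ i
      exact ⟨h1 i, fun p => h2 p i⟩
    · intro h
      exact ⟨fun i => (h i).1, fun p i => (h i).2 p⟩
  choose k hk hku using fun i => h i
  refine ⟨k, (key k).2 hk, fun l hl => funext fun i => hku i _ ((key l).1 hl i)⟩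

lemma measurableSet_unitBox : MeasurableSet (unitBox S d) :=
  (MeasurableSet.univ_pi fun _ => measurableSet_Ico).prod
    (MeasurableSet.univ_pi fun _ => Metric.isClosed_closedBall.measurableSet)

lemma volS_unitBox : volS S d (unitBox S d) = 1 := by
  unfold volS unitBox
  rw [Measure.prod_prod, Measure.pi_pi, volume_pi_pi]
  have : ∀ p : S, volPadic p.1.1 d (Metric.closedBall 0 1) = 1 := fun p =>
    Measure.addHaarMeasure_self (K₀ := unitBall p.1.1 d)
  simp [this]

lemma norm_le_one_of_mem_unitBox {v : QSVec S d} (hv : v ∈ unitBox S d) : ‖v‖ ≤ 1 := by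
  obtain ⟨h1, h2⟩ := hv
  refine max_le ?_ ?_
  · refine (pi_norm_le_iff_of_nonneg zero_le_one).2 fun i => ?_
    have := h1 i (Set.mem_univ i)
    rw [Real.norm_eq_abs, abs_le]
    constructor <;> linarith [this.1, this.2]
  · refine (pi_norm_le_iff_of_nonneg zero_le_one).2 fun p => ?_
    exact mem_closedBall_zero_iff.1 (h2 p (Set.mem_univ p))

instance : Countable (Fin d → ZS S) := inferInstance

/-- Unfolding of the integral over `ℚ_S ^ d` along the lattice `ℤ_S ^ d`. -/
theorem lintegral_eq_unitBox (f : QSVec S d → ℝ≥0∞) :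
    ∫⁻ v, f v ∂(volS S d) =
      ∑' k : Fin d → ZS S, ∫⁻ u in unitBox S d, f (u + diagVec k) ∂(volS S d) := by
  have hmeas : ∀ k : Fin d → ZS S, MeasurableSet ((fun v => v + diagVec k) ⁻¹' unitBox S d) :=
    fun k => (measurable_add_const _) measurableSet_unitBox
  have hU : (⋃ k : Fin d → ZS S, (fun v => v + diagVec k) ⁻¹' unitBox S d) = Set.univ := by
    refine Set.eq_univ_of_forall fun v => ?_
    obtain ⟨k, hk, -⟩ := exists_unique_mem_unitBox v
    exact Set.mem_iUnion.2 ⟨k, hk⟩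
  have hdisj : Pairwise (Function.onFun Disjoint
      fun k : Fin d → ZS S => (fun v => v + diagVec k) ⁻¹' unitBox S d) := by
    intro k l hkl
    refine Set.disjoint_left.2 fun v hk hl => hkl ?_
    exact (exists_unique_mem_unitBox v).unique hk hl
  rw [← setLIntegral_univ f, ← hU, lintegral_iUnion hmeas hdisj,
    ← (Equiv.neg (Fin d → ZS S)).tsum_eq]
  refine tsum_congr fun k => ?_
  have hmp := measurePreserving_add_right (volS S d) (diagVec k)
  rw [← hmp.setLIntegral_comp_preimage_emb (measurableEmbedding_addRight _)]
  congr 2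
  ext v
  simp [diagVec_neg]

end Lattice

/-! ### Borel sets of representatives for discrete groups -/

section FundamentalDomain

open TopologicalSpace in
/-- A countable discrete subgroup of a second countable group has a Borel set of representatives. -/
theorem exists_strict_fundamentalDomain {G : Type*} [Group G] [TopologicalSpace G]
    [IsTopologicalGroup G] [SecondCountableTopology G] [MeasurableSpace G] [BorelSpace G]
    (Γ : Subgroup G) {N : Set G} (hN : N ∈ nhds (1 : G)) (hΓ : ∀ γ ∈ Γ, γ ∈ N → γ = 1) :
    ∃ F : Set G, MeasurableSet F ∧ ∀ x : G, ∃! γ : Γ, γ • x ∈ F := by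
  obtain ⟨U, hUo, hU1, hUN⟩ := exists_open_nhds_one_split hN
  let W : Set G := U ∩ U⁻¹
  have hWo : IsOpen W := hUo.inter hUo.inv
  have hW1 : (1 : G) ∈ W := ⟨hU1, by simpa using hU1⟩
  have hW : ∀ v ∈ W, ∀ w ∈ W, v * w⁻¹ ∈ N := fun v hv w hw => hUN v hv.1 w⁻¹ hw.2
  let x : ℕ → G := denseSeq G
  -- A countable cover by open pieces so small that two points of one piece in the same `Γ`-orbit
  -- differ by an element of `N`, hence coincide.
  let B : ℕ → Set G := fun n => {g | g * (x n)⁻¹ ∈ W}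
  have hBo : ∀ n, IsOpen (B n) := fun n => hWo.preimage (by fun_prop)
  have hBcov : ∀ g : G, ∃ n, g ∈ B n := by
    intro g
    have ho : IsOpen {y : G | g * y⁻¹ ∈ W} := hWo.preimage (by fun_prop)
    obtain ⟨n, hn⟩ := (denseRange_denseSeq G).exists_mem_open ho ⟨g, by simpa using hW1⟩
    exact ⟨n, hn⟩
  let T : ℕ → Set G := fun n => {g | ∃ γ : Γ, γ • g ∈ B n}
  have hTo : ∀ n, IsOpen (T n) := by
    intro n
    have : T n = ⋃ γ : Γ, (fun g : G => (γ : G) * g) ⁻¹' B n := by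
      ext g; simp [T, Subgroup.smul_def]
    rw [this]
    exact isOpen_iUnion fun γ => (hBo n).preimage (by fun_prop)
  have hTinv : ∀ n (γ : Γ) g, γ • g ∈ T n ↔ g ∈ T n := by
    intro n γ g
    constructor
    · rintro ⟨δ, hδ⟩; exact ⟨δ * γ, by rwa [mul_smul]⟩
    · rintro ⟨δ, hδ⟩; exact ⟨δ * γ⁻¹, by rwa [mul_smul, inv_smul_smul]⟩
  have hTcov : ∀ g : G, ∃ n, g ∈ T n := fun g => by
    obtain ⟨n, hn⟩ := hBcov g
    exact ⟨n, 1, by rwa [one_smul]⟩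
  -- From the piece `B n` keep only the orbits that no earlier piece meets. Each orbit is then
  -- represented in exactly one piece, and there only once.
  let F : Set G := ⋃ n, (B n \ ⋃ k ∈ Finset.range n, T k)
  refine ⟨F, ?_, ?_⟩
  · exact MeasurableSet.iUnion fun n => (hBo n).measurableSet.diff
      (Finset.measurableSet_biUnion _ fun k _ => (hTo k).measurableSet)
  · intro g
    classical
    let n := Nat.find (hTcov g)
    have hn : g ∈ T n := Nat.find_spec (hTcov g)
    have hmin : ∀ k < n, g ∉ T k := fun k hk => Nat.find_min (hTcov g) hk
    have hF : ∀ γ : Γ, γ • g ∈ F ↔ γ • g ∈ B n := by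
      intro γ
      simp only [F, Set.mem_iUnion, Set.mem_sdiff, Finset.mem_range, not_exists, hTinv]
      constructor
      · rintro ⟨k, hk, hkT⟩
        have hkT' : g ∈ T k := ⟨γ, hk⟩
        have h1 : n ≤ k := Nat.find_min' (hTcov g) hkT'
        have h2 : ¬ n < k := fun h => hkT n h hn
        have : k = n := by omega
        rwa [← this]
      · intro h
        exact ⟨n, h, fun k hk => hmin k hk⟩
    obtain ⟨γ, hγ⟩ := hn
    refine ⟨γ, (hF γ).2 hγ, fun δ hδ => ?_⟩
    have h1 := hW _ ((hF δ).1 hδ) _ hγ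
    have h2 : (δ • g) * (x n)⁻¹ * ((γ • g) * (x n)⁻¹)⁻¹ = ((δ * γ⁻¹ : Γ) : G) := by
      simp only [Subgroup.smul_def, smul_eq_mul, Subgroup.coe_mul, Subgroup.coe_inv]
      group
    rw [h2] at h1
    have h3 := hΓ _ (δ * γ⁻¹).2 h1
    have h4 : δ * γ⁻¹ = 1 := Subtype.ext h3
    exact mul_inv_eq_one.1 h4

variable {S : Finset Nat.Primes} {d : ℕ}

instance : Countable (Matrix.SpecialLinearGroup (Fin d) (ZS S)) := by
  have : Countable (Matrix (Fin d) (Fin d) (ZS S)) :=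
    inferInstanceAs (Countable (Fin d → Fin d → ZS S))
  exact Subtype.countable

instance : Countable (ULZ S d) := by
  have : Function.Surjective (diagSL S d).rangeRestrict := (diagSL S d).rangeRestrict_surjective
  exact this.countable

/-- The entries of `γ - 1` are `S`-integers; if `γ` is near the identity at all places,
`ZS.eq_zero_of_small` makes them zero. -/
lemma ULZ_discrete : ∃ N ∈ nhds (1 : UL S d), ∀ γ ∈ ULZ S d, γ ∈ N → γ = 1 := by
  refine ⟨{g | dist g.rows (1 : UL S d).rows < 1}, ?_, ?_⟩
  · have : IsOpen {g : UL S d | dist g.rows (1 : UL S d).rows < 1} :=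
      isOpen_lt (isClosedEmbedding_rows.continuous.dist continuous_const) continuous_const
    exact this.mem_nhds (by simp)
  · rintro _ ⟨γ, rfl⟩ h
    change dist (diagSL S d γ).rows (1 : UL S d).rows < 1 at h
    rw [dist_eq_norm] at h
    have hi : ∀ i, ‖((diagSL S d γ).rows i - (1 : UL S d).rows i)‖ < 1 := fun i =>
      (norm_le_pi_norm ((diagSL S d γ).rows - (1 : UL S d).rows) i).trans_lt h
    have : γ = 1 := by
      apply Subtype.ext
      refine Matrix.ext fun i j => ?_
      refine sub_eq_zero.1 (ZS.eq_zero_of_small ?_ fun p => ?_)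
      · have h1 := (norm_le_pi_norm _ j).trans_lt ((le_max_left _ _).trans_lt (hi i))
        rw [map_sub, ← Real.norm_eq_abs]
        have e : ZS.toReal S ((1 : Matrix (Fin d) (Fin d) (ZS S)) i j) =
            (1 : Matrix (Fin d) (Fin d) ℝ) i j := by
          simp only [Matrix.one_apply]; split_ifs <;> simp
        change ‖ZS.toReal S ((γ : Matrix (Fin d) (Fin d) (ZS S)) i j) -
          ZS.toReal S ((1 : Matrix (Fin d) (Fin d) (ZS S)) i j)‖ < 1
        rw [e]
        exact h1
      · have h0 := (norm_le_pi_norm _ p).trans_lt ((le_max_right _ _).trans_lt (hi i))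
        have h1 := ((norm_le_pi_norm _ j).trans_lt h0).le
        rw [map_sub]
        have e : ZS.toPadic S p ((1 : Matrix (Fin d) (Fin d) (ZS S)) i j) =
            (1 : Matrix (Fin d) (Fin d) ℚ_[p.1.1]) i j := by
          simp only [Matrix.one_apply]; split_ifs <;> simp
        change ‖ZS.toPadic S p ((γ : Matrix (Fin d) (Fin d) (ZS S)) i j) -
          ZS.toPadic S p ((1 : Matrix (Fin d) (Fin d) (ZS S)) i j)‖ ≤ 1
        rw [e]
        exact h1
    rw [this, map_one]

/-- `UL_d(ℤ_S)` has a Borel set of representatives in `UL_d(ℚ_S)`. -/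
theorem exists_fundamentalDomain_ULZ (S : Finset Nat.Primes) (d : ℕ) :
    ∃ F : Set (UL S d), MeasurableSet F ∧ ∀ x : UL S d, ∃! γ : ULZ S d, γ • x ∈ F := by
  obtain ⟨N, hN, h⟩ := ULZ_discrete (S := S) (d := d)
  exact exists_strict_fundamentalDomain (ULZ S d) hN h

end FundamentalDomain

/-! ### Orbits of integral vectors under the arithmetic group -/

section Orbits

variable {S : Finset Nat.Primes} {m : ℕ}

/-- The elementary matrix with entry `c` at the place `(i, j)`, as an element of `SL`. -/
def transvectionSL {R n : Type*} [CommRing R] [Fintype n] [DecidableEq n] (i j : n) (hij : i ≠ j)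
    (c : R) : Matrix.SpecialLinearGroup n R :=
  ⟨Matrix.transvection i j c, Matrix.det_transvection_of_ne i j hij c⟩

lemma vecMul_transvectionSL {R n : Type*} [CommRing R] [Fintype n] [DecidableEq n] (v : n → R)
    (i j : n) (hij : i ≠ j) (c : R) :
    v ᵥ* (transvectionSL i j hij c : Matrix n n R) = Function.update v j (v j + v i * c) := by
  change v ᵥ* Matrix.transvection i j c = _
  rw [Matrix.transvection, Matrix.vecMul_add, Matrix.vecMul_one]
  ext k
  by_cases hk : k = j
  · subst hk; simp [Matrix.vecMul, dotProduct, Matrix.single_apply]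
  · simp [hk, Matrix.vecMul, dotProduct, Ne.symm hk]

/-- Euclid's algorithm by transvections, with the sum of the absolute values of the entries as the
decreasing quantity. -/
lemma exists_SL_vecMul_eq_single (v : Fin (m + 2) → ℤ) :
    ∃ (γ : Matrix.SpecialLinearGroup (Fin (m + 2)) ℤ) (c : ℤ),
      v ᵥ* (γ : Matrix (Fin (m + 2)) (Fin (m + 2)) ℤ) = Pi.single 0 c := by
  induction hN : ∑ i, (v i).natAbs using Nat.strong_induction_on generalizing v with
  | _ N ih =>
  have step : ∀ i j, i ≠ j → ∀ c : ℤ, (v j + v i * c).natAbs < (v j).natAbs →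
      ∃ (γ : Matrix.SpecialLinearGroup (Fin (m + 2)) ℤ) (c : ℤ),
      v ᵥ* (γ : Matrix (Fin (m + 2)) (Fin (m + 2)) ℤ) = Pi.single 0 c := by
    intro i j hij c hlt
    have hsum : ∑ k, (Function.update v j (v j + v i * c) k).natAbs < N := by
      rw [← hN]
      refine Finset.sum_lt_sum (fun k _ => ?_) ⟨j, Finset.mem_univ j, by simpa using hlt⟩
      by_cases hk : k = j
      · subst hk; simpa using hlt.le
      · simp [hk]
    obtain ⟨γ, c', h⟩ := ih _ hsum (Function.update v j (v j + v i * c)) rfl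
    refine ⟨transvectionSL i j hij c * γ, c', ?_⟩
    rw [Matrix.SpecialLinearGroup.coe_mul, ← Matrix.vecMul_vecMul, vecMul_transvectionSL, h]
  by_cases h2 : ∃ i j, i ≠ j ∧ v i ≠ 0 ∧ v j ≠ 0
  · obtain ⟨i, j, hij, hi, hj⟩ := h2
    rcases le_total (v i).natAbs (v j).natAbs with hle | hle
    · rcases lt_or_gt_of_ne hi with h1 | h1 <;> rcases lt_or_gt_of_ne hj with h3 | h3
      · exact step i j hij (-1) (by omega)
      · exact step i j hij 1 (by omega)
      · exact step i j hij 1 (by omega)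
      · exact step i j hij (-1) (by omega)
    · rcases lt_or_gt_of_ne hi with h1 | h1 <;> rcases lt_or_gt_of_ne hj with h3 | h3
      · exact step j i hij.symm (-1) (by omega)
      · exact step j i hij.symm 1 (by omega)
      · exact step j i hij.symm 1 (by omega)
      · exact step j i hij.symm (-1) (by omega)
  · push Not at h2
    by_cases h0 : ∃ i, i ≠ 0 ∧ v i ≠ 0
    · obtain ⟨i, hi0, hi⟩ := h0
      -- A single nonzero entry is left, in the wrong place: copy it to the place 0, then cancel the
      -- original.
      refine ⟨transvectionSL i 0 hi0 1 * transvectionSL 0 i hi0.symm (-1), v i, ?_⟩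
      rw [Matrix.SpecialLinearGroup.coe_mul, ← Matrix.vecMul_vecMul, vecMul_transvectionSL,
        vecMul_transvectionSL]
      have hz : ∀ k, k ≠ i → v k = 0 := fun k hk => by
        by_contra hne
        exact hne (h2 i k (Ne.symm hk) hi)
      ext k
      by_cases hk : k = i
      · subst hk
        simp [hi0, hz 0 hi0.symm]
      · by_cases hk0 : k = 0
        · subst hk0
          simp [hk, hz 0 hk]
        · simp [hk, hk0, hz k hk]
    · push Not at h0
      refine ⟨1, v 0, ?_⟩
      ext k
      by_cases hk : k = 0
      · subst hk; simp
      · simp [hk, h0 k hk]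

lemma exists_coprime_mul_unit (S : Finset Nat.Primes) (c : ℕ) (hc : c ≠ 0) :
    ∃ a b : ℕ, c = a * b ∧ (∀ p ∈ S, ¬ p.1 ∣ a) ∧ ((b : ℚ)⁻¹) ∈ ZS S := by
  induction c using Nat.strong_induction_on with
  | _ c ih =>
  by_cases h : ∃ p ∈ S, p.1 ∣ c
  · obtain ⟨p, hp, k, rfl⟩ := h
    have hk : k ≠ 0 := fun h => hc (by simp [h])
    obtain ⟨a, b, hab, ha, hb⟩ := ih k (lt_mul_of_one_lt_left (Nat.pos_of_ne_zero hk) p.2.one_lt) hk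
    refine ⟨a, p.1 * b, by rw [hab]; ring, ha, ?_⟩
    push_cast
    rw [mul_inv]
    refine mul_mem (fun q hq => ?_) hb
    have h1 : padicNorm q.1 (p.1 : ℚ) = 1 := by
      rw [padicNorm.nat_eq_one_iff]
      intro hd
      exact hq ((Subtype.ext ((Nat.prime_dvd_prime_iff_eq q.2 p.2).1 hd) : q = p) ▸ hp)
    rw [← one_div, padicNorm.div, h1]; simp
  · push Not at h
    exact ⟨c, 1, by simp, h, by simp⟩

/-- The diagonal matrix with entries `u`, `u'`, `1`, ... -/
def diagUnit (u u' : ZS S) (h : u * u' = 1) : Matrix.SpecialLinearGroup (Fin (m + 2)) (ZS S) :=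
  ⟨Matrix.diagonal (Fin.cons u (Fin.cons u' fun _ => 1)), by
    rw [Matrix.det_diagonal, Fin.prod_univ_succ, Fin.prod_univ_succ]
    simpa using h⟩

/-- Every nonzero `S`-integral vector is a multiple of a vector in the orbit of the first standard
basis vector, by a natural number prime to `S`. -/
theorem exists_orbit_rep (k : Fin (m + 2) → ZS S) (hk : k ≠ 0) :
    ∃ (a : ℕ) (γ : Matrix.SpecialLinearGroup (Fin (m + 2)) (ZS S)), a ≠ 0 ∧ (∀ p ∈ S, ¬ p.1 ∣ a) ∧
      k = (a : ZS S) • (Pi.single 0 1 ᵥ* (γ : Matrix (Fin (m + 2)) (Fin (m + 2)) (ZS S))) := by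
  -- A common denominator; it is a unit of `ZS S`, since each denominator is prime to the primes
  -- outside `S`.
  let N : ℕ := ∏ i, (k i : ℚ).den
  have hN0 : (N : ℚ) ≠ 0 := by
    simp only [N]; push_cast
    exact Finset.prod_ne_zero_iff.2 fun i _ => Nat.cast_ne_zero.2 (k i : ℚ).den_nz
  have hNinv : ((N : ℚ)⁻¹) ∈ ZS S := by
    simp only [N]; push_cast
    rw [← Finset.prod_inv_distrib]
    exact prod_mem fun i _ => inv_den_mem_ZS (k i).2
  have hv : ∀ i, ∃ v : ℤ, (v : ZS S) = (N : ZS S) * k i := by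
    intro i
    refine ⟨(k i : ℚ).num * (∏ j ∈ Finset.univ.erase i, (k j : ℚ).den : ℕ), Subtype.ext ?_⟩
    push_cast
    have hsplit : (N : ℚ) = (k i : ℚ).den * ((∏ j ∈ Finset.univ.erase i, (k j : ℚ).den : ℕ) : ℚ) := by
      rw [← Nat.cast_mul, Finset.mul_prod_erase _ (fun j => (k j : ℚ).den) (Finset.mem_univ i)]
    rw [hsplit]
    push_cast
    rw [mul_right_comm, mul_comm ((k i : ℚ).den : ℚ) (k i : ℚ), Rat.mul_den_eq_num]
  choose v hv using hv
  obtain ⟨γ, c, hγ⟩ := exists_SL_vecMul_eq_single v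
  have hv' : v = Pi.single 0 c ᵥ* ((γ⁻¹ : Matrix.SpecialLinearGroup (Fin (m + 2)) ℤ) :
      Matrix (Fin (m + 2)) (Fin (m + 2)) ℤ) := by
    rw [← hγ, Matrix.vecMul_vecMul, ← Matrix.SpecialLinearGroup.coe_mul, mul_inv_cancel,
      Matrix.SpecialLinearGroup.coe_one, Matrix.vecMul_one]
  have hc : c ≠ 0 := by
    rintro rfl
    rw [Pi.single_zero, Matrix.zero_vecMul] at hv'
    apply hk
    ext i : 1
    have := hv i
    rw [hv', Pi.zero_apply, Int.cast_zero] at this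
    rcases mul_eq_zero.1 this.symm with h | h
    · exact absurd (congrArg Subtype.val h) (by simpa using hN0)
    · simpa using h
  obtain ⟨a, b, hab, ha, hb⟩ := exists_coprime_mul_unit S c.natAbs (by simpa using hc)
  have hb0 : (b : ℚ) ≠ 0 := by
    rintro h
    have : b = 0 := by exact_mod_cast h
    rw [this, mul_zero] at hab
    exact hc (Int.natAbs_eq_zero.1 hab)
  have ha0 : a ≠ 0 := by
    rintro rfl
    rw [zero_mul] at hab
    exact hc (Int.natAbs_eq_zero.1 hab)
  have hsign : c.sign * c.sign = 1 := by
    rcases Int.lt_or_gt_of_ne hc with h | h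
    · rw [Int.sign_eq_neg_one_of_neg h]; norm_num
    · rw [Int.sign_eq_one_of_pos h]; norm_num
  -- The unit with `a * u = c / N`. A unit multiple of the first basis vector stays in its orbit,
  -- because the second diagonal entry can compensate the determinant; here the dimension must be at
  -- least two.
  let u : ZS S := (c.sign : ZS S) * (b : ZS S) * ⟨_, hNinv⟩
  let u' : ZS S := (c.sign : ZS S) * ⟨_, hb⟩ * (N : ZS S)
  have huu : u * u' = 1 := by
    apply Subtype.ext
    simp only [u, u']
    push_cast
    have h3 : (c.sign : ℚ) * c.sign = 1 := by exact_mod_cast hsign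
    field_simp
    linear_combination h3
  let γ' : Matrix.SpecialLinearGroup (Fin (m + 2)) (ZS S) :=
    Matrix.SpecialLinearGroup.map (Int.castRingHom (ZS S)) γ⁻¹
  refine ⟨a, diagUnit u u' huu * γ', ha0, ha, ?_⟩
  have hd : (Pi.single 0 1 : Fin (m + 2) → ZS S) ᵥ*
      ((diagUnit u u' huu : Matrix.SpecialLinearGroup (Fin (m + 2)) (ZS S)) : Matrix (Fin (m + 2)) (Fin (m + 2)) (ZS S)) = Pi.single 0 u := by
    change _ ᵥ* Matrix.diagonal _ = _
    ext j : 1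
    rw [Matrix.vecMul_diagonal]
    by_cases hj : j = 0
    · subst hj; simp
    · simp [hj]
  rw [Matrix.SpecialLinearGroup.coe_mul, ← Matrix.vecMul_vecMul, hd, ← Matrix.smul_vecMul]
  have hInt : ∀ i, (v i : ZS S) = (Pi.single 0 (c : ZS S) ᵥ*
      (γ' : Matrix (Fin (m + 2)) (Fin (m + 2)) (ZS S))) i := by
    intro i
    have h := RingHom.map_vecMul (Int.castRingHom (ZS S))
      ((γ⁻¹ : Matrix.SpecialLinearGroup (Fin (m + 2)) ℤ) :
        Matrix (Fin (m + 2)) (Fin (m + 2)) ℤ) (Pi.single 0 c) i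
    rw [← hv'] at h
    have hs : (Int.castRingHom (ZS S) ∘ (Pi.single 0 c : Fin (m + 2) → ℤ)) =
        Pi.single 0 (c : ZS S) := by
      ext j : 1
      simp only [Function.comp]
      by_cases hj : j = 0
      · subst hj; simp
      · simp [hj]
    rw [hs] at h
    exact h
  have hcast : (a : ZS S) • (Pi.single 0 u : Fin (m + 2) → ZS S) =
      (⟨_, hNinv⟩ : ZS S) • (Pi.single 0 (c : ZS S) : Fin (m + 2) → ZS S) := by
    ext j : 1
    by_cases hj : j = 0
    · subst hj
      simp only [Pi.smul_apply, Pi.single_eq_same, smul_eq_mul]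
      apply Subtype.ext
      simp only [u]
      push_cast
      have h4 : (c : ℚ) = c.sign * (a * b) := by
        have h5 : c = c.sign * (c.natAbs : ℤ) := (Int.sign_mul_natAbs c).symm
        rw [hab] at h5
        exact_mod_cast h5
      rw [h4]; ring
    · simp [hj]
  rw [hcast, Matrix.smul_vecMul]
  ext i : 1
  rw [Pi.smul_apply, ← hInt, hv]
  apply Subtype.ext
  simp only [smul_eq_mul]
  push_cast
  rw [← mul_assoc, inv_mul_cancel₀ hN0, one_mul]

end Orbits

/-! ### Averages of counting measures over the quotient -/

section OrbitMeasure

variable {S : Finset Nat.Primes} {d m : ℕ}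

lemma toReal_injective : Function.Injective (ZS.toReal S) := fun _ _ h =>
  Subtype.ext (Rat.cast_injective h)

lemma diagVec_injective : Function.Injective (diagVec : (Fin d → ZS S) → QSVec S d) := by
  intro k l h
  funext i
  exact toReal_injective (congrFun (congrArg Prod.fst h) i)

lemma rowMul_injective (g : UL S d) : Function.Injective fun v : QSVec S d => rowMul v g := by
  intro v w h
  have := congrArg (fun x => rowMul x g⁻¹) h
  simpa only [← rowMul_mul, mul_inv_cancel, rowMul_one] using this

lemma rowMul_firstBasis (g : UL S (m + 2)) :
    rowMul (diagVec (Pi.single 0 1 : Fin (m + 2) → ZS S)) g = g.rows 0 := by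
  refine Prod.ext ?_ (funext fun p => ?_)
  · have : (diagVec (Pi.single 0 1 : Fin (m + 2) → ZS S)).1 = Pi.single 0 1 := by
      funext j
      by_cases hj : j = 0
      · subst hj; simp [diagVec]
      · simp [diagVec, hj]
    change (diagVec (Pi.single 0 1 : Fin (m + 2) → ZS S)).1 ᵥ* g.realMat = g.realMat 0
    rw [this, Matrix.single_one_vecMul]; rfl
  · have : (diagVec (Pi.single 0 1 : Fin (m + 2) → ZS S)).2 p = Pi.single 0 1 := by
      funext j
      by_cases hj : j = 0
      · subst hj; simp [diagVec]
      · simp [diagVec, hj]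
    change (diagVec (Pi.single 0 1 : Fin (m + 2) → ZS S)).2 p ᵥ* g.padicMat p = g.padicMat p 0
    rw [this, Matrix.single_one_vecMul]; rfl

lemma diagVec_smul (a : ℕ) (k : Fin d → ZS S) : diagVec ((a : ZS S) • k) = a • diagVec k := by
  refine Prod.ext (funext fun i => ?_) (funext fun p => funext fun i => ?_) <;>
  simp [diagVec]

lemma rowMul_nsmul (a : ℕ) (v : QSVec S d) (g : UL S d) : rowMul (a • v) g = a • rowMul v g := by
  refine Prod.ext ?_ (funext fun p => ?_)
  · exact Matrix.smul_vecMul a v.1 g.realMat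
  · exact Matrix.smul_vecMul a (v.2 p) (g.padicMat p)

/-- An integer prime to `S` is a unit at every finite place of `S`, so only the real factor feels
the scaling. -/
lemma map_nsmul_volS {a : ℕ} (ha : a ≠ 0) (hS : ∀ p ∈ S, ¬ p.1 ∣ a) :
    (volS S d).map (fun v => a • v) = ENNReal.ofReal (((a : ℝ) ^ d)⁻¹) • volS S d := by
  have hp : ∀ p : S, MeasurePreserving (fun v : Fin d → ℚ_[p.1.1] => a • v) (volPadic p.1.1 d)
      (volPadic p.1.1 d) := by
    intro p
    have hnorm : ‖(a : ℚ_[p.1.1])‖ = 1 := by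
      have h1 : padicNorm p.1.1 (a : ℚ) = 1 := (padicNorm.nat_eq_one_iff _).2 (hS p.1 p.2)
      have h2 : ‖((a : ℚ) : ℚ_[p.1.1])‖ = padicNorm p.1.1 (a : ℚ) := Padic.eq_padicNorm _
      rw [h1] at h2
      simpa using h2
    have ha' : (a : ℚ_[p.1.1]) ≠ 0 := by rw [← norm_ne_zero_iff, hnorm]; exact one_ne_zero
    let g : GL (Fin d) ℚ_[p.1.1] := Matrix.GeneralLinearGroup.mkOfDetNeZero
      ((a : ℚ_[p.1.1]) • (1 : Matrix (Fin d) (Fin d) ℚ_[p.1.1])) (by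
        rw [Matrix.det_smul, Matrix.det_one, mul_one]; exact pow_ne_zero _ ha')
    have := measurePreserving_mulVec_padic p.1.1 d g (by
      change ‖((a : ℚ_[p.1.1]) • (1 : Matrix (Fin d) (Fin d) ℚ_[p.1.1])).det‖ = 1
      rw [Matrix.det_smul, Matrix.det_one, mul_one, norm_pow, hnorm, one_pow])
    have e : (fun v : Fin d → ℚ_[p.1.1] => (g : Matrix (Fin d) (Fin d) ℚ_[p.1.1]) *ᵥ v) =
        fun v => a • v := by
      funext v
      change ((a : ℚ_[p.1.1]) • (1 : Matrix (Fin d) (Fin d) ℚ_[p.1.1])) *ᵥ v = a • v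
      rw [Matrix.smul_mulVec, Matrix.one_mulVec, Nat.cast_smul_eq_nsmul]
    rwa [e] at this
  have h2 : MeasurePreserving (Prod.map id fun (y : (p : S) → Fin d → ℚ_[p.1.1]) p => a • y p)
      (volS S d) (volS S d) := (MeasurePreserving.id _).prod (measurePreserving_pi _ _ hp)
  have e : (fun v : QSVec S d => a • v) = realScale (a : ℝ) ∘
      (Prod.map id fun (y : (p : S) → Fin d → ℚ_[p.1.1]) p => a • y p) := by
    funext v
    refine Prod.ext ?_ rfl
    exact (Nat.cast_smul_eq_nsmul ℝ a v.1).symm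
  rw [e, ← Measure.map_map (measurable_realScale_const _) h2.measurable, h2.map_eq,
    map_realScale (Nat.cast_ne_zero.2 ha), abs_of_nonneg (by positivity)]

/-- The average over `F` of the counting measures of the sets `{k g}`, `k ∈ O`. -/
def orbitMeasure (μ : Measure (UL S d)) (F : Set (UL S d)) (O : Set (Fin d → ZS S)) :
    Measure (QSVec S d) :=
  Measure.sum fun k : O => (μ.restrict F).map fun g => rowMul (diagVec k.1) g

lemma measurable_rowMul_const (v : QSVec S d) : Measurable fun g : UL S d => rowMul v g :=
  measurable_rowMul.comp (measurable_const.prodMk measurable_id)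

lemma lintegral_orbitMeasure (μ : Measure (UL S d)) (F : Set (UL S d)) (O : Set (Fin d → ZS S))
    {f : QSVec S d → ℝ≥0∞} (hf : Measurable f) :
    ∫⁻ v, f v ∂(orbitMeasure μ F O) =
      ∫⁻ g in F, ∑' k : O, f (rowMul (diagVec k.1) g) ∂μ := by
  unfold orbitMeasure
  have hm : ∀ k : O, AEMeasurable (fun g => f (rowMul (diagVec k.1) g)) (μ.restrict F) :=
    fun k => (hf.comp (measurable_rowMul_const _)).aemeasurable
  rw [lintegral_sum_measure, lintegral_tsum hm]
  exact tsum_congr fun k => lintegral_map hf (measurable_rowMul_const _)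

lemma isFundamentalDomain_of_strict {μ : Measure (UL S d)} {F : Set (UL S d)}
    (hFm : MeasurableSet F) (hF : ∀ x : UL S d, ∃! γ : ULZ S d, γ • x ∈ F) :
    IsFundamentalDomain (ULZ S d) F μ :=
  IsFundamentalDomain.mk' hFm.nullMeasurableSet hF

/-- Right translation commutes with the left action of `ULZ S d`. It therefore carries `F` to
another set of representatives, over which an invariant function has the same integral. -/
lemma setLIntegral_mul_right (μ : Measure (UL S d)) [μ.IsMulLeftInvariant] [μ.IsMulRightInvariant]
    {F : Set (UL S d)} (hFm : MeasurableSet F) (hF : ∀ x : UL S d, ∃! γ : ULZ S d, γ • x ∈ F)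
    {Φ : UL S d → ℝ≥0∞} (hinv : ∀ (γ : ULZ S d) g, Φ (γ • g) = Φ g) (h : UL S d) :
    ∫⁻ g in F, Φ (g * h) ∂μ = ∫⁻ g in F, Φ g ∂μ := by
  have hmp := measurePreserving_mul_right μ h
  set F' : Set (UL S d) := (fun g => g * h⁻¹) ⁻¹' F
  have hF'm : MeasurableSet F' := measurable_mul_const _ hFm
  have hF' : ∀ x : UL S d, ∃! γ : ULZ S d, γ • x ∈ F' := by
    intro x
    have : ∀ γ : ULZ S d, γ • x ∈ F' ↔ γ • (x * h⁻¹) ∈ F := by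
      intro γ
      simp only [F', Set.mem_preimage, Subgroup.smul_def, smul_eq_mul, mul_assoc]
    simp only [this]
    exact hF _
  have e : (fun g => g * h) ⁻¹' F' = F := by
    ext g; simp [F', mul_assoc]
  rw [← e, hmp.setLIntegral_comp_preimage_emb (measurableEmbedding_mulRight h), e]
  exact (isFundamentalDomain_of_strict hF'm hF').setLIntegral_eq
    (isFundamentalDomain_of_strict hFm hF) Φ hinv

/-- Stability of a set of `S`-integral vectors under `SL_d(ℤ_S)`. -/
def OrbitStable (O : Set (Fin d → ZS S)) : Prop :=
  ∀ (γ : Matrix.SpecialLinearGroup (Fin d) (ZS S)) (k : Fin d → ZS S), k ∈ O →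
    k ᵥ* (γ : Matrix (Fin d) (Fin d) (ZS S)) ∈ O

lemma tsum_orbit_smul {O : Set (Fin d → ZS S)} (hO : OrbitStable O) (f : QSVec S d → ℝ≥0∞)
    (γ : ULZ S d) (g : UL S d) :
    ∑' k : O, f (rowMul (diagVec k.1) (γ • g)) = ∑' k : O, f (rowMul (diagVec k.1) g) := by
  obtain ⟨_, γ, rfl⟩ := γ
  let e : O ≃ O :=
    { toFun := fun k => ⟨k.1 ᵥ* (γ : Matrix (Fin d) (Fin d) (ZS S)), hO γ k.1 k.2⟩
      invFun := fun k => ⟨k.1 ᵥ* ((γ⁻¹ : Matrix.SpecialLinearGroup (Fin d) (ZS S)) :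
        Matrix (Fin d) (Fin d) (ZS S)), hO γ⁻¹ k.1 k.2⟩
      left_inv := fun k => Subtype.ext (by
        simp only [Matrix.vecMul_vecMul]
        rw [← Matrix.SpecialLinearGroup.coe_mul, mul_inv_cancel, Matrix.SpecialLinearGroup.coe_one,
          Matrix.vecMul_one])
      right_inv := fun k => Subtype.ext (by
        simp only [Matrix.vecMul_vecMul]
        rw [← Matrix.SpecialLinearGroup.coe_mul, inv_mul_cancel, Matrix.SpecialLinearGroup.coe_one,
          Matrix.vecMul_one]) }
  refine Eq.trans (tsum_congr fun k => ?_)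
    (e.tsum_eq fun k : O => f (rowMul (diagVec k.1) g))
  change f (rowMul _ (diagSL S d γ * g)) = _
  rw [rowMul_mul, rowMul_diag]
  rfl

lemma map_rowMul_orbitMeasure (μ : Measure (UL S d)) [μ.IsMulLeftInvariant]
    [μ.IsMulRightInvariant] {F : Set (UL S d)} (hFm : MeasurableSet F)
    (hF : ∀ x : UL S d, ∃! γ : ULZ S d, γ • x ∈ F) {O : Set (Fin d → ZS S)} (hO : OrbitStable O)
    (h : UL S d) : (orbitMeasure μ F O).map (fun v => rowMul v h) = orbitMeasure μ F O := by
  have hR : Measurable fun v : QSVec S d => rowMul v h := (measurePreserving_rowMul h).measurable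
  refine Measure.ext_of_lintegral _ fun f hf => ?_
  have hfR : Measurable fun v => f (rowMul v h) := hf.comp hR
  rw [lintegral_map hf hR, lintegral_orbitMeasure _ _ _ hfR, lintegral_orbitMeasure _ _ _ hf]
  simp only [← rowMul_mul]
  exact setLIntegral_mul_right μ hFm hF
    (Φ := fun g => ∑' k : O, f (rowMul (diagVec k.1) g)) (tsum_orbit_smul hO f) h

lemma ae_firstRow_of_volS_zero (μ : Measure (UL S (m + 2))) [μ.IsHaarMeasure]
    {A : Set (QSVec S (m + 2))} (hA : MeasurableSet A) (h0 : volS S (m + 2) A = 0) :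
    μ {g | g.rows 0 ∈ A} = 0 := by
  obtain ⟨c, hc, h⟩ := exists_coneMeasure_eq_smul (by omega) μ
  have h1 := (ae_firstRow_iff hA).2 h0
  rw [h, ae_iff] at h1
  simp only [not_not, Measure.smul_apply, smul_eq_zero, hc, false_or] at h1
  exact h1

/-- By `exists_orbit_rep`, `k g` is an integer `a` times the first row of `γ g`. Left translation by
`γ` preserves `μ`, scaling by `a` preserves null sets, and the first row takes values in a null set
only with probability zero. -/
lemma orbitMeasure_absolutelyContinuous (μ : Measure (UL S (m + 2))) [μ.IsHaarMeasure]
    (F : Set (UL S (m + 2))) {O : Set (Fin (m + 2) → ZS S)} (hO : 0 ∉ O) :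
    orbitMeasure μ F O ≪ volS S (m + 2) := by
  refine Measure.AbsolutelyContinuous.mk fun A hA h0 => ?_
  unfold orbitMeasure
  rw [Measure.sum_apply _ hA, ENNReal.tsum_eq_zero]
  rintro ⟨k, hk⟩
  have hk0 : k ≠ 0 := fun h => hO (h ▸ hk)
  rw [Measure.map_apply (measurable_rowMul_const _) hA]
  refine Measure.absolutelyContinuous_of_le Measure.restrict_le_self ?_
  obtain ⟨a, γ, ha, haS, rfl⟩ := exists_orbit_rep k hk0
  have hA' : MeasurableSet ((fun v : QSVec S (m + 2) => a • v) ⁻¹' A) :=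
    (continuous_const_smul a).measurable hA
  have h1 : volS S (m + 2) ((fun v => a • v) ⁻¹' A) = 0 := by
    rw [← Measure.map_apply (continuous_const_smul a).measurable hA, map_nsmul_volS ha haS,
      Measure.smul_apply, h0, smul_zero]
  have h2 := ae_firstRow_of_volS_zero μ hA' h1
  have h3 : (fun g => rowMul (diagVec ((a : ZS S) • (Pi.single 0 1 ᵥ*
      (γ : Matrix (Fin (m + 2)) (Fin (m + 2)) (ZS S))))) g) ⁻¹' A =
      (fun g => diagSL S (m + 2) γ * g) ⁻¹' {g | g.rows 0 ∈ (fun v => a • v) ⁻¹' A} := by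
    ext g
    simp only [Set.mem_preimage, Set.mem_ofPred_eq]
    rw [diagVec_smul, rowMul_nsmul, ← rowMul_diag, ← rowMul_mul, rowMul_firstBasis]
  rw [h3, measure_preimage_mul]
  exact h2

theorem exists_orbitMeasure_eq (μ : Measure (UL S (m + 2))) [μ.IsHaarMeasure]
    {F : Set (UL S (m + 2))} (hFm : MeasurableSet F)
    (hF : ∀ x : UL S (m + 2), ∃! γ : ULZ S (m + 2), γ • x ∈ F) {O : Set (Fin (m + 2) → ZS S)}
    (hO : OrbitStable O) (h0 : 0 ∉ O) : ∃ c : ℝ≥0∞, orbitMeasure μ F O = c • volS S (m + 2) := by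
  have := isMulRightInvariant_of_isHaarMeasure (by omega) μ
  have : SFinite (orbitMeasure μ F O) := by unfold orbitMeasure; infer_instance
  exact exists_eq_smul_volS _ (map_rowMul_orbitMeasure μ hFm hF hO)
    (orbitMeasure_absolutelyContinuous μ F h0)

/-- The orbit of the first standard basis vector. -/
def primitiveOrbit (S : Finset Nat.Primes) (m : ℕ) : Set (Fin (m + 2) → ZS S) :=
  Set.range fun γ : Matrix.SpecialLinearGroup (Fin (m + 2)) (ZS S) =>
    Pi.single 0 1 ᵥ* (γ : Matrix (Fin (m + 2)) (Fin (m + 2)) (ZS S))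

lemma orbitStable_primitiveOrbit : OrbitStable (primitiveOrbit S m) := by
  rintro γ _ ⟨δ, rfl⟩
  exact ⟨δ * γ, by simp only [Matrix.SpecialLinearGroup.coe_mul, Matrix.vecMul_vecMul]⟩

lemma vecMul_ne_zero {k : Fin d → ZS S} (hk : k ≠ 0)
    (γ : Matrix.SpecialLinearGroup (Fin d) (ZS S)) :
    k ᵥ* (γ : Matrix (Fin d) (Fin d) (ZS S)) ≠ 0 := by
  intro h
  apply hk
  have := congrArg (fun v => v ᵥ* ((γ⁻¹ : Matrix.SpecialLinearGroup (Fin d) (ZS S)) :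
    Matrix (Fin d) (Fin d) (ZS S))) h
  simpa only [Matrix.vecMul_vecMul, ← Matrix.SpecialLinearGroup.coe_mul, mul_inv_cancel,
    Matrix.SpecialLinearGroup.coe_one, Matrix.vecMul_one, Matrix.zero_vecMul] using this

lemma zero_notMem_primitiveOrbit : 0 ∉ primitiveOrbit S m := by
  rintro ⟨γ, h⟩
  refine vecMul_ne_zero ?_ γ h
  intro h1
  have := congrFun h1 0
  simp at this

lemma orbitStable_nonzero : OrbitStable {k : Fin d → ZS S | k ≠ 0} := fun γ _ hk =>
  vecMul_ne_zero hk γ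

/-- The mean value over nonzero vectors is bounded in terms of the mean value over primitive
vectors. -/
theorem orbitMeasure_nonzero_lt_top (μ : Measure (UL S (m + 2))) {F : Set (UL S (m + 2))}
    {c c' : ℝ≥0∞} (hc : orbitMeasure μ F {k | k ≠ 0} = c • volS S (m + 2))
    (hc' : orbitMeasure μ F (primitiveOrbit S m) = c' • volS S (m + 2)) (hfin : c' ≠ ∞) :
    c ≠ ∞ := by
  let J : Type := {a : ℕ // a ≠ 0 ∧ ∀ p ∈ S, ¬ p.1 ∣ a}
  set B := unitBox S (m + 2) with hB
  have hBm : MeasurableSet B := measurableSet_unitBox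
  have h1 : orbitMeasure μ F {k | k ≠ 0} B ≤
      ∑' a : J, orbitMeasure μ F (primitiveOrbit S m) ((fun v => a.1 • v) ⁻¹' B) := by
    have hind : Measurable (B.indicator (fun _ => (1 : ℝ≥0∞))) := measurable_one.indicator hBm
    have hsm : ∀ a : J, Measurable fun v : QSVec S (m + 2) => a.1 • v := fun a =>
      (continuous_const_smul a.1).measurable
    have e1 : orbitMeasure μ F {k | k ≠ 0} B = ∫⁻ v, B.indicator (fun _ => 1) v
        ∂(orbitMeasure μ F {k | k ≠ 0}) := (lintegral_indicator_one hBm).symm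
    have e2 : ∀ a : J, orbitMeasure μ F (primitiveOrbit S m) ((fun v => a.1 • v) ⁻¹' B) =
        ∫⁻ v, B.indicator (fun _ => 1) (a.1 • v) ∂(orbitMeasure μ F (primitiveOrbit S m)) := by
      intro a
      rw [← lintegral_indicator_one (hsm a hBm)]
      rfl
    rw [e1, lintegral_orbitMeasure _ _ _ hind]
    simp only [e2]
    have e3 : ∀ a : J, ∫⁻ v, B.indicator (fun _ => 1) (a.1 • v)
        ∂(orbitMeasure μ F (primitiveOrbit S m)) = ∫⁻ g in F, ∑' k : primitiveOrbit S m,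
          B.indicator (fun _ => 1) (a.1 • rowMul (diagVec k.1) g) ∂μ := fun a =>
      lintegral_orbitMeasure μ F (primitiveOrbit S m) (hind.comp (hsm a))
    have hm : ∀ a : J, AEMeasurable (fun g => ∑' k : primitiveOrbit S m,
        B.indicator (fun _ => (1 : ℝ≥0∞)) (a.1 • rowMul (diagVec k.1) g)) (μ.restrict F) := fun a =>
      (Measurable.tsum fun k => (hind.comp (hsm a)).comp (measurable_rowMul_const _)).aemeasurable
    simp only [e3]
    rw [← lintegral_tsum hm]
    refine lintegral_mono fun g => ?_
    refine le_of_le_of_eq ?_ (ENNReal.tsum_prod (f := fun (a : J) (k : primitiveOrbit S m) =>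
      B.indicator (fun _ => (1 : ℝ≥0∞)) (a.1 • rowMul (diagVec k.1) g)))
    -- Each nonzero vector determines, by choice, a multiplier prime to `S` and a vector in the
    -- primitive orbit, from which it can be recovered. So the sum is at most the double sum.
    have hrep : ∀ k : {k : Fin (m + 2) → ZS S | k ≠ 0}, ∃ x : J × primitiveOrbit S m,
        k.1 = (x.1.1 : ZS S) • x.2.1 := by
      rintro ⟨k, hk⟩
      obtain ⟨a, γ, ha, haS, h⟩ := exists_orbit_rep k hk
      exact ⟨(⟨a, ha, haS⟩, ⟨_, γ, rfl⟩), h⟩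
    choose r hr using hrep
    have hrinj : Function.Injective r := fun k l h => Subtype.ext (by rw [hr k, hr l, h])
    refine le_trans (le_of_eq (tsum_congr fun k => ?_))
      (ENNReal.tsum_comp_le_tsum_of_injective hrinj fun x : J × primitiveOrbit S m =>
        B.indicator (fun _ => (1 : ℝ≥0∞)) (x.1.1 • rowMul (diagVec x.2.1) g))
    rw [hr k, diagVec_smul, rowMul_nsmul]
  have h2 : ∀ a : J, orbitMeasure μ F (primitiveOrbit S m) ((fun v => a.1 • v) ⁻¹' B) =
      c' * ENNReal.ofReal ((((a.1 : ℕ) : ℝ) ^ (m + 2))⁻¹) := by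
    intro a
    rw [hc', Measure.smul_apply, ← Measure.map_apply (continuous_const_smul a.1).measurable hBm,
      map_nsmul_volS a.2.1 a.2.2, Measure.smul_apply, hB, volS_unitBox]
    simp
  -- The exponent is the dimension, which is at least two.
  have hsum : ∑' a : J, ENNReal.ofReal ((((a.1 : ℕ) : ℝ) ^ (m + 2))⁻¹) ≠ ∞ := by
    have hs : Summable fun n : ℕ => (((n : ℝ) ^ (m + 2))⁻¹) :=
      Real.summable_nat_pow_inv.2 (by omega)
    refine ne_top_of_le_ne_top hs.tsum_ofReal_ne_top ?_
    exact ENNReal.tsum_comp_le_tsum_of_injective (f := fun a : J => a.1) Subtype.val_injective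
      fun n : ℕ => ENNReal.ofReal (((n : ℝ) ^ (m + 2))⁻¹)
  have h3 : c = orbitMeasure μ F {k | k ≠ 0} B := by
    rw [hc, Measure.smul_apply, hB, volS_unitBox]; simp
  rw [h3]
  refine ne_top_of_le_ne_top ?_ h1
  simp only [h2]
  rw [ENNReal.tsum_mul_left]
  exact ENNReal.mul_ne_top hfin hsum

/-- The mean value over primitive vectors is bounded by the measure of a set that meets every orbit
of the stabilizer of the first basis vector. -/
theorem orbitMeasure_primitive_le (μ : Measure (UL S (m + 2))) [μ.IsHaarMeasure]
    {F : Set (UL S (m + 2))} (hFm : MeasurableSet F)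
    (hF : ∀ x : UL S (m + 2), ∃! γ : ULZ S (m + 2), γ • x ∈ F) {B : Set (QSVec S (m + 2))}
    (hB : MeasurableSet B) {Ω : Set (UL S (m + 2))} (hΩm : MeasurableSet Ω)
    (hΩ : ∀ g : UL S (m + 2), g.rows 0 ∈ B →
      ∃ γ : Matrix.SpecialLinearGroup (Fin (m + 2)) (ZS S),
        Pi.single 0 1 ᵥ* (γ : Matrix (Fin (m + 2)) (Fin (m + 2)) (ZS S)) = Pi.single 0 1 ∧
        diagSL S (m + 2) γ * g ∈ Ω) :
    orbitMeasure μ F (primitiveOrbit S m) B ≤ μ Ω := by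
  classical
  have hind : Measurable (B.indicator (fun _ => (1 : ℝ≥0∞))) := measurable_one.indicator hB
  have e2 := (isFundamentalDomain_of_strict (μ := μ) hFm hF).lintegral_eq_tsum''
    (Ω.indicator fun _ => (1 : ℝ≥0∞))
  rw [← lintegral_indicator_one hB, ← lintegral_indicator_one hΩm]
  change ∫⁻ v, B.indicator (fun _ => 1) v ∂_ ≤ ∫⁻ g, Ω.indicator (fun _ => 1) g ∂μ
  have hm : ∀ γ : ULZ S (m + 2), AEMeasurable
      (fun g => Ω.indicator (fun _ => (1 : ℝ≥0∞)) (γ • g)) (μ.restrict F) := fun γ =>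
    ((measurable_one.indicator hΩm).comp (measurable_const_smul γ)).aemeasurable
  rw [lintegral_orbitMeasure _ _ _ hind, e2, ← lintegral_tsum hm]
  refine lintegral_mono fun g => ?_
  -- An element carrying the first basis vector to `k` is unique only up to the stabilizer; that
  -- freedom is used to bring it into `Ω` whenever `k g` lies in `B`. As `β` determines `k`, the sum
  -- over `k` is at most the sum over the whole group, whose integral over `F` unfolds to `μ Ω`.
  have hrep : ∀ k : primitiveOrbit S m, ∃ β : Matrix.SpecialLinearGroup (Fin (m + 2)) (ZS S),
      Pi.single 0 1 ᵥ* (β : Matrix (Fin (m + 2)) (Fin (m + 2)) (ZS S)) = k.1 ∧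
      (rowMul (diagVec k.1) g ∈ B → diagSL S (m + 2) β * g ∈ Ω) := by
    rintro ⟨_, δ, rfl⟩
    by_cases hb : rowMul (diagVec (Pi.single 0 1 ᵥ*
        (δ : Matrix (Fin (m + 2)) (Fin (m + 2)) (ZS S)))) g ∈ B
    · have hb' := hb
      rw [← rowMul_diag, ← rowMul_mul, rowMul_firstBasis] at hb'
      obtain ⟨γ, h1, h2⟩ := hΩ _ hb'
      refine ⟨γ * δ, ?_, fun _ => ?_⟩
      · rw [Matrix.SpecialLinearGroup.coe_mul, ← Matrix.vecMul_vecMul, h1]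
      · rwa [map_mul, mul_assoc]
    · exact ⟨δ, rfl, fun h => absurd h hb⟩
  choose β hβ1 hβ2 using hrep
  let j : primitiveOrbit S m → ULZ S (m + 2) := fun k => ⟨diagSL S (m + 2) (β k), β k, rfl⟩
  have hj : Function.Injective j := by
    intro k l h
    have h1 : diagSL S (m + 2) (β k) = diagSL S (m + 2) (β l) := congrArg Subtype.val h
    have h2 := congrArg (fun x => rowMul (diagVec (Pi.single 0 1 : Fin (m + 2) → ZS S)) x) h1
    simp only [rowMul_diag, hβ1] at h2
    exact Subtype.ext (diagVec_injective h2)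
  refine le_trans (ENNReal.tsum_le_tsum fun k => ?_)
    (ENNReal.tsum_comp_le_tsum_of_injective hj fun γ : ULZ S (m + 2) =>
      Ω.indicator (fun _ => (1 : ℝ≥0∞)) (γ • g))
  by_cases hb : rowMul (diagVec k.1) g ∈ B
  · have : j k • g ∈ Ω := hβ2 k hb
    rw [Set.indicator_of_mem hb, Set.indicator_of_mem this]
  · rw [Set.indicator_of_notMem hb]; exact zero_le

end OrbitMeasure

/-! ### Lattice points in large balls and the value of the constant -/

section Counting

open Filter Topology

variable {S : Finset Nat.Primes} {d : ℕ}

/-- A product of balls, of radius `R` at the infinite place and `ρ` at the finite places. -/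
def twoBall (S : Finset Nat.Primes) (d : ℕ) (R ρ : ℝ) : Set (QSVec S d) :=
  Metric.closedBall 0 R ×ˢ Metric.closedBall 0 ρ

lemma mem_twoBall {R ρ : ℝ} {v : QSVec S d} : v ∈ twoBall S d R ρ ↔ ‖v.1‖ ≤ R ∧ ‖v.2‖ ≤ ρ := by
  simp [twoBall, Set.mem_prod]

lemma measurableSet_twoBall {R ρ : ℝ} : MeasurableSet (twoBall S d R ρ) :=
  Metric.isClosed_closedBall.measurableSet.prod Metric.isClosed_closedBall.measurableSet

/-- The volume of a ball at the finite places. -/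
def finVol (S : Finset Nat.Primes) (d : ℕ) (ρ : ℝ) : ℝ≥0∞ :=
  (Measure.pi fun p : S => volPadic p.1.1 d) (Metric.closedBall 0 ρ)

lemma volS_twoBall {R ρ : ℝ} (hR : 0 ≤ R) :
    volS S d (twoBall S d R ρ) = ENNReal.ofReal ((2 * R) ^ d) * finVol S d ρ := by
  unfold volS twoBall finVol
  rw [Measure.prod_prod, Real.volume_pi_closedBall _ hR, Fintype.card_fin]

lemma finVol_ne_top (ρ : ℝ) : finVol S d ρ ≠ ∞ :=
  (isCompact_closedBall _ _).measure_lt_top.ne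

lemma one_le_finVol {ρ : ℝ} (hρ : 1 ≤ ρ) : 1 ≤ finVol S d ρ := by
  have h1 : (Measure.pi fun p : S => volPadic p.1.1 d)
      (Set.univ.pi fun p : S => Metric.closedBall (0 : Fin d → ℚ_[p.1.1]) 1) = 1 := by
    have : ∀ p : S, volPadic p.1.1 d (Metric.closedBall 0 1) = 1 := fun p =>
      Measure.addHaarMeasure_self (K₀ := unitBall p.1.1 d)
    rw [Measure.pi_pi]; simp [this]
  rw [← h1]
  refine measure_mono fun y hy => ?_
  rw [mem_closedBall_zero_iff]
  refine (pi_norm_le_iff_of_nonneg (zero_le_one.trans hρ)).2 fun p => ?_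
  exact (mem_closedBall_zero_iff.1 (hy p (Set.mem_univ p))).trans hρ

lemma lintegral_eq_tsum_rowMul (g : UL S d) {f : QSVec S d → ℝ≥0∞} (hf : Measurable f) :
    ∫⁻ v, f v ∂(volS S d) = ∑' k : Fin d → ZS S,
      ∫⁻ u in unitBox S d, f (rowMul u g + rowMul (diagVec k) g) ∂(volS S d) := by
  rw [← (measurePreserving_rowMul g).lintegral_comp hf, lintegral_eq_unitBox]
  simp only [rowMul_add]

/-- The number of lattice points in a set. -/
def latticeCount (A : Set (QSVec S d)) (g : UL S d) : ℝ≥0∞ :=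
  ∑' k : Fin d → ZS S, A.indicator (fun _ => (1 : ℝ≥0∞)) (rowMul (diagVec k) g)

/-- Every lattice point of `A` carries its own translate of the image of the box, of volume one,
inside `A'`, and these translates tile space. -/
lemma latticeCount_le {A A' : Set (QSVec S d)} (hA' : MeasurableSet A') (g : UL S d)
    (h : ∀ u ∈ unitBox S d, ∀ v ∈ A, rowMul u g + v ∈ A') : latticeCount A g ≤ volS S d A' := by
  rw [← lintegral_indicator_one hA', lintegral_eq_tsum_rowMul g (measurable_one.indicator hA')]
  refine ENNReal.tsum_le_tsum fun k => ?_
  by_cases hk : rowMul (diagVec k) g ∈ A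
  · rw [Set.indicator_of_mem hk]
    calc (1 : ℝ≥0∞) = ∫⁻ _ in unitBox S d, 1 ∂(volS S d) := by simp [volS_unitBox]
      _ ≤ _ := setLIntegral_mono' measurableSet_unitBox fun u hu => by
        rw [Set.indicator_of_mem (h u hu _ hk)]; rfl
  · rw [Set.indicator_of_notMem hk]; exact zero_le

lemma le_latticeCount {A A' : Set (QSVec S d)} (hA' : MeasurableSet A') (g : UL S d)
    (h : ∀ u ∈ unitBox S d, ∀ v, rowMul u g + v ∈ A' → v ∈ A) :
    volS S d A' ≤ latticeCount A g := by
  rw [← lintegral_indicator_one hA', lintegral_eq_tsum_rowMul g (measurable_one.indicator hA')]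
  refine ENNReal.tsum_le_tsum fun k => ?_
  by_cases hk : rowMul (diagVec k) g ∈ A
  · rw [Set.indicator_of_mem hk]
    have hle : ∀ u : QSVec S d,
        A'.indicator (1 : QSVec S d → ℝ≥0∞) (rowMul u g + rowMul (diagVec k) g) ≤ 1 := fun u =>
      Set.indicator_apply_le' (fun _ => le_rfl) fun _ => zero_le
    exact (lintegral_mono hle).trans_eq (by simp [volS_unitBox])
  · rw [Set.indicator_of_notMem hk]
    refine le_of_eq (setLIntegral_eq_zero measurableSet_unitBox fun u hu => ?_)
    exact Set.indicator_of_notMem (fun hm => hk (h u hu _ hm)) _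

lemma exists_bound_rowMul (g : UL S d) :
    ∃ r : ℝ, 0 ≤ r ∧ ∀ u ∈ unitBox S d, ‖rowMul u g‖ ≤ r := by
  have hc : Continuous fun u : QSVec S d => rowMul u g :=
    continuous_rowMul.comp (continuous_id.prodMk continuous_const)
  obtain ⟨r, hr⟩ := ((isCompact_closedBall (0 : QSVec S d) 1).image hc).isBounded.exists_norm_le
  refine ⟨max r 0, le_max_right _ _, fun u hu => (hr _ ⟨u, ?_, rfl⟩).trans (le_max_left _ _)⟩
  rw [mem_closedBall_zero_iff]
  exact norm_le_one_of_mem_unitBox hu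

/-- The ball of radius `n + 1`. -/
def bigBall (S : Finset Nat.Primes) (d n : ℕ) : Set (QSVec S d) := twoBall S d (n + 1) (n + 1)

lemma volS_bigBall (n : ℕ) : volS S d (bigBall S d n) =
    ENNReal.ofReal ((2 * (n + 1 : ℝ)) ^ d) * finVol S d (n + 1) := volS_twoBall (by positivity)

lemma volS_bigBall_ne_top (n : ℕ) : volS S d (bigBall S d n) ≠ ∞ := by
  rw [volS_bigBall]; exact ENNReal.mul_ne_top ENNReal.ofReal_ne_top (finVol_ne_top _)

lemma finVol_ne_zero (n : ℕ) : finVol S d (n + 1) ≠ 0 :=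
  (zero_lt_one.trans_le (one_le_finVol (by simp))).ne'

lemma volS_bigBall_ne_zero (n : ℕ) : volS S d (bigBall S d n) ≠ 0 := by
  rw [volS_bigBall]
  exact mul_ne_zero (ENNReal.ofReal_pos.2 (by positivity)).ne' (finVol_ne_zero n)

lemma volS_twoBall_div (n : ℕ) {R : ℝ} (hR : 0 ≤ R) :
    volS S d (twoBall S d R (n + 1)) / volS S d (bigBall S d n) =
      ENNReal.ofReal ((R / (n + 1)) ^ d) := by
  rw [volS_bigBall, volS_twoBall hR, ENNReal.mul_div_mul_right _ _ (finVol_ne_zero n) (finVol_ne_top _),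
    ← ENNReal.ofReal_div_of_pos (by positivity), ← div_pow, mul_div_mul_left _ _ two_ne_zero]

/-- The image of the box is bounded by some `r`. At the finite places a ball of radius at least `r`
absorbs it by the ultrametric inequality, so only the real radius has to be changed by `r`, which is
negligible in the limit. -/
lemma tendsto_latticeCount_div (g : UL S d) :
    Tendsto (fun n => latticeCount (bigBall S d n) g / volS S d (bigBall S d n)) atTop (𝓝 1) := by
  obtain ⟨r, hr0, hr⟩ := exists_bound_rowMul g
  have hlim : ∀ a : ℝ, Tendsto (fun n : ℕ => ENNReal.ofReal (((n + 1 + a) / (n + 1 : ℝ)) ^ d))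
      atTop (𝓝 1) := by
    intro a
    rw [← ENNReal.ofReal_one]
    refine ENNReal.tendsto_ofReal ?_
    have h1 : Tendsto (fun n : ℕ => a / ((n : ℝ) + 1)) atTop (𝓝 0) :=
      tendsto_const_nhds.div_atTop (tendsto_atTop_add_const_right _ _ tendsto_natCast_atTop_atTop)
    have h2 : Tendsto (fun n : ℕ => (1 + a / ((n : ℝ) + 1)) ^ d) atTop (𝓝 ((1 + 0) ^ d)) :=
      (h1.const_add 1).pow d
    rw [add_zero, one_pow] at h2
    refine h2.congr fun n => ?_
    have : (n : ℝ) + 1 ≠ 0 := by positivity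
    congr 1
    field_simp
  have hu : ∀ n : ℕ, r ≤ n + 1 → ∀ u ∈ unitBox S d, ‖(rowMul u g).1‖ ≤ r ∧
      ‖(rowMul u g).2‖ ≤ (n + 1 : ℝ) := fun n hn u hub =>
    ⟨(norm_fst_le _).trans (hr u hub), ((norm_snd_le _).trans (hr u hub)).trans hn⟩
  have hev : ∀ᶠ n : ℕ in atTop, r ≤ (n : ℝ) + 1 := by
    filter_upwards [tendsto_natCast_atTop_atTop.eventually_ge_atTop r] with n hn
    linarith
  refine tendsto_of_tendsto_of_tendsto_of_le_of_le' (hlim (-r)) (hlim r) ?_ ?_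
  · filter_upwards [hev] with n hn
    rw [← volS_twoBall_div (S := S) n (by linarith)]
    refine ENNReal.div_le_div_right (le_latticeCount measurableSet_twoBall g ?_) _
    intro u hub v hv
    obtain ⟨h1, h2⟩ := hu n hn u hub
    rw [mem_twoBall] at hv
    refine mem_twoBall.2 ⟨?_, ?_⟩
    · have e : v.1 = (rowMul u g + v).1 - (rowMul u g).1 := by simp
      rw [e]
      exact (norm_sub_le _ _).trans (by linarith [hv.1])
    · have e : v.2 = (rowMul u g + v).2 - (rowMul u g).2 := by simp
      rw [e]
      exact (norm_sub_le_max _ _).trans (max_le hv.2 h2)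
  · filter_upwards [hev] with n hn
    rw [← volS_twoBall_div (S := S) n (by linarith)]
    refine ENNReal.div_le_div_right (latticeCount_le measurableSet_twoBall g ?_) _
    intro u hub v hv
    obtain ⟨h1, h2⟩ := hu n hn u hub
    obtain ⟨hv1, hv2⟩ := mem_twoBall.1 hv
    refine mem_twoBall.2 ⟨?_, ?_⟩
    · exact (norm_add_le _ _).trans (by linarith)
    · exact (IsUltrametricDist.norm_add_le_max _ _).trans (max_le h2 hv2)

/-- The number of nonzero lattice points in a set. -/
def primedCount (A : Set (QSVec S d)) (g : UL S d) : ℝ≥0∞ :=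
  ∑' k : {k : Fin d → ZS S | k ≠ 0}, A.indicator (fun _ => (1 : ℝ≥0∞)) (rowMul (diagVec k.1) g)

lemma measurable_primedCount {A : Set (QSVec S d)} (hA : MeasurableSet A) :
    Measurable (primedCount A) :=
  Measurable.tsum fun _ => (measurable_one.indicator hA).comp (measurable_rowMul_const _)

lemma tsum_eq_zero_add_tsum_ne (f : (Fin d → ZS S) → ℝ≥0∞) :
    ∑' k, f k = f 0 + ∑' k : {k : Fin d → ZS S | k ≠ 0}, f k.1 := by
  have h := Summable.tsum_add_tsum_compl (f := f) (s := {(0 : Fin d → ZS S)})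
    ENNReal.summable ENNReal.summable
  rw [← h, tsum_singleton]
  rfl

lemma latticeCount_eq {A : Set (QSVec S d)} (h0 : (0 : QSVec S d) ∈ A) (g : UL S d) :
    latticeCount A g = 1 + primedCount A g := by
  unfold latticeCount primedCount
  rw [tsum_eq_zero_add_tsum_ne, diagVec_zero, rowMul_zero, Set.indicator_of_mem h0]

lemma zero_mem_bigBall (n : ℕ) : (0 : QSVec S d) ∈ bigBall S d n := by
  refine mem_twoBall.2 ⟨?_, ?_⟩ <;> simp <;> positivity

lemma natCast_le_volS_bigBall (hd : d ≠ 0) (n : ℕ) : (n : ℝ≥0∞) ≤ volS S d (bigBall S d n) := by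
  rw [volS_bigBall]
  have h1 : (n : ℝ) ≤ (2 * (n + 1 : ℝ)) ^ d := by
    have : (1 : ℝ) ≤ 2 * (n + 1 : ℝ) := by linarith [(Nat.cast_nonneg n : (0 : ℝ) ≤ n)]
    calc (n : ℝ) ≤ 2 * (n + 1 : ℝ) := by linarith [(Nat.cast_nonneg n : (0 : ℝ) ≤ n)]
      _ ≤ _ := le_self_pow₀ this hd
  calc (n : ℝ≥0∞) = ENNReal.ofReal n := (ENNReal.ofReal_natCast n).symm
    _ ≤ ENNReal.ofReal ((2 * (n + 1 : ℝ)) ^ d) := ENNReal.ofReal_le_ofReal h1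
    _ ≤ _ := le_mul_of_one_le_right zero_le (one_le_finVol (by simp))

lemma tendsto_primedCount_div (hd : d ≠ 0) (g : UL S d) :
    Tendsto (fun n => primedCount (bigBall S d n) g / volS S d (bigBall S d n)) atTop (𝓝 1) := by
  have h1 := tendsto_latticeCount_div g
  have h2 : Tendsto (fun n => 1 / volS S d (bigBall S d n)) atTop (𝓝 0) := by
    refine tendsto_of_tendsto_of_tendsto_of_le_of_le tendsto_const_nhds
      ENNReal.tendsto_inv_nat_nhds_zero (fun n => zero_le) fun n => ?_
    rw [one_div]
    exact ENNReal.inv_le_inv.2 (natCast_le_volS_bigBall hd n)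
  have h3 := ENNReal.Tendsto.sub h1 h2 (Or.inl ENNReal.one_ne_top)
  rw [tsub_zero] at h3
  refine h3.congr fun n => ?_
  rw [latticeCount_eq (zero_mem_bigBall n), ENNReal.add_div]
  exact ENNReal.add_sub_cancel_left (ENNReal.div_ne_top ENNReal.one_ne_top (volS_bigBall_ne_zero n))

/-- The number of lattice points in a translate of a small ball is bounded by the number in the
ball of radius one. -/
lemma tsum_translate_le (g : UL S d) (x : QSVec S d) :
    ∑' k : Fin d → ZS S, (twoBall S d (1 / 2) (1 / 2)).indicator (fun _ => (1 : ℝ≥0∞))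
      (x - rowMul (diagVec k) g) ≤ latticeCount (bigBall S d 0) g := by
  by_cases h : ∃ k₀ : Fin d → ZS S, x - rowMul (diagVec k₀) g ∈ twoBall S d (1 / 2) (1 / 2)
  · obtain ⟨k₀, hk₀⟩ := h
    unfold latticeCount
    -- Recentre at one lattice point `k₀` of the translate: differences from it are lattice points
    -- of the unit ball.
    rw [← (Equiv.addRight k₀).tsum_eq]
    refine ENNReal.tsum_le_tsum fun k => ?_
    by_cases hk : x - rowMul (diagVec (k + k₀)) g ∈ twoBall S d (1 / 2) (1 / 2)
    · have hmem : rowMul (diagVec k) g ∈ bigBall S d 0 := by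
        have e : rowMul (diagVec k) g = (x - rowMul (diagVec k₀) g) -
            (x - rowMul (diagVec (k + k₀)) g) := by
          rw [diagVec_add, rowMul_add]; abel
        obtain ⟨a1, a2⟩ := mem_twoBall.1 hk₀
        obtain ⟨b1, b2⟩ := mem_twoBall.1 hk
        rw [e]
        refine mem_twoBall.2 ⟨?_, ?_⟩
        · exact (norm_sub_le _ _).trans (by norm_num at *; linarith)
        · exact (norm_sub_le _ _).trans (by norm_num at *; linarith)
      rw [Set.indicator_of_mem hmem]
      exact Set.indicator_le_self' (fun _ _ => zero_le) _
    · rw [Equiv.coe_addRight, Set.indicator_of_notMem hk]; exact zero_le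
  · push Not at h
    have : ∀ k : Fin d → ZS S, (twoBall S d (1 / 2) (1 / 2)).indicator (fun _ => (1 : ℝ≥0∞))
      (x - rowMul (diagVec k) g) = 0 := fun k => Set.indicator_of_notMem (h k) _
    rw [tsum_congr this, tsum_zero]
    exact zero_le

/-- Put a small ball around each lattice point of the large ball and integrate the total overlap.
The small balls stay in `W`, and by `tsum_translate_le` no point is covered more often than the
count in the unit ball. -/
lemma latticeCount_mul_le (n : ℕ) (g : UL S d) :
    latticeCount (bigBall S d n) g * volS S d (twoBall S d (1 / 2) (1 / 2)) ≤
      volS S d (twoBall S d (2 * (n + 1)) (n + 1)) * latticeCount (bigBall S d 0) g := by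
  set U := twoBall S d (1 / 2) (1 / 2) with hU
  set W := twoBall S d (2 * (n + 1)) (n + 1) with hW
  have hUm : MeasurableSet U := measurableSet_twoBall
  have hWm : MeasurableSet W := measurableSet_twoBall
  have hmeas : ∀ k : Fin d → ZS S, Measurable fun x : QSVec S d =>
      U.indicator (fun _ => (1 : ℝ≥0∞)) (x - rowMul (diagVec k) g) := fun k =>
    (measurable_one.indicator hUm).comp (measurable_id.sub_const _)
  have hvol : ∀ k : Fin d → ZS S, ∫⁻ x, U.indicator (fun _ => (1 : ℝ≥0∞))
      (x - rowMul (diagVec k) g) ∂(volS S d) = volS S d U := by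
    intro k
    rw [lintegral_sub_right_eq_self (fun x => U.indicator (fun _ => (1 : ℝ≥0∞)) x)]
    exact lintegral_indicator_one hUm
  calc latticeCount (bigBall S d n) g * volS S d U
      = ∑' k : Fin d → ZS S, ∫⁻ x, (bigBall S d n).indicator (fun _ => (1 : ℝ≥0∞))
          (rowMul (diagVec k) g) * U.indicator (fun _ => (1 : ℝ≥0∞))
          (x - rowMul (diagVec k) g) ∂(volS S d) := by
        unfold latticeCount
        rw [← ENNReal.tsum_mul_right]
        refine tsum_congr fun k => ?_
        rw [lintegral_const_mul _ (hmeas k), hvol]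
    _ = ∫⁻ x, ∑' k : Fin d → ZS S, (bigBall S d n).indicator (fun _ => (1 : ℝ≥0∞))
          (rowMul (diagVec k) g) * U.indicator (fun _ => (1 : ℝ≥0∞))
          (x - rowMul (diagVec k) g) ∂(volS S d) :=
        (lintegral_tsum fun k => ((hmeas k).const_mul _).aemeasurable).symm
    _ ≤ ∫⁻ x, W.indicator (fun _ => (1 : ℝ≥0∞)) x * latticeCount (bigBall S d 0) g
          ∂(volS S d) := by
        refine lintegral_mono fun x => ?_
        by_cases hx : x ∈ W
        · rw [Set.indicator_of_mem hx, one_mul]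
          refine le_trans (ENNReal.tsum_le_tsum fun k => ?_) (tsum_translate_le g x)
          exact mul_le_of_le_one_left zero_le (Set.indicator_le_self' (fun _ _ => zero_le) _)
        · rw [Set.indicator_of_notMem hx, zero_mul]
          refine le_of_eq (ENNReal.tsum_eq_zero.2 fun k => ?_)
          by_contra hne
          have h1 : rowMul (diagVec k) g ∈ bigBall S d n := by
            by_contra h; exact hne (by rw [Set.indicator_of_notMem h, zero_mul])
          have h2 : x - rowMul (diagVec k) g ∈ U := by
            by_contra h; exact hne (by rw [Set.indicator_of_notMem h, mul_zero])
          apply hx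
          have e : x = (x - rowMul (diagVec k) g) + rowMul (diagVec k) g := by abel
          obtain ⟨a1, a2⟩ := mem_twoBall.1 h1
          obtain ⟨b1, b2⟩ := mem_twoBall.1 h2
          have hn : (0 : ℝ) ≤ n := Nat.cast_nonneg n
          rw [e]
          refine mem_twoBall.2 ⟨?_, ?_⟩
          · exact (norm_add_le _ _).trans (by linarith)
          · exact (IsUltrametricDist.norm_add_le_max _ _).trans (max_le (by linarith) a2)
    _ = volS S d W * latticeCount (bigBall S d 0) g := by
        have hm : Measurable fun x => W.indicator (fun _ => (1 : ℝ≥0∞)) x :=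
          measurable_one.indicator hWm
        rw [lintegral_mul_const _ hm]
        congr 1
        exact lintegral_indicator_one hWm

lemma volS_twoBall_half_ne_zero : volS S d (twoBall S d (1 / 2) (1 / 2)) ≠ 0 := by
  have h : twoBall S d (1 / 2) (1 / 2) ∈ 𝓝 (0 : QSVec S d) := by
    refine mem_of_superset (Metric.closedBall_mem_nhds (0 : QSVec S d) (by norm_num : (0:ℝ) < 1 / 2))
      fun v hv => ?_
    rw [mem_closedBall_zero_iff] at hv
    exact mem_twoBall.2 ⟨(norm_fst_le v).trans hv, (norm_snd_le v).trans hv⟩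
  exact (Measure.measure_pos_of_mem_nhds _ h).ne'

/-- A bound independent of `n`, whose integrability over `F` follows from the finiteness of the mean
value; it dominates the limit in `covolume_eq_of_orbitMeasure`. -/
lemma primedCount_div_le (n : ℕ) (g : UL S d) :
    primedCount (bigBall S d n) g / volS S d (bigBall S d n) ≤
      ENNReal.ofReal (2 ^ d) / volS S d (twoBall S d (1 / 2) (1 / 2)) *
        (1 + primedCount (bigBall S d 0) g) := by
  have h1 := latticeCount_mul_le n g
  have hv := volS_twoBall_div (S := S) (d := d) n (R := 2 * (n + 1)) (by positivity)
  have hne : ((n : ℝ) + 1) ≠ 0 := by positivity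
  rw [mul_div_assoc, div_self hne, mul_one] at hv
  have hU0 := volS_twoBall_half_ne_zero (S := S) (d := d)
  have hUt : volS S d (twoBall S d (1 / 2) (1 / 2)) ≠ ∞ := by
    rw [volS_twoBall (by norm_num)]
    exact ENNReal.mul_ne_top ENNReal.ofReal_ne_top (finVol_ne_top _)
  rw [← latticeCount_eq (zero_mem_bigBall 0), ← hv]
  calc primedCount (bigBall S d n) g / volS S d (bigBall S d n)
      ≤ latticeCount (bigBall S d n) g / volS S d (bigBall S d n) := by
        rw [latticeCount_eq (zero_mem_bigBall n)]
        exact ENNReal.div_le_div_right le_add_self _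
    _ ≤ (volS S d (twoBall S d (2 * (n + 1)) (n + 1)) * latticeCount (bigBall S d 0) g /
          volS S d (twoBall S d (1 / 2) (1 / 2))) / volS S d (bigBall S d n) :=
        ENNReal.div_le_div_right ((ENNReal.le_div_iff_mul_le (Or.inl hU0) (Or.inl hUt)).2 h1) _
    _ = _ := by
        simp only [div_eq_mul_inv]
        ring

/-- If the mean value of the number of nonzero lattice points is finite, it equals the volume times
the covolume. -/
theorem covolume_eq_of_orbitMeasure (hd : d ≠ 0) (μ : Measure (UL S d)) {F : Set (UL S d)}
    {c : ℝ≥0∞} (hc : orbitMeasure μ F {k | k ≠ 0} = c • volS S d)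
    (hfin : c ≠ ∞) : μ F ≠ ∞ ∧ c = μ F := by
  -- The mean of the normalised count is exactly `c` for every radius, while pointwise it tends to
  -- one. Fatou's lemma then yields `μ F ≤ c`, and dominated convergence yields equality.
  have hcount : ∀ n, ∫⁻ g in F, primedCount (bigBall S d n) g / volS S d (bigBall S d n) ∂μ = c := by
    intro n
    have hB : MeasurableSet (bigBall S d n) := measurableSet_twoBall
    have h1 := lintegral_orbitMeasure μ F {k : Fin d → ZS S | k ≠ 0}
      (f := (bigBall S d n).indicator fun _ => (1 : ℝ≥0∞)) (measurable_one.indicator hB)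
    have h2 : ∫⁻ v, (bigBall S d n).indicator (fun _ => (1 : ℝ≥0∞)) v
        ∂(orbitMeasure μ F {k | k ≠ 0}) = c * volS S d (bigBall S d n) := by
      rw [hc]
      exact lintegral_indicator_one hB
    rw [h2] at h1
    simp only [div_eq_mul_inv]
    rw [lintegral_mul_const _ (measurable_primedCount hB)]
    unfold primedCount
    rw [← h1, mul_assoc, ENNReal.mul_inv_cancel (volS_bigBall_ne_zero n) (volS_bigBall_ne_top n),
      mul_one]
  have hmeas : ∀ n, Measurable fun g : UL S d =>
      primedCount (bigBall S d n) g / volS S d (bigBall S d n) := fun n =>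
    (measurable_primedCount measurableSet_twoBall).div_const _
  have hF : μ F ≤ c := by
    have h := lintegral_liminf_le (μ := μ.restrict F) (u := atTop) hmeas
    simp only [hcount, liminf_const] at h
    have e : ∀ g : UL S d, liminf (fun n => primedCount (bigBall S d n) g /
        volS S d (bigBall S d n)) atTop = 1 := fun g => (tendsto_primedCount_div hd g).liminf_eq
    simp only [e] at h
    simpa using h
  have hFt : μ F ≠ ∞ := ne_top_of_le_ne_top hfin hF
  refine ⟨hFt, ?_⟩
  have hbound : ∫⁻ g in F, ENNReal.ofReal (2 ^ d) / volS S d (twoBall S d (1 / 2) (1 / 2)) *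
        (1 + primedCount (bigBall S d 0) g) ∂μ ≠ ∞ := by
    have hm : Measurable (primedCount (bigBall S d 0)) := measurable_primedCount measurableSet_twoBall
    have hm1 : Measurable fun g => 1 + primedCount (bigBall S d 0) g := measurable_const.add hm
    rw [lintegral_const_mul _ hm1, lintegral_add_left measurable_const]
    refine ENNReal.mul_ne_top
      (ENNReal.div_ne_top ENNReal.ofReal_ne_top volS_twoBall_half_ne_zero) ?_
    refine ENNReal.add_ne_top.2 ⟨by simpa using hFt, ?_⟩
    have h0 := hcount 0
    simp only [div_eq_mul_inv] at h0
    rw [lintegral_mul_const _ hm] at h0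
    intro htop
    rw [htop, ENNReal.top_mul (ENNReal.inv_ne_zero.2 (volS_bigBall_ne_top 0))] at h0
    exact hfin h0.symm
  have hlim := tendsto_lintegral_of_dominated_convergence (μ := μ.restrict F) _ hmeas
    (fun n => Eventually.of_forall fun g => primedCount_div_le n g) hbound
    (Eventually.of_forall fun g => tendsto_primedCount_div hd g)
  simp only [hcount] at hlim
  have := tendsto_nhds_unique hlim tendsto_const_nhds
  simpa using this.symm

end Counting

/-! ### Finite covolume by induction through Schur complements -/

section Schur

variable {n : ℕ}

/-- The Schur complement of the top left entry. -/
def schur {K : Type*} [Field K] (A : Matrix (Fin (n + 1)) (Fin (n + 1)) K) :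
    Matrix (Fin n) (Fin n) K :=
  fun i j => A i.succ j.succ - A i.succ 0 / A 0 0 * A 0 j.succ

/-- The first column below the top left entry, divided by that entry. -/
def slope {K : Type*} [Field K] (A : Matrix (Fin (n + 1)) (Fin (n + 1)) K) : Fin n → K :=
  fun i => A i.succ 0 / A 0 0

lemma det_eq_mul_det_schur {K : Type*} [Field K] {A : Matrix (Fin (n + 1)) (Fin (n + 1)) K}
    (h : A 0 0 ≠ 0) : A.det = A 0 0 * (schur A).det := by
  let B : Matrix (Fin (n + 1)) (Fin (n + 1)) K :=
    Fin.cons (A 0) fun i => Fin.cons 0 (schur A i)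
  have h1 : A.det = B.det := by
    refine Matrix.det_eq_of_forall_row_eq_smul_add_const (Fin.cons 0 (slope A)) 0 rfl fun i j => ?_
    refine Fin.cases ?_ (fun i => ?_) i
    · simp [B]
    · refine Fin.cases ?_ (fun j => ?_) j
      · simp [B, slope, h]
      · simp [B, slope, schur]
  rw [h1, Matrix.det_succ_column_zero, Fin.sum_univ_succ]
  have h2 : B.submatrix (Fin.succAbove 0) Fin.succ = schur A := by
    ext i j
    rw [Matrix.submatrix_apply, Fin.zero_succAbove]
    rfl
  rw [h2]
  simp [B]

lemma schur_smul {K : Type*} [Field K] (A : Matrix (Fin (n + 1)) (Fin (n + 1)) K) {c : K}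
    (hc : c ≠ 0) : schur (c • A) = c • schur A := by
  ext i j
  simp only [schur, Matrix.smul_apply, smul_eq_mul]
  rw [mul_div_mul_left _ _ hc]
  ring

lemma slope_smul {K : Type*} [Field K] (A : Matrix (Fin (n + 1)) (Fin (n + 1)) K) {c : K}
    (hc : c ≠ 0) : slope (c • A) = slope A := by
  ext i
  simp only [slope, Matrix.smul_apply, smul_eq_mul]
  rw [mul_div_mul_left _ _ hc]

/-- The block matrix with first row `(1, 0)` and lower rows `(k, γ)`. -/
def lowerBlock {R : Type*} [CommRing R] (k : Fin n → R) (γ : Matrix (Fin n) (Fin n) R) :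
    Matrix (Fin (n + 1)) (Fin (n + 1)) R :=
  Fin.cons (Pi.single 0 1) fun i => Fin.cons (k i) (γ i)

section

variable {R : Type*} [CommRing R] (k : Fin n → R) (γ : Matrix (Fin n) (Fin n) R)

lemma det_lowerBlock : (lowerBlock k γ).det = γ.det := by
  rw [Matrix.det_succ_row_zero, Fin.sum_univ_succ]
  have h2 : (lowerBlock k γ).submatrix Fin.succ (Fin.succAbove 0) = γ := by
    ext i j
    rw [Matrix.submatrix_apply, Fin.zero_succAbove]
    rfl
  rw [h2]
  simp [lowerBlock]

lemma lowerBlock_mul_zero (A : Matrix (Fin (n + 1)) (Fin (n + 1)) R) :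
    (lowerBlock k γ * A) 0 = A 0 := by
  funext j
  rw [Matrix.mul_apply, Fin.sum_univ_succ]
  simp [lowerBlock]

lemma lowerBlock_mul_succ (A : Matrix (Fin (n + 1)) (Fin (n + 1)) R) (i : Fin n)
    (j : Fin (n + 1)) :
    (lowerBlock k γ * A) i.succ j = k i * A 0 j + ∑ l, γ i l * A l.succ j := by
  rw [Matrix.mul_apply, Fin.sum_univ_succ]
  simp [lowerBlock]

lemma map_lowerBlock {R' : Type*} [CommRing R'] (f : R →+* R') :
    (lowerBlock k γ).map f = lowerBlock (fun i => f (k i)) (γ.map f) := by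
  ext i j
  rw [Matrix.map_apply]
  refine Fin.cases ?_ (fun i => ?_) i <;> refine Fin.cases ?_ (fun j => ?_) j <;>
    simp [lowerBlock]

end

/-- The lower rows are combined by `γ` and receive multiples of the first row, which the Schur
complement does not see. For the slope, the same multiples become a translation by `k`. -/
lemma schur_lowerBlock_mul {K : Type*} [Field K] (k : Fin n → K) (γ : Matrix (Fin n) (Fin n) K)
    {A : Matrix (Fin (n + 1)) (Fin (n + 1)) K} (h : A 0 0 ≠ 0) :
    schur (lowerBlock k γ * A) = γ * schur A := by
  ext i j
  rw [Matrix.mul_apply]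
  simp only [schur, lowerBlock_mul_succ, lowerBlock_mul_zero]
  simp only [mul_sub, Finset.sum_sub_distrib, add_div, add_mul, Finset.sum_div, Finset.sum_mul]
  rw [mul_div_cancel_right₀ _ h]
  have : ∀ l, γ i l * A l.succ 0 / A 0 0 * A 0 j.succ = γ i l * (A l.succ 0 / A 0 0 * A 0 j.succ) :=
    fun l => by ring
  simp only [this]
  ring

lemma slope_lowerBlock_mul {K : Type*} [Field K] (k : Fin n → K) (γ : Matrix (Fin n) (Fin n) K)
    {A : Matrix (Fin (n + 1)) (Fin (n + 1)) K} (h : A 0 0 ≠ 0) :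
    slope (lowerBlock k γ * A) = γ *ᵥ slope A + k := by
  ext i
  simp only [slope, lowerBlock_mul_succ, lowerBlock_mul_zero, Matrix.mulVec, dotProduct,
    Pi.add_apply, add_div, Finset.sum_div]
  rw [mul_div_cancel_right₀ _ h, add_comm]
  simp only [mul_div_assoc]

variable {S : Finset Nat.Primes}

/-- The Schur complement of the top left entry, at all places. -/
def schurRows (X : RowSpace S (n + 1) (n + 1)) : RowSpace S n n :=
  fun i => (schur X.realMat i, fun p => schur (X.padicMat p) i)

/-- The first column below the top left entry, divided by that entry, at all places. -/
def slopeVec (X : RowSpace S (n + 1) (n + 1)) : QSVec S n :=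
  (slope X.realMat, fun p => slope (X.padicMat p))

lemma measurable_schurRows : Measurable (schurRows : RowSpace S (n + 1) (n + 1) → _) := by
  have hr : ∀ i j, Measurable fun X : RowSpace S (n + 1) (n + 1) => X.realMat i j := fun i j => by
    unfold RowSpace.realMat; fun_prop
  have hp : ∀ p i j, Measurable fun X : RowSpace S (n + 1) (n + 1) => X.padicMat p i j :=
    fun p i j => by unfold RowSpace.padicMat; fun_prop
  refine measurable_pi_lambda _ fun i => Measurable.prodMk ?_ ?_
  · exact measurable_pi_lambda _ fun j => (hr _ _).sub (((hr _ _).div (hr _ _)).mul (hr _ _))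
  · exact measurable_pi_lambda _ fun p => measurable_pi_lambda _ fun j =>
      (hp p _ _).sub (((hp p _ _).div (hp p _ _)).mul (hp p _ _))

lemma measurable_slopeVec : Measurable (slopeVec : RowSpace S (n + 1) (n + 1) → _) := by
  have hr : ∀ i j, Measurable fun X : RowSpace S (n + 1) (n + 1) => X.realMat i j := fun i j => by
    unfold RowSpace.realMat; fun_prop
  have hp : ∀ p i j, Measurable fun X : RowSpace S (n + 1) (n + 1) => X.padicMat p i j :=
    fun p i j => by unfold RowSpace.padicMat; fun_prop
  refine Measurable.prodMk ?_ ?_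
  · exact measurable_pi_lambda _ fun j => (hr _ _).div (hr _ _)
  · exact measurable_pi_lambda _ fun p => measurable_pi_lambda _ fun j => (hp p _ _).div (hp p _ _)

/-- The set of vectors of bounded size whose first coordinate is in `(1, 2)` at the infinite place
and a unit at the finite places. -/
def pivotBox (S : Finset Nat.Primes) (n : ℕ) : Set (QSVec S (n + 1)) :=
  {v | (1 < v.1 0 ∧ ‖v.1‖ < 2) ∧ ∀ p : S, ‖v.2 p 0‖ = 1 ∧ ‖v.2 p‖ < 2}

lemma isOpen_pivotBox : IsOpen (pivotBox S n) := by
  refine IsOpen.inter (IsOpen.inter ?_ ?_) ?_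
  · exact isOpen_lt continuous_const ((continuous_apply 0).comp continuous_fst)
  · exact isOpen_lt continuous_fst.norm continuous_const
  · have : {v : QSVec S (n + 1) | ∀ p : S, ‖v.2 p 0‖ = 1 ∧ ‖v.2 p‖ < 2} =
        ⋂ p : S, ((fun v : QSVec S (n + 1) => v.2 p 0) ⁻¹' Metric.sphere 0 1 ∩
          {v | ‖v.2 p‖ < 2}) := by
      ext; simp
    change IsOpen {v : QSVec S (n + 1) | ∀ p : S, ‖v.2 p 0‖ = 1 ∧ ‖v.2 p‖ < 2}
    rw [this]
    exact isOpen_iInter_of_finite fun p => IsOpen.inter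
      ((IsUltrametricDist.isOpen_sphere 0 one_ne_zero).preimage (by fun_prop))
      (isOpen_lt (by fun_prop) continuous_const)

lemma volS_pivotBox_ne_zero : volS S (n + 1) (pivotBox S n) ≠ 0 := by
  refine (isOpen_pivotBox.measure_pos _ ⟨(fun _ => 3 / 2, fun _ _ => 1), ⟨?_, ?_⟩, fun p => ⟨?_, ?_⟩⟩).ne'
  · norm_num
  · rw [pi_norm_const]; norm_num
  · simp
  · rw [pi_norm_const]; norm_num

/-- A subset of `UL_{n+1}(ℚ_S)` fibered over a subset of `UL_n(ℚ_S)`. -/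
def liftSet (Ω : Set (UL S n)) : Set (UL S (n + 1)) :=
  {g | g.rows 0 ∈ pivotBox S n ∧ slopeVec g.rows ∈ unitBox S n ∧ coneMap (schurRows g.rows) ∈ Ω}

lemma measurableSet_liftSet {Ω : Set (UL S n)} (hΩ : MeasurableSet Ω) :
    MeasurableSet (liftSet Ω) := by
  have hrows : Measurable (UL.rows (S := S) (d := n + 1)) := measurableEmbedding_rows.measurable
  refine MeasurableSet.inter ?_ (MeasurableSet.inter ?_ ?_)
  · exact ((measurable_pi_apply 0).comp hrows) isOpen_pivotBox.measurableSet
  · exact (measurable_slopeVec.comp hrows) measurableSet_unitBox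
  · exact (measurable_coneMap.comp (measurable_schurRows.comp hrows)) hΩ

/-- The determinant is the pivot times the determinant of the Schur complement, so the hypotheses on
the pivot are exactly what keeps the quotient in the cone. -/
lemma schurRows_mem_cone {X : RowSpace S (n + 1) (n + 1)} (hX : X ∈ cone S (n + 1))
    (h0 : 0 < (X 0).1 0) (hdet : X.realMat.det ≤ (X 0).1 0) (hp : ∀ p : S, ‖(X 0).2 p 0‖ = 1) :
    schurRows X ∈ cone S n := by
  have hr := det_eq_mul_det_schur (A := X.realMat) h0.ne'
  change _ = (X 0).1 0 * _ at hr
  have hr' : (schur X.realMat).det = X.realMat.det / (X 0).1 0 := by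
    rw [hr, mul_div_cancel_left₀ _ h0.ne']
  refine ⟨⟨?_, ?_⟩, fun p => ?_⟩
  · change 0 < (schur X.realMat).det
    rw [hr']; exact div_pos hX.1.1 h0
  · change (schur X.realMat).det ≤ 1
    rw [hr']; exact (div_le_one h0).2 hdet
  · change ‖(schur (X.padicMat p)).det‖ = 1
    have hne : X.padicMat p 0 0 ≠ 0 := by
      rw [← norm_ne_zero_iff, show ‖X.padicMat p 0 0‖ = 1 from hp p]; exact one_ne_zero
    have h := congrArg norm (det_eq_mul_det_schur hne)
    rw [norm_mul, show ‖X.padicMat p 0 0‖ = 1 from hp p, one_mul, hX.2 p] at h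
    exact h.symm

lemma rows_mem_cone (g : UL S n) : g.rows ∈ cone S n :=
  ⟨⟨zero_lt_one.trans_eq g.det_realMat.symm, g.det_realMat.le⟩, fun p => g.norm_det_padicMat p⟩

/-- Block matrices in the stabilizer of the first basis vector leave the first row alone. First `γ`
brings the projected Schur complement into `Ω`; then an integral `k` brings the slope into the box
without disturbing it. -/
lemma exists_mul_mem_liftSet {Ω : Set (UL S n)}
    (hΩ : ∀ g : UL S n, ∃ γ : Matrix.SpecialLinearGroup (Fin n) (ZS S), diagSL S n γ * g ∈ Ω)
    (g : UL S (n + 1)) (hg : g.rows 0 ∈ pivotBox S n) :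
    ∃ γ : Matrix.SpecialLinearGroup (Fin (n + 1)) (ZS S),
      Pi.single 0 1 ᵥ* (γ : Matrix (Fin (n + 1)) (Fin (n + 1)) (ZS S)) = Pi.single 0 1 ∧
      diagSL S (n + 1) γ * g ∈ liftSet Ω := by
  obtain ⟨⟨hv1, hv2⟩, hvp⟩ := hg
  have hr0 : g.realMat 0 0 ≠ 0 := (zero_lt_one.trans hv1).ne'
  have hp0 : ∀ p, g.padicMat p 0 0 ≠ 0 := fun p => by
    rw [← norm_ne_zero_iff, show ‖g.padicMat p 0 0‖ = 1 from (hvp p).1]; exact one_ne_zero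
  have hcone : schurRows g.rows ∈ cone S n :=
    schurRows_mem_cone (rows_mem_cone g) (zero_lt_one.trans hv1)
      ((g.det_realMat.le).trans hv1.le) fun p => (hvp p).1
  obtain ⟨γ, hγ⟩ := hΩ (coneMap (schurRows g.rows))
  obtain ⟨k, hk, -⟩ := exists_unique_mem_unitBox (colMul (diagSL S n γ) (slopeVec g.rows))
  let δ : Matrix.SpecialLinearGroup (Fin (n + 1)) (ZS S) :=
    ⟨lowerBlock k γ, by rw [det_lowerBlock]; exact γ.2⟩
  have er : (diagSL S (n + 1) δ * g).realMat =
      lowerBlock (diagVec k).1 (diagSL S n γ).realMat * g.realMat := by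
    rw [realMat_mul]
    congr 1
    exact map_lowerBlock k _ (ZS.toReal S)
  have ep : ∀ p, (diagSL S (n + 1) δ * g).padicMat p =
      lowerBlock ((diagVec k).2 p) ((diagSL S n γ).padicMat p) * g.padicMat p := by
    intro p
    rw [padicMat_mul]
    congr 1
    exact map_lowerBlock k _ (ZS.toPadic S p)
  refine ⟨δ, ?_, ?_, ?_, ?_⟩
  · rw [Matrix.single_one_vecMul]; rfl
  · have e : (diagSL S (n + 1) δ * g).rows 0 = g.rows 0 := by
      refine Prod.ext ?_ (funext fun p => ?_)
      · change (diagSL S (n + 1) δ * g).realMat 0 = _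
        rw [er, lowerBlock_mul_zero]; rfl
      · change (diagSL S (n + 1) δ * g).padicMat p 0 = _
        rw [ep, lowerBlock_mul_zero]; rfl
    rw [e]
    exact ⟨⟨hv1, hv2⟩, hvp⟩
  · have e : slopeVec (diagSL S (n + 1) δ * g).rows =
        colMul (diagSL S n γ) (slopeVec g.rows) + diagVec k := by
      refine Prod.ext ?_ (funext fun p => ?_)
      · change slope (diagSL S (n + 1) δ * g).realMat = _
        rw [er, slope_lowerBlock_mul _ _ hr0]; rfl
      · change slope ((diagSL S (n + 1) δ * g).padicMat p) = _
        rw [ep, slope_lowerBlock_mul _ _ (hp0 p)]; rfl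
    rw [e]
    exact hk
  · have e : schurRows (diagSL S (n + 1) δ * g).rows =
        mulRows (diagSL S n γ) (schurRows g.rows) := by
      funext i
      refine Prod.ext ?_ (funext fun p => ?_)
      · change schur (diagSL S (n + 1) δ * g).realMat i = _
        rw [er, schur_lowerBlock_mul _ _ hr0]; rfl
      · change schur ((diagSL S (n + 1) δ * g).padicMat p) i = _
        rw [ep, schur_lowerBlock_mul _ _ (hp0 p)]; rfl
    rw [e, coneMap_mulRows hcone]
    exact hγ

/-- The normalising factor is homogeneous of degree `-1`, so the projection depends only on the ray
at the infinite place. -/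
lemma coneMap_congr {Y Z : RowSpace S n n} (hY : Y ∈ cone S n) (hZ : Z ∈ cone S n) {t : ℝ}
    (ht : 0 < t) (hr : Z.realMat = t • Y.realMat) (hp : ∀ p, Z.padicMat p = Y.padicMat p) :
    coneMap Z = coneMap Y := by
  refine UL.ext_mat ?_ fun p => ?_
  · rw [coneMap_realMat hZ, coneMap_realMat hY, hr]
    rcases Nat.eq_zero_or_pos n with rfl | hn
    · exact Subsingleton.elim _ _
    · rw [Matrix.det_smul, Fintype.card_fin, smul_smul,
        Real.mul_rpow (by positivity) hY.1.1.le, ← Real.rpow_natCast, ← Real.rpow_mul ht.le]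
      have : (n : ℝ) ≠ 0 := by positivity
      rw [show (n : ℝ) * -(1 / (n : ℝ)) = -1 by field_simp, Real.rpow_neg_one]
      congr 1
      field_simp
  · rw [coneMap_padicMat hZ, coneMap_padicMat hY, hp]

/-- The conditions of `liftSet` concern the projection of `X`, and they are transferred to `X`
itself. The two differ by a real factor `t ≥ 1`: slopes do not change, Schur complements stay on the
same ray, and norms only decrease on return to `X`. -/
lemma cone_liftSet_bounds {Ω : Set (UL S n)} {X : RowSpace S (n + 1) (n + 1)}
    (hX : X ∈ cone S (n + 1)) (h : coneMap X ∈ liftSet Ω) :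
    (0 < (X 0).1 0 ∧ ∀ p : S, ‖(X 0).2 p 0‖ = 1) ∧ ‖X 0‖ ≤ 2 ∧ ‖slopeVec X‖ ≤ 1 ∧
      schurRows X ∈ cone S n ∧ coneMap (schurRows X) ∈ Ω := by
  obtain ⟨⟨⟨hv1, hv2⟩, hvp⟩, hslope, hΩ⟩ := h
  set t : ℝ := X.realMat.det ^ (-(1 / (n + 1 : ℕ) : ℝ)) with ht
  have ht1 : 1 ≤ t := Real.one_le_rpow_of_pos_of_le_one_of_nonpos hX.1.1 hX.1.2 (by
    rw [neg_nonpos]; positivity)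
  have ht0 : 0 < t := zero_lt_one.trans_le ht1
  have er : (coneMap X).realMat = t • X.realMat := coneMap_realMat hX
  have ep : ∀ p, (coneMap X).padicMat p = X.padicMat p := coneMap_padicMat hX
  have hv1' : 1 < t * (X 0).1 0 := by
    have : ((coneMap X).rows 0).1 0 = (coneMap X).realMat 0 0 := rfl
    rw [this, er] at hv1
    exact hv1
  have hv2' : ‖t • (X 0).1‖ < 2 := by
    have : ((coneMap X).rows 0).1 = (coneMap X).realMat 0 := rfl
    rw [this, er] at hv2
    exact hv2
  have hvp' : ∀ p : S, ‖(X 0).2 p 0‖ = 1 ∧ ‖(X 0).2 p‖ < 2 := by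
    intro p
    have : ((coneMap X).rows 0).2 p = (coneMap X).padicMat p 0 := rfl
    have h := hvp p
    rw [this, ep] at h
    exact h
  have h0 : 0 < (X 0).1 0 := by
    by_contra hneg
    push Not at hneg
    linarith [mul_nonpos_of_nonneg_of_nonpos ht0.le hneg]
  have hdet : X.realMat.det ≤ (X 0).1 0 := by
    -- Here `t⁻¹` is the root of order `n + 1` of a determinant in `(0, 1]`, and `t⁻¹` is below the
    -- pivot of `X` because the pivot of the projection exceeds 1.
    have h1 : X.realMat.det ≤ t⁻¹ := by
      rw [ht, Real.rpow_neg hX.1.1.le, inv_inv]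
      calc X.realMat.det = X.realMat.det ^ (1 : ℝ) := (Real.rpow_one _).symm
        _ ≤ _ := Real.rpow_le_rpow_of_exponent_ge hX.1.1 hX.1.2 (by
          rw [div_le_one (by positivity)]
          push_cast
          linarith [(Nat.cast_nonneg n : (0 : ℝ) ≤ n)])
    refine h1.trans ?_
    rw [inv_le_iff_one_le_mul₀ ht0, mul_comm]
    exact hv1'.le
  have hcone : schurRows X ∈ cone S n := schurRows_mem_cone hX h0 hdet fun p => (hvp' p).1
  have hcone' : schurRows (coneMap X).rows ∈ cone S n :=
    schurRows_mem_cone (rows_mem_cone _) (zero_lt_one.trans hv1)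
      ((coneMap X).det_realMat.le.trans hv1.le) fun p => (hvp p).1
  refine ⟨⟨h0, fun p => (hvp' p).1⟩, ?_, ?_, hcone, ?_⟩
  · refine max_le ?_ ((pi_norm_le_iff_of_nonneg zero_le_two).2 fun p => (hvp' p).2.le)
    rw [norm_smul, Real.norm_of_nonneg ht0.le] at hv2'
    exact (le_mul_of_one_le_left (norm_nonneg _) ht1).trans hv2'.le
  · have e : slopeVec (coneMap X).rows = slopeVec X := by
      refine Prod.ext ?_ (funext fun p => ?_)
      · change slope (coneMap X).realMat = slope X.realMat
        rw [er, slope_smul _ ht0.ne']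
      · change slope ((coneMap X).padicMat p) = slope (X.padicMat p)
        rw [ep]
    rw [← e]
    exact norm_le_one_of_mem_unitBox hslope
  · rw [← coneMap_congr hcone hcone' ht0]
    · exact hΩ
    · change schur (coneMap X).realMat = t • schur X.realMat
      rw [er, schur_smul _ ht0.ne']
    · intro p
      change schur ((coneMap X).padicMat p) = schur (X.padicMat p)
      rw [ep]

/-- The splitting of a matrix into its first column and the remaining columns. -/
def splitColumn (S : Finset Nat.Primes) (n : ℕ) :
    RowSpace S n (n + 1) ≃ₜ+ QSVec S n × RowSpace S n n where
  toFun R := ((fun i => (R i).1 0, fun p i => (R i).2 p 0),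
    fun i => (fun j => (R i).1 j.succ, fun p j => (R i).2 p j.succ))
  invFun x i := (Fin.cons (x.1.1 i) (x.2 i).1, fun p => Fin.cons (x.1.2 p i) ((x.2 i).2 p))
  left_inv R := by
    funext i
    refine Prod.ext ?_ (funext fun p => ?_) <;>
    · funext j
      refine Fin.cases rfl (fun j => rfl) j
  right_inv x := rfl
  map_add' X Y := rfl
  continuous_toFun := by fun_prop
  continuous_invFun := by
    refine continuous_pi fun i => Continuous.prodMk ?_ (continuous_pi fun p => ?_)
    · refine continuous_pi fun j => ?_
      refine Fin.cases ?_ (fun j => ?_) j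
      · simp only [Fin.cons_zero]; fun_prop
      · simp only [Fin.cons_succ]; fun_prop
    · refine continuous_pi fun j => ?_
      refine Fin.cases ?_ (fun j => ?_) j
      · simp only [Fin.cons_zero]; fun_prop
      · simp only [Fin.cons_succ]; fun_prop

instance secondCountable_RowSpace (k l : ℕ) : SecondCountableTopology (RowSpace S k l) :=
  inferInstanceAs (SecondCountableTopology (Fin k → QSVec S l))

instance borelSpace_prod_RowSpace : BorelSpace (QSVec S n × RowSpace S n n) := Prod.borelSpace

lemma volRows_splitColumn_lt_top {C : Set (RowSpace S n n)} (hC : MeasurableSet C)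
    (hfin : volRows S n n C ≠ ∞) :
    volRows S n (n + 1) (splitColumn S n ⁻¹' (Metric.closedBall 0 2 ×ˢ C)) ≠ ∞ := by
  have hH : ((volRows S n (n + 1)).map (splitColumn S n)).IsAddHaarMeasure :=
    (splitColumn S n).isAddHaarMeasure_map _
  have : ((volS S n).prod (volRows S n n)).IsAddHaarMeasure := inferInstance
  have hc := Measure.isAddLeftInvariant_eq_smul ((volRows S n (n + 1)).map (splitColumn S n))
    ((volS S n).prod (volRows S n n))
  have hm : Measurable (splitColumn S n) := (splitColumn S n).continuous.measurable
  rw [← Measure.map_apply hm (Metric.isClosed_closedBall.measurableSet.prod hC), hc,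
    Measure.smul_apply, Measure.prod_prod]
  refine ENNReal.mul_ne_top ENNReal.coe_ne_top (ENNReal.mul_ne_top ?_ hfin)
  exact (isCompact_closedBall _ _).measure_lt_top.ne

lemma transpose_lowerBlock_vecMul {K : Type*} [Field K] (k v : Fin n → K) (r : K) :
    (Fin.cons r v : Fin (n + 1) → K) ᵥ* (lowerBlock k 1)ᵀ = Fin.cons r (v + r • k) := by
  rw [Matrix.vecMul_transpose]
  funext j
  refine Fin.cases ?_ (fun j => ?_) j
  · simp [Matrix.mulVec, dotProduct, Fin.sum_univ_succ, lowerBlock]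
  · simp [Matrix.mulVec, dotProduct, Fin.sum_univ_succ, lowerBlock, Matrix.one_apply, mul_comm,
      add_comm]

/-- The unipotent matrix that clears the first row of a matrix with first row `w`. -/
def clearRow (w : QSVec S (n + 1)) : UL S (n + 1) :=
  UL.ofMat (lowerBlock (fun j => -(w.1 j.succ / w.1 0)) 1)ᵀ
    (by rw [Matrix.det_transpose, det_lowerBlock, Matrix.det_one])
    (fun p => (lowerBlock (fun j => -(w.2 p j.succ / w.2 p 0)) 1)ᵀ)
    (fun p => by rw [Matrix.det_transpose, det_lowerBlock, Matrix.det_one, norm_one])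

lemma splitColumn_rowsMul_clearRow (w : QSVec S (n + 1)) (R : RowSpace S n (n + 1)) :
    splitColumn S n (rowsMul R (clearRow w)) =
      ((splitColumn S n R).1, schurRows (Fin.cons w R : RowSpace S (n + 1) (n + 1))) := by
  have hr : ∀ i, (rowsMul R (clearRow w) i).1 = (Fin.cons ((R i).1 0) (fun j => (R i).1 j.succ +
      (R i).1 0 * -(w.1 j.succ / w.1 0)) : Fin (n + 1) → ℝ) := by
    intro i
    have := transpose_lowerBlock_vecMul (fun j => -(w.1 j.succ / w.1 0)) (fun j => (R i).1 j.succ)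
      ((R i).1 0)
    rw [show (Fin.cons ((R i).1 0) fun j => (R i).1 j.succ : Fin (n + 1) → ℝ) = (R i).1 from
      Fin.cons_self_tail _] at this
    exact this
  have hp : ∀ i p, (rowsMul R (clearRow w) i).2 p = (Fin.cons ((R i).2 p 0)
      (fun j => (R i).2 p j.succ + (R i).2 p 0 * -(w.2 p j.succ / w.2 p 0)) :
        Fin (n + 1) → ℚ_[p.1.1]) := by
    intro i p
    have := transpose_lowerBlock_vecMul (fun j => -(w.2 p j.succ / w.2 p 0))
      (fun j => (R i).2 p j.succ) ((R i).2 p 0)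
    rw [show (Fin.cons ((R i).2 p 0) fun j => (R i).2 p j.succ : Fin (n + 1) → ℚ_[p.1.1]) =
      (R i).2 p from Fin.cons_self_tail _] at this
    exact this
  refine Prod.ext (Prod.ext (funext fun i => ?_) (funext fun p => funext fun i => ?_))
    (funext fun i => Prod.ext (funext fun j => ?_) (funext fun p => funext fun j => ?_))
  · change (rowsMul R (clearRow w) i).1 0 = (R i).1 0
    rw [hr, Fin.cons_zero]
  · change (rowsMul R (clearRow w) i).2 p 0 = (R i).2 p 0
    rw [hp, Fin.cons_zero]
  · change (rowsMul R (clearRow w) i).1 j.succ = (R i).1 j.succ - (R i).1 0 / w.1 0 * w.1 j.succ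
    rw [hr, Fin.cons_succ]
    ring
  · change (rowsMul R (clearRow w) i).2 p j.succ =
      (R i).2 p j.succ - (R i).2 p 0 / w.2 p 0 * w.2 p j.succ
    rw [hp, Fin.cons_succ]
    ring

/-- Fubini over the first row `w`, which ranges in a bounded set. It suffices to bound the volume of
the possible lower rows by a constant independent of `w`. -/
theorem coneMeasure_liftSet_ne_top {Ω : Set (UL S n)} (hΩ : MeasurableSet Ω)
    (hfin : coneMeasure S n Ω ≠ ∞) : coneMeasure S (n + 1) (liftSet Ω) ≠ ∞ := by
  have happly : ∀ {k : ℕ} {U : Set (UL S k)}, MeasurableSet U →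
      coneMeasure S k U = volRows S k k (coneMap ⁻¹' U ∩ cone S k) := by
    intro k U hU
    unfold coneMeasure
    rw [Measure.map_apply measurable_coneMap hU, Measure.restrict_apply (measurable_coneMap hU)]
  have hL := measurableSet_liftSet hΩ
  rw [happly hΩ] at hfin
  rw [happly hL]
  set C := coneMap ⁻¹' Ω ∩ cone S n with hCdef
  have hC : MeasurableSet C := (measurable_coneMap hΩ).inter measurableSet_cone
  set E := coneMap ⁻¹' liftSet Ω ∩ cone S (n + 1) with hEdef
  have hE : MeasurableSet E := (measurable_coneMap hL).inter measurableSet_cone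
  set K := volRows S n (n + 1) (splitColumn S n ⁻¹' (Metric.closedBall 0 2 ×ˢ C)) with hK
  have hKfin : K ≠ ∞ := volRows_splitColumn_lt_top hC hfin
  have hT : MeasurableSet (splitColumn S n ⁻¹' (Metric.closedBall 0 2 ×ˢ C)) :=
    (splitColumn S n).continuous.measurable (Metric.isClosed_closedBall.measurableSet.prod hC)
  have hfiber : ∀ w : QSVec S (n + 1), volRows S n (n + 1)
      {R | (Fin.cons w R : RowSpace S (n + 1) (n + 1)) ∈ E} ≤
        (Metric.closedBall (0 : QSVec S (n + 1)) 2).indicator (fun _ => K) w := by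
    intro w
    by_cases hw : w ∈ Metric.closedBall (0 : QSVec S (n + 1)) 2
    -- Right multiplication by a unipotent matrix preserves the volume and replaces the lower rows
    -- by their first column and the Schur complement. The column is bounded, being slope times
    -- pivot, and the Schur complement lies in `C`, of finite volume by hypothesis.
    · rw [Set.indicator_of_mem hw, hK, ← (measurePreserving_rowsMul n (clearRow w)).measure_preimage
        hT.nullMeasurableSet]
      refine measure_mono fun R hR => ?_
      obtain ⟨⟨h0, hp0⟩, hX0, hslope, hcone, hmem⟩ := cone_liftSet_bounds hR.2 hR.1
      rw [Set.mem_preimage, Set.mem_preimage, splitColumn_rowsMul_clearRow]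
      refine ⟨?_, hmem, hcone⟩
      change 0 < w.1 0 at h0
      change ∀ p : S, ‖w.2 p 0‖ = 1 at hp0
      have hw2 : ‖w‖ ≤ 2 := hX0
      rw [mem_closedBall_zero_iff]
      refine max_le ((pi_norm_le_iff_of_nonneg zero_le_two).2 fun i => ?_)
        ((pi_norm_le_iff_of_nonneg zero_le_two).2 fun p =>
          (pi_norm_le_iff_of_nonneg zero_le_two).2 fun i => ?_)
      · change ‖(R i).1 0‖ ≤ 2
        have h1 : ‖(R i).1 0 / w.1 0‖ ≤ 1 :=
          ((norm_le_pi_norm (slopeVec (Fin.cons w R : RowSpace S (n + 1) (n + 1))).1 i).trans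
            (norm_fst_le _)).trans hslope
        have h2 : ‖w.1 0‖ ≤ 2 := ((norm_le_pi_norm w.1 0).trans (norm_fst_le w)).trans hw2
        have e : (R i).1 0 = (R i).1 0 / w.1 0 * w.1 0 := (div_mul_cancel₀ _ h0.ne').symm
        rw [e, norm_mul]
        exact (mul_le_of_le_one_left (norm_nonneg _) h1).trans h2
      · change ‖(R i).2 p 0‖ ≤ 2
        have h1 : ‖(R i).2 p 0 / w.2 p 0‖ ≤ 1 :=
          (((norm_le_pi_norm ((slopeVec (Fin.cons w R : RowSpace S (n + 1) (n + 1))).2 p) i).trans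
            (norm_le_pi_norm _ p)).trans (norm_snd_le _)).trans hslope
        rw [norm_div, hp0 p, div_one] at h1
        exact h1.trans one_le_two
    · rw [Set.indicator_of_notMem hw]
      refine le_of_eq ?_
      convert measure_empty (μ := volRows S n (n + 1))
      refine Set.eq_empty_of_forall_notMem fun R hR => hw ?_
      rw [mem_closedBall_zero_iff]
      exact (cone_liftSet_bounds hR.2 hR.1).2.1
  have hmp := (measurePreserving_piFinSuccAbove (fun _ : Fin (n + 1) => volS S (n + 1)) 0).symm
  have : SigmaFinite (Measure.pi fun _ : Fin n => volS S (n + 1)) := Measure.pi.sigmaFinite _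
  have e1 : volRows S (n + 1) (n + 1) E = ∫⁻ w, volRows S n (n + 1)
      {R | (Fin.cons w R : RowSpace S (n + 1) (n + 1)) ∈ E} ∂(volS S (n + 1)) := by
    unfold volRows
    rw [← hmp.measure_preimage hE.nullMeasurableSet, Measure.prod_apply (hmp.measurable hE)]
    refine lintegral_congr fun w => ?_
    congr 1
    ext R
    have e : (MeasurableEquiv.piFinSuccAbove (fun _ : Fin (n + 1) => QSVec S (n + 1)) 0).symm (w, R)
        = Fin.cons w R := Fin.insertNth_zero' w R
    change (MeasurableEquiv.piFinSuccAbove (fun _ : Fin (n + 1) => QSVec S (n + 1)) 0).symm (w, R) ∈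
      E ↔ _
    rw [e]
    rfl
  rw [e1]
  refine ne_top_of_le_ne_top ?_ (lintegral_mono hfiber)
  rw [lintegral_indicator_const Metric.isClosed_closedBall.measurableSet]
  exact ENNReal.mul_ne_top hKfin (isCompact_closedBall _ _).measure_lt_top.ne

lemma coneMeasure_one_ne_top : coneMeasure S 1 Set.univ ≠ ∞ := by
  unfold coneMeasure
  rw [Measure.map_apply measurable_coneMap MeasurableSet.univ, Set.preimage_univ,
    Measure.restrict_apply_univ]
  refine ne_top_of_le_ne_top ?_ (measure_mono (t := Metric.closedBall 0 1) fun X hX => ?_)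
  · exact (isCompact_closedBall _ _).measure_lt_top.ne
  rw [mem_closedBall_zero_iff]
  obtain ⟨⟨h1, h2⟩, h3⟩ := hX
  rw [Matrix.det_fin_one] at h1 h2
  simp only [Matrix.det_fin_one] at h3
  refine (pi_norm_le_iff_of_nonneg zero_le_one).2 fun i => max_le
    ((pi_norm_le_iff_of_nonneg zero_le_one).2 fun j => ?_)
    ((pi_norm_le_iff_of_nonneg zero_le_one).2 fun p =>
      (pi_norm_le_iff_of_nonneg zero_le_one).2 fun j => ?_)
  · rw [Subsingleton.elim i 0, Subsingleton.elim j 0]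
    exact (Real.norm_of_nonneg h1.le).trans_le h2
  · rw [Subsingleton.elim i 0, Subsingleton.elim j 0]
    exact (h3 p).le

/-- The existence of a set of finite measure that meets every orbit passes from `n` to `n + 1`, and
gives the finiteness of the covolume and the mean value formula. -/
theorem siegel_of_liftSet {m : ℕ} {Ω : Set (UL S (m + 1))} (hΩm : MeasurableSet Ω)
    (hΩ : ∀ g, ∃ γ : Matrix.SpecialLinearGroup (Fin (m + 1)) (ZS S), diagSL S (m + 1) γ * g ∈ Ω)
    (hfin : coneMeasure S (m + 1) Ω ≠ ∞) (μ : Measure (UL S (m + 2))) [μ.IsHaarMeasure]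
    {F : Set (UL S (m + 2))} (hFm : MeasurableSet F)
    (hF : ∀ x : UL S (m + 2), ∃! γ : ULZ S (m + 2), γ • x ∈ F) :
    μ F ≠ ∞ ∧ orbitMeasure μ F {k | k ≠ 0} = μ F • volS S (m + 2) := by
  obtain ⟨c₀, hc₀, hcone⟩ := exists_coneMeasure_eq_smul (by omega) μ
  have h1 := coneMeasure_liftSet_ne_top hΩm hfin
  have hμ : μ (liftSet Ω) ≠ ∞ := by
    intro htop
    rw [hcone, Measure.smul_apply, htop] at h1
    apply h1
    rw [ENNReal.smul_def, smul_eq_mul]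
    exact ENNReal.mul_top (ENNReal.coe_ne_zero.2 hc₀)
  obtain ⟨c', hc'⟩ := exists_orbitMeasure_eq μ hFm hF orbitStable_primitiveOrbit
    zero_notMem_primitiveOrbit
  obtain ⟨c, hc⟩ := exists_orbitMeasure_eq μ hFm hF (O := {k | k ≠ 0}) orbitStable_nonzero
    (fun h => h rfl)
  have h2 := orbitMeasure_primitive_le μ hFm hF (isOpen_pivotBox (S := S)).measurableSet
    (measurableSet_liftSet hΩm) (exists_mul_mem_liftSet hΩ)
  -- The test set `pivotBox` has positive volume, so an infinite constant would give it infinite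
  -- mass, against the bound by the measure of `liftSet Ω`.
  have h3 : c' ≠ ∞ := by
    intro htop
    rw [hc', Measure.smul_apply, htop, smul_eq_mul, ENNReal.top_mul volS_pivotBox_ne_zero,
      top_le_iff] at h2
    exact hμ h2
  have h4 := covolume_eq_of_orbitMeasure (by omega) μ hc (orbitMeasure_nonzero_lt_top μ hc hc' h3)
  exact ⟨h4.1, by rw [hc, h4.2]⟩

/-- In dimension one the cone itself is bounded and the whole group serves. In the next dimension a
fundamental domain serves, because the preceding set has just shown its measure to be finite. -/
theorem exists_finite_covering (S : Finset Nat.Primes) (m : ℕ) : ∃ Ω : Set (UL S (m + 1)),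
    MeasurableSet Ω ∧ (∀ g, ∃ γ : Matrix.SpecialLinearGroup (Fin (m + 1)) (ZS S),
      diagSL S (m + 1) γ * g ∈ Ω) ∧ coneMeasure S (m + 1) Ω ≠ ∞ := by
  induction m with
  | zero => exact ⟨Set.univ, MeasurableSet.univ, fun _ => ⟨1, trivial⟩, coneMeasure_one_ne_top⟩
  | succ m ih =>
    obtain ⟨Ω, hΩm, hΩ, hfin⟩ := ih
    obtain ⟨F, hFm, hF⟩ := exists_fundamentalDomain_ULZ S (m + 2)
    let μ : Measure (UL S (m + 2)) := Measure.haar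
    obtain ⟨c, -, hcone⟩ := exists_coneMeasure_eq_smul (by omega) μ
    refine ⟨F, hFm, fun g => ?_, ?_⟩
    · obtain ⟨⟨_, γ, rfl⟩, hγ, -⟩ := hF g
      exact ⟨γ, hγ⟩
    · rw [hcone, Measure.smul_apply, ENNReal.smul_def, smul_eq_mul]
      exact ENNReal.mul_ne_top ENNReal.coe_ne_top (siegel_of_liftSet hΩm hΩ hfin μ hFm hF).1

/-- The mean value formula for nonzero lattice vectors. -/
theorem siegel_formula {m : ℕ} (μ : Measure (UL S (m + 2))) [μ.IsHaarMeasure]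
    {F : Set (UL S (m + 2))} (hFm : MeasurableSet F)
    (hF : ∀ x : UL S (m + 2), ∃! γ : ULZ S (m + 2), γ • x ∈ F) :
    μ F ≠ ∞ ∧ orbitMeasure μ F {k | k ≠ 0} = μ F • volS S (m + 2) := by
  obtain ⟨Ω, hΩm, hΩ, hfin⟩ := exists_finite_covering S m
  exact siegel_of_liftSet hΩm hΩ hfin μ hFm hF

end Schur

/-! ### Unfolding on the space of affine lattices -/

section Affine

variable {S : Finset Nat.Primes} {d : ℕ}

/-- The affine group as a measurable product. -/
def AUL.measurableEquiv (S : Finset Nat.Primes) (d : ℕ) : QSVec S d × UL S d ≃ᵐ AUL S d where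
  toFun x := ⟨x.1, x.2⟩
  invFun a := (a.vec, a.lin)
  left_inv _ := rfl
  right_inv _ := rfl
  measurable_toFun := measurable_comap_iff.2 measurable_id
  measurable_invFun := comap_measurable _

lemma measurable_AUL_mk : Measurable fun x : QSVec S d × UL S d => (⟨x.1, x.2⟩ : AUL S d) :=
  (AUL.measurableEquiv S d).measurable

lemma measurable_AUL_vec : Measurable (AUL.vec : AUL S d → QSVec S d) :=
  measurable_fst.comp (AUL.measurableEquiv S d).symm.measurable

lemma measurable_AUL_lin : Measurable (AUL.lin : AUL S d → UL S d) :=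
  measurable_snd.comp (AUL.measurableEquiv S d).symm.measurable

lemma AUL.vec_mul (a b : AUL S d) : (a * b).vec = b.vec + rowMul a.vec b.lin := rfl

lemma AUL.lin_mul (a b : AUL S d) : (a * b).lin = a.lin * b.lin := rfl

lemma measurable_AUL_mul_left (c : AUL S d) : Measurable fun a : AUL S d => c * a := by
  have h : Measurable fun a : AUL S d => (a.vec + rowMul c.vec a.lin, c.lin * a.lin) :=
    (measurable_AUL_vec.add ((measurable_rowMul_const c.vec).comp measurable_AUL_lin)).prodMk
      ((measurable_const_mul c.lin).comp measurable_AUL_lin)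
  exact measurable_AUL_mk.comp h

instance : MeasurableConstSMul (AULZ S d) (AUL S d) where
  measurable_const_smul c := measurable_AUL_mul_left c.1

instance : Countable (AULZ S d) := by
  have h : ∀ c : AULZ S d, ∃ k : Fin d → ZS S, c.1.vec = diagVec k := fun c => c.2.1
  choose φ hφ using h
  refine Function.Injective.countable (f := fun c : AULZ S d =>
    (φ c, (⟨c.1.lin, c.2.2⟩ : ULZ S d))) fun a b h => Subtype.ext (AUL.ext ?_ ?_)
  · rw [hφ a, hφ b]
    exact congrArg diagVec (Prod.ext_iff.1 h).1
  · exact congrArg Subtype.val (Prod.ext_iff.1 h).2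

/-- The product measure on the affine group. -/
def affHaar (ν : Measure (UL S d)) : Measure (AUL S d) :=
  ((volS S d).prod ν).map fun x => (⟨x.1, x.2⟩ : AUL S d)

lemma lintegral_affHaar (ν : Measure (UL S d)) [SFinite ν] {f : AUL S d → ℝ≥0∞}
    (hf : Measurable f) :
    ∫⁻ a, f a ∂(affHaar ν) = ∫⁻ g, ∫⁻ v, f ⟨v, g⟩ ∂(volS S d) ∂ν := by
  unfold affHaar
  have hm : Measurable fun x : QSVec S d × UL S d => f ⟨x.1, x.2⟩ := hf.comp measurable_AUL_mk
  rw [lintegral_map hf measurable_AUL_mk, lintegral_prod_symm' _ hm]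

lemma map_mul_left_affHaar (ν : Measure (UL S d)) [SFinite ν] [ν.IsMulLeftInvariant]
    (c : AUL S d) : (affHaar ν).map (fun a => c * a) = affHaar ν := by
  refine Measure.ext_of_lintegral _ fun f hf => ?_
  have hm := measurable_AUL_mul_left c
  have hcf : Measurable fun a => f (c * a) := hf.comp hm
  rw [lintegral_map hf hm, lintegral_affHaar ν hcf, lintegral_affHaar ν hf]
  rw [← lintegral_mul_left_eq_self (fun g => ∫⁻ v, f ⟨v, g⟩ ∂(volS S d)) c.lin]
  refine lintegral_congr fun g => ?_
  exact lintegral_add_right_eq_self (μ := volS S d) (fun v => f ⟨v, c.lin * g⟩) (rowMul c.vec g)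

lemma smulInvariant_affHaar (ν : Measure (UL S d)) [SFinite ν] [ν.IsMulLeftInvariant] :
    SMulInvariantMeasure (AULZ S d) (AUL S d) (affHaar ν) where
  measure_preimage_smul c A hA := by
    change affHaar ν ((fun a => c.1 * a) ⁻¹' A) = _
    rw [← Measure.map_apply (measurable_AUL_mul_left c.1) hA, map_mul_left_affHaar]

/-- A fundamental domain for the affine group, fibered over one for the linear group. -/
def affDomain (F : Set (UL S d)) : Set (AUL S d) :=
  {a | a.lin ∈ F ∧ rowMul a.vec a.lin⁻¹ ∈ unitBox S d}

lemma measurableSet_affDomain {F : Set (UL S d)} (hF : MeasurableSet F) :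
    MeasurableSet (affDomain F) := by
  refine (measurable_AUL_lin hF).inter ?_
  have h : Measurable fun a : AUL S d => rowMul a.vec a.lin⁻¹ :=
    measurable_rowMul.comp (measurable_AUL_vec.prodMk (measurable_AUL_lin.inv))
  exact h measurableSet_unitBox

/-- The domain `F` determines the linear part of `c`. After the vector is pulled back by the
resulting linear part, the translation part acts by adding an integral vector, which the box
determines. -/
lemma exists_unique_smul_mem_affDomain {F : Set (UL S d)}
    (hF : ∀ x : UL S d, ∃! γ : ULZ S d, γ • x ∈ F) (a : AUL S d) :
    ∃! c : AULZ S d, c • a ∈ affDomain F := by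
  have key : ∀ (c : AUL S d) (k : Fin d → ZS S) (γ : Matrix.SpecialLinearGroup (Fin d) (ZS S)),
      c.vec = rowMul (diagVec k) (diagSL S d γ) → c.lin = diagSL S d γ →
      rowMul (c * a).vec (c * a).lin⁻¹ =
        rowMul a.vec (diagSL S d γ * a.lin)⁻¹ + diagVec k := by
    intro c k γ h1 h2
    rw [AUL.vec_mul, AUL.lin_mul, h1, h2, ← rowMul_mul, rowMul_add, ← rowMul_mul, mul_inv_cancel,
      rowMul_one]
  obtain ⟨⟨γ₀, γ, rfl⟩, hγ, huniq⟩ := hF a.lin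
  obtain ⟨k, hk, hkuniq⟩ := exists_unique_mem_unitBox (rowMul a.vec (diagSL S d γ * a.lin)⁻¹)
  refine ⟨⟨⟨rowMul (diagVec k) (diagSL S d γ), diagSL S d γ⟩, ⟨_, rowMul_diag k γ⟩, γ, rfl⟩,
    ⟨hγ, ?_⟩, ?_⟩
  · change rowMul (_ * a).vec (_ * a).lin⁻¹ ∈ _
    rw [key _ k γ rfl rfl]
    exact hk
  · rintro ⟨c, ⟨l, hl⟩, δ, hδ⟩ ⟨h1, h2⟩
    have e1 : c.lin = diagSL S d γ := by
      have := huniq ⟨c.lin, δ, hδ⟩ h1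
      exact congrArg Subtype.val this
    have e2 : c.vec = rowMul (diagVec (l ᵥ* ((γ⁻¹ : Matrix.SpecialLinearGroup (Fin d) (ZS S)) :
        Matrix (Fin d) (Fin d) (ZS S)))) (diagSL S d γ) := by
      rw [← rowMul_diag, ← rowMul_mul, ← map_mul, inv_mul_cancel, map_one, rowMul_one, hl]
    change rowMul (c * a).vec (c * a).lin⁻¹ ∈ unitBox S d at h2
    rw [key c _ γ e2 e1] at h2
    have e3 := hkuniq _ h2
    refine Subtype.ext (AUL.ext ?_ e1)
    change c.vec = rowMul (diagVec k) (diagSL S d γ)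
    rw [e2, e3]

lemma setLIntegral_affDomain (ν : Measure (UL S d)) [SFinite ν] {F : Set (UL S d)}
    (hF : MeasurableSet F) {f : AUL S d → ℝ≥0∞} (hf : Measurable f) :
    ∫⁻ a in affDomain F, f a ∂(affHaar ν) =
      ∫⁻ g in F, ∫⁻ u in unitBox S d, f ⟨rowMul u g, g⟩ ∂(volS S d) ∂ν := by
  have hD := measurableSet_affDomain hF
  rw [← lintegral_indicator hD, lintegral_affHaar ν (hf.indicator hD), ← lintegral_indicator hF]
  refine lintegral_congr fun g => ?_
  have hm : Measurable fun v : QSVec S d => (affDomain F).indicator f ⟨v, g⟩ :=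
    (hf.indicator hD).comp (measurable_AUL_mk.comp (measurable_id.prodMk measurable_const))
  rw [← (measurePreserving_rowMul g).lintegral_comp hm]
  have hmem : ∀ u : QSVec S d, (⟨rowMul u g, g⟩ : AUL S d) ∈ affDomain F ↔
      g ∈ F ∧ u ∈ unitBox S d := by
    intro u
    change g ∈ F ∧ rowMul (rowMul u g) g⁻¹ ∈ unitBox S d ↔ _
    rw [← rowMul_mul, mul_inv_cancel, rowMul_one]
  by_cases hg : g ∈ F
  · rw [Set.indicator_of_mem hg, ← lintegral_indicator measurableSet_unitBox]
    refine lintegral_congr fun u => ?_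
    by_cases hu : u ∈ unitBox S d
    · rw [Set.indicator_of_mem hu, Set.indicator_of_mem ((hmem u).2 ⟨hg, hu⟩)]
    · rw [Set.indicator_of_notMem hu, Set.indicator_of_notMem fun h => hu ((hmem u).1 h).2]
  · rw [Set.indicator_of_notMem hg]
    have : ∀ u : QSVec S d, (affDomain F).indicator f ⟨rowMul u g, g⟩ = 0 := fun u =>
      Set.indicator_of_notMem (fun h => hg ((hmem u).1 h).1) _
    simp only [this, lintegral_zero]

/-- The coset of an element of the affine group. -/
def AUL.coset (a : AUL S d) : AffSpace S d := Quotient.mk (QuotientGroup.rightRel (AULZ S d)) a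

lemma measurable_coset : Measurable (AUL.coset : AUL S d → AffSpace S d) := measurable_quot_mk

lemma measurable_AffSpace_iff {β : Type*} [MeasurableSpace β] {Φ : AffSpace S d → β} :
    Measurable Φ ↔ Measurable fun a : AUL S d => Φ a.coset := measurable_from_quotient

lemma coset_smul (c : AULZ S d) (a : AUL S d) : (c • a).coset = a.coset :=
  Quotient.sound ⟨c, rfl⟩

/-- The definition uses an arbitrary chosen fundamental domain; invariance allows it to be replaced
by the fibred one, on which the integral is explicit. -/
lemma lintegral_quotientMeasure (ν : Measure (UL S d)) [SFinite ν] [ν.IsMulLeftInvariant]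
    {F : Set (UL S d)} (hFm : MeasurableSet F) (hF : ∀ x : UL S d, ∃! γ : ULZ S d, γ • x ∈ F)
    {Φ : AffSpace S d → ℝ≥0∞} (hΦ : Measurable Φ) :
    ∫⁻ x, Φ x ∂(quotientMeasure (AULZ S d) (affHaar ν)) =
      ∫⁻ g in F, ∫⁻ u in unitBox S d, Φ (AUL.coset ⟨rowMul u g, g⟩) ∂(volS S d) ∂ν := by
  have := smulInvariant_affHaar ν
  have hD : IsFundamentalDomain (AULZ S d) (affDomain F) (affHaar ν) :=
    IsFundamentalDomain.mk' (measurableSet_affDomain hFm).nullMeasurableSet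
      (exists_unique_smul_mem_affDomain hF)
  have h : HasFundamentalDomain (AULZ S d) (AUL S d) (affHaar ν) := ⟨⟨_, hD⟩⟩
  have hΦ' : Measurable fun a : AUL S d => Φ a.coset := hΦ.comp measurable_coset
  unfold quotientMeasure
  rw [dif_pos h, ← setLIntegral_affDomain ν hFm hΦ']
  refine (lintegral_map hΦ measurable_coset).trans ?_
  exact h.ExistsIsFundamentalDomain.choose_spec.setLIntegral_eq hD (fun a => Φ a.coset)
    fun c a => by rw [coset_smul]

/-- Mean value of a function on the space of affine lattices. -/
theorem lintegral_affMeasure {m : ℕ} (μ : Measure (UL S (m + 2))) [μ.IsHaarMeasure] :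
    ∃ (ν : Measure (UL S (m + 2))) (F : Set (UL S (m + 2))), SFinite ν ∧ ν F = 1 ∧
      orbitMeasure ν F {k | k ≠ 0} = volS S (m + 2) ∧
      ∀ Φ : AffSpace S (m + 2) → ℝ≥0∞, Measurable Φ → ∫⁻ x, Φ x ∂(affMeasure μ) =
        ∫⁻ g in F, ∫⁻ u in unitBox S (m + 2), Φ (AUL.coset ⟨rowMul u g, g⟩) ∂(volS S (m + 2)) ∂ν := by
  obtain ⟨F, hFm, hF⟩ := exists_fundamentalDomain_ULZ S (m + 2)
  obtain ⟨hfin, -⟩ := siegel_formula μ hFm hF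
  have hdom := isFundamentalDomain_of_strict (μ := μ) hFm hF
  have hcov : covolume (ULZ S (m + 2)) (UL S (m + 2)) μ = μ F := hdom.covolume_eq_volume μ
  have hne : μ F ≠ 0 := hdom.measure_ne_zero (NeZero.ne μ)
  have hnorm : normalizedHaar μ = (μ F)⁻¹ • μ := by unfold normalizedHaar; rw [hcov]
  have hHaar : (normalizedHaar μ).IsHaarMeasure := by
    rw [hnorm]
    exact Measure.IsHaarMeasure.smul μ (ENNReal.inv_ne_zero.2 hfin) (ENNReal.inv_ne_top.2 hne)
  have hone : normalizedHaar μ F = 1 := by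
    rw [hnorm, Measure.smul_apply, smul_eq_mul, ENNReal.inv_mul_cancel hne hfin]
  -- The finite covolume just found makes the normalised measure a Haar measure again, so the mean
  -- value formula applies to it, with constant one.
  have hsiegel := (siegel_formula (normalizedHaar μ) hFm hF).2
  rw [hone, one_smul] at hsiegel
  exact ⟨normalizedHaar μ, F, inferInstance, hone, hsiegel, fun Φ hΦ =>
    lintegral_quotientMeasure (normalizedHaar μ) hFm hF hΦ⟩

theorem isProbabilityMeasure_affMeasure {m : ℕ} (μ : Measure (UL S (m + 2))) [μ.IsHaarMeasure] :
    IsProbabilityMeasure (affMeasure μ) := by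
  obtain ⟨ν, F, -, hone, -, h⟩ := lintegral_affMeasure μ
  refine ⟨?_⟩
  rw [← lintegral_one, h _ measurable_const]
  simp [volS_unitBox, hone]

lemma latticePoint_injective (a : AUL S d) : Function.Injective (latticePoint a) := by
  intro k l h
  have := rowMul_injective a.lin (add_right_cancel h)
  exact diagVec_injective this

/-- The lattice points of the coset of `a`. -/
def latticeEquiv (a : AUL S d) : (Fin d → ZS S) ≃ affineLattice a.coset :=
  Equiv.ofInjective _ (latticePoint_injective a)

lemma siegelTransform_coset {M : Type} [AddCommMonoid M] [TopologicalSpace M] (f : QSVec S d → M)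
    (a : AUL S d) : siegelTransform f a.coset = ∑' k, f (latticePoint a k) :=
  ((latticeEquiv a).tsum_eq fun v => f v.1).symm

/-- The sum of a function of two variables over all pairs of lattice points. -/
def pairSum (H : QSVec S d × QSVec S d → ℝ≥0∞) (x : AffSpace S d) : ℝ≥0∞ :=
  ∑' v : affineLattice x × affineLattice x, H (v.1, v.2)

lemma pairSum_coset (H : QSVec S d × QSVec S d → ℝ≥0∞) (a : AUL S d) :
    pairSum H a.coset = ∑' k : (Fin d → ZS S) × (Fin d → ZS S),
      H (latticePoint a k.1, latticePoint a k.2) :=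
  (((latticeEquiv a).prodCongr (latticeEquiv a)).tsum_eq fun v => H (v.1.1, v.2.1)).symm

lemma measurable_latticePoint (k : Fin d → ZS S) :
    Measurable fun a : AUL S d => latticePoint a k :=
  ((measurable_rowMul_const _).comp measurable_AUL_lin).add measurable_AUL_vec

lemma measurable_siegelTransform {f : QSVec S d → ℝ≥0∞} (hf : Measurable f) :
    Measurable (siegelTransform f) := by
  rw [measurable_AffSpace_iff]
  simp only [siegelTransform_coset]
  exact Measurable.tsum fun k => hf.comp (measurable_latticePoint k)

lemma measurable_pairSum {H : QSVec S d × QSVec S d → ℝ≥0∞} (hH : Measurable H) :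
    Measurable (pairSum H) := by
  rw [measurable_AffSpace_iff]
  simp only [pairSum_coset]
  exact Measurable.tsum fun k => hH.comp
    ((measurable_latticePoint k.1).prodMk (measurable_latticePoint k.2))

lemma latticePoint_rowMul (u : QSVec S d) (g : UL S d) (k : Fin d → ZS S) :
    latticePoint ⟨rowMul u g, g⟩ k = rowMul (u + diagVec k) g := by
  change rowMul (diagVec k) g + rowMul u g = _
  rw [rowMul_add, add_comm]

/-- The mean value of the Siegel transform. -/
theorem lintegral_siegelTransform {m : ℕ} (μ : Measure (UL S (m + 2))) [μ.IsHaarMeasure]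
    {f : QSVec S (m + 2) → ℝ≥0∞} (hf : Measurable f) :
    ∫⁻ x, siegelTransform f x ∂(affMeasure μ) = ∫⁻ v, f v ∂(volS S (m + 2)) := by
  obtain ⟨ν, F, -, hone, -, h⟩ := lintegral_affMeasure μ
  rw [h _ (measurable_siegelTransform hf)]
  -- No averaging over `g` is needed: the integral over each fibre is already the full integral,
  -- because the translates of the box tile space.
  have e : ∀ g : UL S (m + 2), ∫⁻ u in unitBox S (m + 2),
      siegelTransform f (AUL.coset ⟨rowMul u g, g⟩) ∂(volS S (m + 2)) =
        ∫⁻ v, f v ∂(volS S (m + 2)) := by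
    intro g
    have hm : ∀ k : Fin (m + 2) → ZS S, Measurable fun u => f (rowMul (u + diagVec k) g) := fun k =>
      (hf.comp (measurePreserving_rowMul g).measurable).comp (measurable_add_const _)
    simp only [siegelTransform_coset, latticePoint_rowMul]
    rw [← (measurePreserving_rowMul g).lintegral_comp hf, lintegral_eq_unitBox,
      lintegral_tsum fun k => (hm k).aemeasurable]
  simp only [e]
  rw [setLIntegral_const, hone, mul_one]

/-- The mean value of the sum over pairs of lattice points. -/
theorem lintegral_pairSum {m : ℕ} (μ : Measure (UL S (m + 2))) [μ.IsHaarMeasure]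
    {H : QSVec S (m + 2) × QSVec S (m + 2) → ℝ≥0∞} (hH : Measurable H) :
    ∫⁻ x, pairSum H x ∂(affMeasure μ) =
      ∫⁻ v, H v ∂((volS S (m + 2)).prod (volS S (m + 2))) + ∫⁻ v, H (v, v) ∂(volS S (m + 2)) := by
  obtain ⟨ν, F, _, hone, hsiegel, h⟩ := lintegral_affMeasure μ
  rw [h _ (measurable_pairSum hH)]
  set Φ : QSVec S (m + 2) → ℝ≥0∞ := fun w => ∫⁻ x, H (x, x + w) ∂(volS S (m + 2)) with hΦ
  have hshear : Measurable fun z : QSVec S (m + 2) × QSVec S (m + 2) => H (z.2, z.2 + z.1) :=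
    hH.comp (measurable_snd.prodMk (measurable_snd.add measurable_fst))
  have hΦm : Measurable Φ := hshear.lintegral_prod_right'
  have hw : ∀ w, Measurable fun x => H (x, x + w) := fun w =>
    hH.comp (measurable_id.prodMk (measurable_add_const w))
  have e : ∀ g : UL S (m + 2), ∫⁻ u in unitBox S (m + 2),
      pairSum H (AUL.coset ⟨rowMul u g, g⟩) ∂(volS S (m + 2)) =
        ∑' l : Fin (m + 2) → ZS S, Φ (rowMul (diagVec l) g) := by
    intro g
    -- Pairs are indexed by the difference `l` and the first vector `k`. The sum over `k` and the
    -- integral over the box combine to an integral over all of space, leaving a function of `l g`.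
    let σ : (Fin (m + 2) → ZS S) × (Fin (m + 2) → ZS S) ≃
        (Fin (m + 2) → ZS S) × (Fin (m + 2) → ZS S) :=
      ⟨fun x => (x.2, x.2 + x.1), fun x => (x.2 - x.1, x.1), fun x => by simp, fun x => by simp⟩
    have e1 : ∀ u, pairSum H (AUL.coset ⟨rowMul u g, g⟩) = ∑' l : Fin (m + 2) → ZS S,
        ∑' k : Fin (m + 2) → ZS S, H (rowMul (u + diagVec k) g,
          rowMul (u + diagVec k) g + rowMul (diagVec l) g) := by
      intro u
      rw [pairSum_coset, ← σ.tsum_eq, ENNReal.tsum_prod']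
      refine tsum_congr fun l => tsum_congr fun k => ?_
      change H (latticePoint _ k, latticePoint _ (k + l)) = _
      rw [latticePoint_rowMul, latticePoint_rowMul, diagVec_add, ← add_assoc,
        rowMul_add (u + diagVec k)]
    have hm : ∀ l k : Fin (m + 2) → ZS S, Measurable fun u => H (rowMul (u + diagVec k) g,
          rowMul (u + diagVec k) g + rowMul (diagVec l) g) := fun l k =>
      (hw _).comp ((measurePreserving_rowMul g).measurable.comp (measurable_add_const _))
    simp only [e1]
    rw [lintegral_tsum fun l => (Measurable.tsum fun k => hm l k).aemeasurable]
    refine tsum_congr fun l => ?_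
    rw [lintegral_tsum fun k => (hm l k).aemeasurable, hΦ]
    dsimp only
    rw [← (measurePreserving_rowMul g).lintegral_comp (hw _), lintegral_eq_unitBox]
  -- The zero difference gives the diagonal integral; the nonzero differences are averaged by
  -- Siegel's formula.
  simp only [e, tsum_eq_zero_add_tsum_ne]
  rw [lintegral_add_left (by
    simp only [diagVec_zero, rowMul_zero]; exact measurable_const), add_comm]
  congr 1
  · rw [← lintegral_orbitMeasure ν F {k : Fin (m + 2) → ZS S | k ≠ 0} hΦm, hsiegel,
      lintegral_prod _ hH.aemeasurable]
    calc ∫⁻ w, Φ w ∂(volS S (m + 2))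
        = ∫⁻ x, ∫⁻ w, H (x, x + w) ∂(volS S (m + 2)) ∂(volS S (m + 2)) :=
          lintegral_lintegral_swap hshear.aemeasurable
      _ = _ := lintegral_congr fun x => lintegral_add_left_eq_self (fun w => H (x, w)) x
  · simp only [diagVec_zero, rowMul_zero, hΦ, add_zero]
    rw [setLIntegral_const, hone, mul_one]

end Affine

/-! ### Real-valued functions and characteristic functions -/

section RealValued

variable {S : Finset Nat.Primes} {d : ℕ}

/-- The number of lattice points in a ball is at most the volume of a larger ball. Consequently the
sums of compactly supported functions are finite sums. -/
lemma finite_latticePoint_norm_le (a : AUL S d) (R : ℝ) :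
    {k : Fin d → ZS S | ‖latticePoint a k‖ ≤ R}.Finite := by
  obtain ⟨r, -, hr⟩ := exists_bound_rowMul a.lin
  set A : Set (QSVec S d) := Metric.closedBall 0 (R + ‖a.vec‖)
  set A' : Set (QSVec S d) := Metric.closedBall 0 (r + (R + ‖a.vec‖))
  have h := latticeCount_le (A := A) (A' := A') Metric.isClosed_closedBall.measurableSet a.lin (by
    intro u hu v hv
    rw [mem_closedBall_zero_iff] at hv ⊢
    exact (norm_add_le _ _).trans (add_le_add (hr u hu) hv))
  have hfin : latticeCount A a.lin ≠ ∞ :=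
    ne_top_of_le_ne_top (isCompact_closedBall _ _).measure_lt_top.ne h
  refine (ENNReal.finite_const_le_of_tsum_ne_top hfin one_ne_zero).subset fun k hk => ?_
  have hk' : ‖rowMul (diagVec k) a.lin + a.vec‖ ≤ R := hk
  have hmem : rowMul (diagVec k) a.lin ∈ A := by
    rw [mem_closedBall_zero_iff]
    calc ‖rowMul (diagVec k) a.lin‖ = ‖(rowMul (diagVec k) a.lin + a.vec) - a.vec‖ := by
          rw [add_sub_cancel_right]
      _ ≤ R + ‖a.vec‖ := (norm_sub_le _ _).trans (by linarith)
  rw [Set.mem_ofPred_eq, Set.indicator_of_mem hmem]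

lemma exists_norm_bound_of_hasCompactSupport {E : Type*} [NormedAddCommGroup E] {f : E → ℝ}
    (hf : HasCompactSupport f) : ∃ R, ∀ v, f v ≠ 0 → ‖v‖ ≤ R := by
  obtain ⟨R, hR⟩ := hf.isBounded.exists_norm_le
  exact ⟨R, fun v hv => hR v (subset_tsupport f hv)⟩

lemma summable_latticePoint {f : QSVec S d → ℝ} (hf : HasCompactSupport f) (a : AUL S d) :
    Summable fun k => f (latticePoint a k) := by
  obtain ⟨R, hR⟩ := exists_norm_bound_of_hasCompactSupport hf
  exact summable_of_hasFiniteSupport ((finite_latticePoint_norm_le a R).subset fun k hk => hR _ hk)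

lemma summable_latticePoint_pair {F : QSVec S d × QSVec S d → ℝ} (hF : HasCompactSupport F)
    (a : AUL S d) : Summable fun k : (Fin d → ZS S) × (Fin d → ZS S) =>
      F (latticePoint a k.1, latticePoint a k.2) := by
  obtain ⟨R, hR⟩ := exists_norm_bound_of_hasCompactSupport hF
  have hfin := finite_latticePoint_norm_le a R
  refine summable_of_hasFiniteSupport ((hfin.prod hfin).subset fun k hk => ?_)
  have := hR _ hk
  exact ⟨(norm_fst_le _).trans this, (norm_snd_le _).trans this⟩

lemma lintegral_ofReal_ne_top {E : Type*} [NormedAddCommGroup E] [ProperSpace E]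
    [MeasurableSpace E] [OpensMeasurableSpace E] (ν : Measure E) [IsFiniteMeasureOnCompacts ν]
    {f : E → ℝ} (hC : ∃ C, ∀ v, f v ≤ C) (hf : HasCompactSupport f) :
    ∫⁻ v, ENNReal.ofReal (f v) ∂ν ≠ ∞ := by
  obtain ⟨C, hC⟩ := hC
  obtain ⟨R, hR⟩ := exists_norm_bound_of_hasCompactSupport hf
  have h : ∀ v, ENNReal.ofReal (f v) ≤
      (Metric.closedBall (0 : E) R).indicator (fun _ => ENNReal.ofReal C) v := by
    intro v
    by_cases hv : f v = 0
    · rw [hv, ENNReal.ofReal_zero]; exact zero_le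
    · rw [Set.indicator_of_mem (mem_closedBall_zero_iff.2 (hR v hv))]
      exact ENNReal.ofReal_le_ofReal (hC v)
  refine ne_top_of_le_ne_top ?_ (lintegral_mono h)
  rw [lintegral_indicator_const Metric.isClosed_closedBall.measurableSet]
  exact ENNReal.mul_ne_top ENNReal.ofReal_ne_top (isCompact_closedBall _ _).measure_lt_top.ne

lemma integral_eq_toReal_lintegral {α : Type*} [MeasurableSpace α] (ν : Measure α) {f : α → ℝ}
    (hf : Measurable f) (h0 : ∀ v, 0 ≤ f v) :
    ∫ v, f v ∂ν = (∫⁻ v, ENNReal.ofReal (f v) ∂ν).toReal :=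
  integral_eq_lintegral_of_nonneg_ae (Filter.Eventually.of_forall h0) hf.aestronglyMeasurable

lemma forall_coset {P : AffSpace S d → Prop} (h : ∀ a : AUL S d, P a.coset) (x : AffSpace S d) :
    P x := Quotient.ind h x

theorem siegelTransform_real {m : ℕ} (μ : Measure (UL S (m + 2))) [μ.IsHaarMeasure]
    {f : QSVec S (m + 2) → ℝ} (hf : Measurable f) (h0 : ∀ v, 0 ≤ f v) (hC : ∃ C, ∀ v, f v ≤ C)
    (hs : HasCompactSupport f) :
    (∀ x : AffSpace S (m + 2), Summable fun v : affineLattice x => f v) ∧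
      Integrable (siegelTransform f) (affMeasure μ) ∧
      (∫ x, siegelTransform f x ∂(affMeasure μ)) = ∫ v, f v ∂(volS S (m + 2)) := by
  have hsum : ∀ x : AffSpace S (m + 2), Summable fun v : affineLattice x => f v :=
    forall_coset fun a => (latticeEquiv a).summable_iff.1 (summable_latticePoint hs a)
  set φ : QSVec S (m + 2) → ℝ≥0∞ := fun v => ENNReal.ofReal (f v)
  have hφ : Measurable φ := hf.ennreal_ofReal
  have e0 : ∀ x, siegelTransform φ x = ENNReal.ofReal (siegelTransform f x) := fun x =>
    (ENNReal.ofReal_tsum_of_nonneg (fun v => h0 _) (hsum x)).symm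
  have e : siegelTransform f = fun x : AffSpace S (m + 2) => (siegelTransform φ x).toReal := by
    funext x
    have hnn : 0 ≤ siegelTransform f x := tsum_nonneg fun v => h0 _
    rw [e0, ENNReal.toReal_ofReal hnn]
  have hfin : ∫⁻ x, siegelTransform φ x ∂(affMeasure μ) ≠ ∞ := by
    rw [lintegral_siegelTransform μ hφ]
    exact lintegral_ofReal_ne_top _ hC hs
  have hm := (measurable_siegelTransform hφ).aemeasurable (μ := affMeasure μ)
  refine ⟨hsum, ?_, ?_⟩
  · rw [e]
    exact integrable_toReal_of_lintegral_ne_top hm hfin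
  · rw [e, integral_toReal hm (Filter.Eventually.of_forall fun x => by
      rw [e0]; exact ENNReal.ofReal_lt_top), lintegral_siegelTransform μ hφ,
      integral_eq_toReal_lintegral _ hf h0]

theorem pairTransform_real {m : ℕ} (μ : Measure (UL S (m + 2))) [μ.IsHaarMeasure]
    {F : QSVec S (m + 2) × QSVec S (m + 2) → ℝ} (hF : Measurable F) (h0 : ∀ v, 0 ≤ F v)
    (hC : ∃ C, ∀ v, F v ≤ C) (hs : HasCompactSupport F) :
    Integrable (pairTransform F) (affMeasure μ) ∧
      (∫ x, pairTransform F x ∂(affMeasure μ)) =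
        (∫ v, F v ∂((volS S (m + 2)).prod (volS S (m + 2)))) + ∫ v, F (v, v) ∂(volS S (m + 2)) := by
  set H : QSVec S (m + 2) × QSVec S (m + 2) → ℝ≥0∞ := fun v => ENNReal.ofReal (F v)
  have hH : Measurable H := hF.ennreal_ofReal
  have e0 : ∀ x, pairSum H x = ENNReal.ofReal (pairTransform F x) := forall_coset fun a => by
    rw [pairSum_coset]
    exact (ENNReal.ofReal_tsum_of_nonneg (fun k => h0 _) (summable_latticePoint_pair hs a)).symm
  have hnn : ∀ x, 0 ≤ pairTransform F x := forall_coset fun a => tsum_nonneg fun k => h0 _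
  have e : pairTransform F = fun x : AffSpace S (m + 2) => (pairSum H x).toReal := by
    funext x
    rw [e0, ENNReal.toReal_ofReal (hnn x)]
  have hdiag : Measurable fun v : QSVec S (m + 2) => F (v, v) :=
    hF.comp (measurable_id.prodMk measurable_id)
  have : OpensMeasurableSpace (QSVec S (m + 2) × QSVec S (m + 2)) := Prod.opensMeasurableSpace
  have h1 : ∫⁻ v, H v ∂((volS S (m + 2)).prod (volS S (m + 2))) ≠ ∞ :=
    lintegral_ofReal_ne_top _ hC hs
  have h2 : ∫⁻ v, H (v, v) ∂(volS S (m + 2)) ≠ ∞ := by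
    refine lintegral_ofReal_ne_top (f := fun v => F (v, v)) _ (hC.imp fun C h v => h _) ?_
    obtain ⟨R, hR⟩ := exists_norm_bound_of_hasCompactSupport hs
    refine HasCompactSupport.of_support_subset_isCompact
      (isCompact_closedBall (0 : QSVec S (m + 2)) R) fun v hv => ?_
    rw [mem_closedBall_zero_iff]
    exact (norm_fst_le (v, v)).trans (hR _ hv)
  have hfin : ∫⁻ x, pairSum H x ∂(affMeasure μ) ≠ ∞ := by
    rw [lintegral_pairSum μ hH]
    exact ENNReal.add_ne_top.2 ⟨h1, h2⟩
  have hm := (measurable_pairSum hH).aemeasurable (μ := affMeasure μ)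
  refine ⟨?_, ?_⟩
  · rw [e]
    exact integrable_toReal_of_lintegral_ne_top hm hfin
  · rw [e, integral_toReal hm (Filter.Eventually.of_forall fun x => by
      rw [e0]; exact ENNReal.ofReal_lt_top), lintegral_pairSum μ hH, ENNReal.toReal_add h1 h2,
      integral_eq_toReal_lintegral _ hF h0, integral_eq_toReal_lintegral _ hdiag fun v => h0 _]

theorem lintegral_siegelTransform_indicator_sq {m : ℕ} (μ : Measure (UL S (m + 2)))
    [μ.IsHaarMeasure] {A : Set (QSVec S (m + 2))} (hA : MeasurableSet A) :
    ∫⁻ x, siegelTransform (A.indicator fun _ => (1 : ℝ≥0∞)) x ^ 2 ∂(affMeasure μ) =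
      volS S (m + 2) A ^ 2 + volS S (m + 2) A := by
  set φ : QSVec S (m + 2) → ℝ≥0∞ := A.indicator fun _ => 1
  have hφ : Measurable φ := measurable_one.indicator hA
  have hvol : ∫⁻ v, φ v ∂(volS S (m + 2)) = volS S (m + 2) A := lintegral_indicator_one hA
  have hH : Measurable fun v : QSVec S (m + 2) × QSVec S (m + 2) => φ v.1 * φ v.2 :=
    (hφ.comp measurable_fst).mul (hφ.comp measurable_snd)
  -- In `[0, ∞]` the square of a sum is always the sum over pairs, so neither boundedness nor finite
  -- measure of `A` is needed.
  have e : ∀ x, siegelTransform φ x ^ 2 = pairSum (fun v => φ v.1 * φ v.2) x := by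
    intro x
    unfold pairSum siegelTransform
    rw [ENNReal.tsum_prod', sq]
    simp only [ENNReal.tsum_mul_left, ENNReal.tsum_mul_right]
  have hsq : ∀ v, φ v * φ v = φ v := by
    intro v
    by_cases hv : v ∈ A
    · simp only [φ, Set.indicator_of_mem hv, mul_one]
    · simp only [φ, Set.indicator_of_notMem hv, mul_zero]
  simp only [e]
  rw [lintegral_pairSum μ hH, lintegral_prod_mul hφ.aemeasurable hφ.aemeasurable]
  simp only [hsq, hvol, sq]

end RealValued

end SArith

end

theorem theorem6p1 (S : Finset Nat.Primes) (d : ℕ) (hd : 2 ≤ d)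
    (μ : Measure (SArith.UL S d)) [μ.IsHaarMeasure] :
    IsProbabilityMeasure (SArith.affMeasure μ) ∧
    (∀ f : SArith.QSVec S d → ℝ, Measurable f → (∀ v, 0 ≤ f v) → (∃ C, ∀ v, f v ≤ C) →
      HasCompactSupport f →
        (∀ x : SArith.AffSpace S d, Summable fun v : SArith.affineLattice x => f v) ∧
        Integrable (SArith.siegelTransform f) (SArith.affMeasure μ) ∧
        (∫ x, SArith.siegelTransform f x ∂(SArith.affMeasure μ)) = ∫ v, f v ∂(SArith.volS S d)) ∧
    (∀ F : SArith.QSVec S d × SArith.QSVec S d → ℝ, Measurable F → (∀ v, 0 ≤ F v) →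
      (∃ C, ∀ v, F v ≤ C) → HasCompactSupport F →
        (∀ a : SArith.AUL S d, Summable fun k : (Fin d → SArith.ZS S) × (Fin d → SArith.ZS S) =>
          F (SArith.latticePoint a k.1, SArith.latticePoint a k.2)) ∧
        Integrable (SArith.pairTransform F) (SArith.affMeasure μ) ∧
        (∫ x, SArith.pairTransform F x ∂(SArith.affMeasure μ)) =
          (∫ v, F v ∂((SArith.volS S d).prod (SArith.volS S d))) +
            ∫ v, F (v, v) ∂(SArith.volS S d)) ∧
    (∀ A : Set (SArith.QSVec S d), MeasurableSet A →
      AEMeasurable (SArith.siegelTransform (A.indicator fun _ => (1 : ℝ≥0∞)))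
        (SArith.affMeasure μ) ∧
      (∫⁻ x, SArith.siegelTransform (A.indicator fun _ => (1 : ℝ≥0∞)) x ^ 2
          ∂(SArith.affMeasure μ)) =
        SArith.volS S d A ^ 2 + SArith.volS S d A) := by
  obtain ⟨m, rfl⟩ : ∃ m, d = m + 2 := ⟨d - 2, by omega⟩
  refine ⟨SArith.isProbabilityMeasure_affMeasure μ, fun f hf h0 hC hs =>
    SArith.siegelTransform_real μ hf h0 hC hs, fun F hF h0 hC hs =>
    ⟨SArith.summable_latticePoint_pair hs, SArith.pairTransform_real μ hF h0 hC hs⟩, fun A hA =>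
    ⟨?_, SArith.lintegral_siegelTransform_indicator_sq μ hA⟩⟩
  exact (SArith.measurable_siegelTransform (measurable_one.indicator hA)).aemeasurable
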